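/- An additively separable hedonic game (ASHG) is a directed graph $G=(V,E)$ with a weight function $w:V\times V\to\mathbb{Z}$ such that $w(u,v)=0$ whenever $uv\notin E$. For $v\in V$ and $S\subseteq V$ let $p_v(S)=\sum_{u\in S\setminus\{v\}}w(v,u)$. A partition $\pi$ of $V$ is Nash Stable if for every $v\in V$, with $v\in S\in\pi$, we have $p_v(S)\ge 0$ and $p_v(S)\ge p_v(S')$ for all $S'\in\pi$. Let $n=|V|$, let $\Delta$ and $p$ be the maximum degree and the pathwidth of the underlying undirected graph of $G$, and let $W=\max_{u,v}|w(u,v)|$. **Theorem.** Assume the Exponential Time Hypothesis, in the (weaker) form that 3-SAT on formulas with $n$ variables cannot be decided in time $2^{o(n)}\cdot|\varphi|^{O(1)}$, where $|\varphi|$ is the size of the formula. Then there is no algorithm which decides whether a given ASHG admits a Nash Stable partition in time $(p\Delta)^{o(p\Delta)}\,(nW)^{O(1)}$. That is, there are no algorithm, function $f:\mathbb{N}\to\mathbb{R}$ with $f(k)=o(k)$ and constant $C\in\mathbb{N}$ such that the algorithm decides the problem correctly and takes at most $$C\cdot(p\Delta+2)^{f(p\Delta)}\cdot\bigl((n+2)(W+2)\bigr)^{C}$$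 steps on every ASHG. (Algorithms are multi-stack, equivalently multi-tape, Turing machines; weights are given in binary. The added constants $2$ only avoid degenerate bounds when $p\Delta\le 1$ or $nW\le 1$.) -/

import Mathlib

open Computability

/-! ### Graphs: path decompositions and pathwidth -/

/-- A path decomposition of a graph: a finite sequence of bags covering all vertices and all edges,
such that the bags containing any given vertex are consecutive. -/
structure PathDecomposition {V : Type*} (G : SimpleGraph V) where
  length : ℕ
  bag : Fin length → Finset V
  vertex_mem : ∀ v, ∃ i, v ∈ bag i
  edge_mem : ∀ u v, G.Adj u v → ∃ i, u ∈ bag i ∧ v ∈ bag i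
  consecutive : ∀ v i j k, i ≤ j → j ≤ k → v ∈ bag i → v ∈ bag k → v ∈ bag j

/-- The pathwidth: the least `k` such that some path decomposition has all bags of size at most
`k + 1`. (The graph without vertices gets pathwidth `0`.) -/
noncomputable def pathwidth {V : Type*} (G : SimpleGraph V) : ℕ :=
  sInf {k | ∃ D : PathDecomposition G, ∀ i, (D.bag i).card ≤ k + 1}

/-- On a finite vertex type the set whose infimum is the pathwidth is not empty, and the pathwidth
is attained. -/
theorem exists_pathDecomposition_card_le {V : Type*} [Fintype V] (G : SimpleGraph V) :
    ∃ D : PathDecomposition G, ∀ i, (D.bag i).card ≤ pathwidth G + 1 := by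
  have h : {k | ∃ D : PathDecomposition G, ∀ i, (D.bag i).card ≤ k + 1}.Nonempty :=
    ⟨Fintype.card V, ⟨1, fun _ => Finset.univ, by simp, by simp, by simp⟩, fun _ => by
      simp [Finset.card_univ]⟩
  exact Nat.sInf_mem h

/-! ### Additively separable hedonic games -/

/-- An additively separable hedonic game on the vertex set `V`: a directed graph with integer
weights that vanish outside the arcs. `weight v u` is the utility that `v` gains from `u`. -/
structure ASHG (V : Type*) where
  graph : Digraph V
  weight : V → V → ℤ
  weight_eq_zero : ∀ u v, ¬ graph.Adj u v → weight u v = 0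

namespace ASHG

variable {V : Type*} [Fintype V] [DecidableEq V] (G : ASHG V)

/-- The utility of `v` in the coalition `S`: the sum of `weight v u` over `u ∈ S \ {v}`. -/
def utility (v : V) (S : Finset V) : ℤ := ∑ u ∈ S.erase v, G.weight v u

/-- A partition of the vertices is Nash stable if no vertex can strictly increase its utility by
joining another coalition or by forming a singleton coalition. -/
def NashStable (π : Finpartition (Finset.univ : Finset V)) : Prop :=
  ∀ v, ∀ S ∈ π.parts, v ∈ S →
    0 ≤ G.utility v S ∧ ∀ S' ∈ π.parts, G.utility v S' ≤ G.utility v S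

/-- The game admits a Nash stable partition. -/
def HasNashStablePartition : Prop := ∃ π, G.NashStable π

/-- The underlying undirected graph. -/
def underlying : SimpleGraph V := G.graph.toSimpleGraphInclusive

open Classical in
/-- The maximum degree `Δ` of the underlying graph. -/
noncomputable def maxDegree : ℕ := G.underlying.maxDegree

/-- The maximum absolute weight `W`. -/
def maxWeight : ℕ := Finset.univ.sup fun e : V × V => (G.weight e.1 e.2).natAbs

end ASHG

/-- An instance of Nash Stability: a number `n` of vertices and a game on `Fin n`. -/
structure ASHGInstance where
  n : ℕ
  game : ASHG (Fin n)

namespace ASHGInstance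

/-- The number `p * Δ`: pathwidth times maximum degree, both of the underlying graph. -/
noncomputable def param (I : ASHGInstance) : ℕ := pathwidth I.game.underlying * I.game.maxDegree

open Classical in
/-- One entry of the weighted adjacency matrix: a bit for the presence of the arc, a sign bit, the
binary digits of the absolute weight (least significant first), and a delimiter. -/
noncomputable def encodeEntry {n : ℕ} (G : ASHG (Fin n)) (u v : Fin n) : List Γ' :=
  Γ'.bit (decide (G.graph.Adj u v)) :: Γ'.bit (decide (G.weight u v < 0)) ::
    ((G.weight u v).natAbs.bits.map Γ'.bit ++ [Γ'.comma])

/-- The encoding of an instance: `n` in unary, followed by the weighted adjacency matrix, row by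
row, with weights in binary. -/
noncomputable def encode (I : ASHGInstance) : List Γ' :=
  List.replicate I.n (Γ'.bit true) ++ Γ'.comma ::
    (List.finRange I.n).flatMap fun u => (List.finRange I.n).flatMap fun v =>
      encodeEntry I.game u v

end ASHGInstance

/-! ### 3-SAT -/

/-- A 3-CNF formula with variables `x_0, …, x_{n-1}`. A literal is a pair `(k, b)`, which stands for
`x_k` if `b` is true and for `¬ x_k` otherwise. Every clause has three literals, which may repeat. -/
structure ThreeCNF where
  n : ℕ
  clauses : List (Fin 3 → Fin n × Bool)

namespace ThreeCNF

def Satisfiable (φ : ThreeCNF) : Prop :=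
  ∃ a : Fin φ.n → Bool, ∀ c ∈ φ.clauses, ∃ i, a (c i).1 = (c i).2

/-- A literal: its sign, the index of its variable in unary, and a delimiter. -/
def encodeLiteral {n : ℕ} (l : Fin n × Bool) : List Γ' :=
  Γ'.bit l.2 :: (List.replicate (l.1 : ℕ) (Γ'.bit true) ++ [Γ'.comma])

/-- The encoding of a formula: the number of variables in unary, followed by the clauses. -/
def encode (φ : ThreeCNF) : List Γ' :=
  List.replicate φ.n (Γ'.bit true) ++ Γ'.comma ::
    φ.clauses.flatMap fun c => encodeLiteral (c 0) ++ encodeLiteral (c 1) ++ encodeLiteral (c 2)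

end ThreeCNF

/-! ### The encodings are faithful -/

theorem append_comma_inj {a b s t : List Γ'} (ha : Γ'.comma ∉ a) (hb : Γ'.comma ∉ b)
    (h : a ++ Γ'.comma :: s = b ++ Γ'.comma :: t) : a = b ∧ s = t := by
  induction a generalizing b with
  | nil => cases b with
    | nil => simpa using h
    | cons y b => simp only [List.nil_append, List.cons_append, List.cons.injEq] at h; simp [← h.1] at hb
  | cons x a ih => cases b with
    | nil => simp only [List.nil_append, List.cons_append, List.cons.injEq] at h; simp [h.1] at ha
    | cons y b =>
      simp only [List.cons_append, List.cons.injEq] at h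
      have := ih (fun h' => ha (List.mem_cons_of_mem _ h')) (fun h' => hb (List.mem_cons_of_mem _ h'))
        h.2
      exact ⟨by rw [h.1, this.1], this.2⟩

theorem ThreeCNF.encodeLiteral_append_inj {n : ℕ} {l l' : Fin n × Bool} {s t : List Γ'}
    (h : encodeLiteral l ++ s = encodeLiteral l' ++ t) : l = l' ∧ s = t := by
  simp only [encodeLiteral, List.cons_append, List.append_assoc, List.nil_append,
    List.cons.injEq, Γ'.bit.injEq] at h
  obtain ⟨h1, h2⟩ := append_comma_inj (by simp [List.mem_replicate]) (by simp [List.mem_replicate])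
    h.2
  have h3 := congrArg List.length h1
  simp only [List.length_replicate] at h3
  exact ⟨Prod.ext (Fin.ext h3) h.1, h2⟩

theorem ThreeCNF.encode_injective : Function.Injective ThreeCNF.encode := by
  rintro ⟨n, c⟩ ⟨n', c'⟩ h
  obtain ⟨h1, h2⟩ := append_comma_inj (by simp [List.mem_replicate]) (by simp [List.mem_replicate]) h
  have h3 := congrArg List.length h1
  simp only [List.length_replicate] at h3
  subst h3
  congr 1
  clear h h1
  simp only at h2
  induction c generalizing c' with
  | nil => cases c' with
    | nil => rfl
    | cons x c' => simp [encodeLiteral] at h2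
  | cons x c ih => cases c' with
    | nil => simp [encodeLiteral] at h2
    | cons y c' =>
      rw [List.flatMap_cons, List.flatMap_cons, List.append_assoc, List.append_assoc,
        List.append_assoc, List.append_assoc] at h2
      obtain ⟨e0, h2⟩ := encodeLiteral_append_inj h2
      obtain ⟨e1, h2⟩ := encodeLiteral_append_inj h2
      obtain ⟨e2, h2⟩ := encodeLiteral_append_inj h2
      rw [ih _ h2]
      congr 1
      funext i
      fin_cases i <;> assumption

theorem ASHGInstance.encodeEntry_append_inj {n : ℕ} {G G' : ASHG (Fin n)} {u v : Fin n}
    {s t : List Γ'} (h : encodeEntry G u v ++ s = encodeEntry G' u v ++ t) :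
    ((G.graph.Adj u v ↔ G'.graph.Adj u v) ∧ G.weight u v = G'.weight u v) ∧ s = t := by
  simp only [encodeEntry, List.cons_append, List.append_assoc, List.nil_append,
    List.cons.injEq, Γ'.bit.injEq, decide_eq_decide] at h
  obtain ⟨h1, h2, h3⟩ := h
  obtain ⟨h3, h4⟩ := append_comma_inj (by simp) (by simp) h3
  have h5 := List.map_injective_iff.2 (fun a b h => by simpa using h) h3
  have h6 : (G.weight u v).natAbs = (G'.weight u v).natAbs := by
    have h7 := congrArg (List.map fun b => cond b 1 0) h5
    rw [← Nat.digits_two_eq_bits, ← Nat.digits_two_eq_bits] at h7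
    exact Nat.digits_inj_iff.1 h7
  exact ⟨⟨h1, by omega⟩, h4⟩

theorem flatMap_append_inj {ι : Type*} {P : ι → Prop} {f g : ι → List Γ'}
    (H : ∀ i s t, f i ++ s = g i ++ t → P i ∧ s = t) (l : List ι) {s t : List Γ'}
    (h : l.flatMap f ++ s = l.flatMap g ++ t) : (∀ i ∈ l, P i) ∧ s = t := by
  induction l with
  | nil => simpa using h
  | cons x l ih =>
    simp only [List.flatMap_cons, List.append_assoc] at h
    obtain ⟨h1, h2⟩ := H _ _ _ h
    obtain ⟨h3, h4⟩ := ih h2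
    exact ⟨by simpa [h1] using h3, h4⟩

theorem ASHGInstance.encode_injective : Function.Injective ASHGInstance.encode := by
  rintro ⟨n, G⟩ ⟨n', G'⟩ h
  obtain ⟨h1, h2⟩ := append_comma_inj (by simp [List.mem_replicate]) (by simp [List.mem_replicate]) h
  have h3 := congrArg List.length h1
  simp only [List.length_replicate] at h3
  subst h3
  congr 1
  have h4 := (flatMap_append_inj (f := fun u => (List.finRange n).flatMap (encodeEntry G u))
    (g := fun u => (List.finRange n).flatMap (encodeEntry G' u))
    (P := fun u => ∀ v, (G.graph.Adj u v ↔ G'.graph.Adj u v) ∧ G.weight u v = G'.weight u v)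
    (fun u s t hu => by
      have := flatMap_append_inj (f := encodeEntry G u) (g := encodeEntry G' u)
        (P := fun v => (G.graph.Adj u v ↔ G'.graph.Adj u v) ∧ G.weight u v = G'.weight u v)
        (fun v _ _ hv => encodeEntry_append_inj hv) _ hu
      exact ⟨fun v => this.1 v (List.mem_finRange v), this.2⟩) (List.finRange n)
      (s := []) (t := []) (by simpa using h2)).1
  obtain ⟨D, w, _⟩ := G
  obtain ⟨D', w', _⟩ := G'
  have hD : D = D' := by
    ext u v
    exact (h4 u (List.mem_finRange u) v).1
  have hw : w = w' := by
    funext u v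
    exact (h4 u (List.mem_finRange u) v).2
  subst hD hw
  rfl

/-! ### Algorithms and running times -/

/-- The multi-stack Turing machine `M` (with input alphabet `Γ`, and output alphabet `Bool`) decides
the problem `P`, whose instances are encoded by `enc`: on every instance `a` it halts after at most
`T a` steps with output `true` if `P a` holds and with output `false` otherwise. -/
def DecidesInTime {α Γ : Type} (M : Turing.TM2ComputableAux Γ Bool) (enc : α → List Γ)
    (P : α → Prop) (T : α → ℝ) : Prop :=
  ∀ a, ∃ (b : Bool) (t : ℕ), (b = true ↔ P a) ∧ (t : ℝ) ≤ T a ∧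
    Nonempty (Turing.TM2OutputsInTime M.tm ((enc a).map M.inputAlphabet.invFun)
      (some ([b].map M.outputAlphabet.invFun)) t)

/-- The Exponential Time Hypothesis: for some `c > 1`, no algorithm solves 3-SAT in time `c ^ n`,
up to a factor polynomial in the size of the formula, where `n` is the number of variables. -/
def ETH : Prop :=
  ∃ c : ℝ, 1 < c ∧ ¬ ∃ (M : Turing.TM2ComputableAux Γ' Bool) (C : ℕ),
    DecidesInTime M ThreeCNF.encode ThreeCNF.Satisfiable
      fun φ => C * c ^ φ.n * ((φ.encode.length : ℝ) + 1) ^ C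

/-- The weaker form of the Exponential Time Hypothesis: no algorithm solves 3-SAT in time
`2 ^ o(n)`, up to a factor polynomial in the size of the formula. -/
def SubexpETH : Prop :=
  ¬ ∃ (M : Turing.TM2ComputableAux Γ' Bool) (f : ℕ → ℝ) (C : ℕ),
    f =o[Filter.atTop] (fun k : ℕ => (k : ℝ)) ∧
    DecidesInTime M ThreeCNF.encode ThreeCNF.Satisfiable
      fun φ => C * (2 : ℝ) ^ f φ.n * ((φ.encode.length : ℝ) + 1) ^ C

/-- The Exponential Time Hypothesis implies its weaker form. -/
theorem ETH.subexpETH (h : ETH) : SubexpETH := by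
  obtain ⟨c, hc, h⟩ := h
  rintro ⟨M, f, C, hf, hM⟩
  apply h
  have hl : 0 < Real.logb 2 c := Real.logb_pos one_lt_two hc
  obtain ⟨N, hN⟩ := Filter.eventually_atTop.1 (hf.bound hl)
  set B : ℝ := 1 + ∑ k ∈ Finset.range N, (2 : ℝ) ^ f k with hB
  have hs : ∀ k, (2 : ℝ) ^ f k ≤ B * c ^ k := by
    intro k
    have hp : ∀ i, 0 ≤ (2 : ℝ) ^ f i := fun i => by positivity
    have hck : 1 ≤ c ^ k := one_le_pow₀ hc.le
    rcases lt_or_ge k N with hk | hk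
    · have h1 : (2 : ℝ) ^ f k ≤ B := by
        have := Finset.single_le_sum (fun i _ => hp i) (Finset.mem_range.2 hk)
        linarith
      nlinarith [hp k]
    · have h1 : f k ≤ Real.logb 2 c * k := by
        have := hN k hk
        simp only [Real.norm_eq_abs, Nat.abs_cast] at this
        exact (le_abs_self _).trans this
      have h2 : (2 : ℝ) ^ f k ≤ c ^ k := by
        calc (2 : ℝ) ^ f k ≤ 2 ^ (Real.logb 2 c * k) :=
              Real.rpow_le_rpow_of_exponent_le one_le_two h1
          _ = c ^ k := by
              rw [Real.rpow_mul zero_le_two, Real.rpow_logb two_pos (by norm_num) (by linarith),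
                Real.rpow_natCast]
      have h3 : 1 ≤ B := by
        have := Finset.sum_nonneg (fun i (_ : i ∈ Finset.range N) => hp i)
        linarith
      nlinarith
  have hB0 : 0 ≤ B := by positivity
  obtain ⟨b, hb⟩ := exists_nat_ge B
  refine ⟨M, C * (b + 1), fun φ => ?_⟩
  obtain ⟨r, t, hr, ht, ho⟩ := hM φ
  refine ⟨r, t, hr, ht.trans ?_, ho⟩
  have hC : (C : ℝ) * (2 : ℝ) ^ f φ.n ≤ ((C * (b + 1) : ℕ) : ℝ) * c ^ φ.n := by
    have h1 := hs φ.n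
    have h2 : 0 < c ^ φ.n := by positivity
    have h3 : (2 : ℝ) ^ f φ.n ≤ ((b : ℝ) + 1) * c ^ φ.n := by nlinarith
    push_cast
    calc (C : ℝ) * (2 : ℝ) ^ f φ.n ≤ C * (((b : ℝ) + 1) * c ^ φ.n) := by gcongr
      _ = _ := by ring
  have hL : ((φ.encode.length : ℝ) + 1) ^ C ≤ ((φ.encode.length : ℝ) + 1) ^ (C * (b + 1)) :=
    pow_le_pow_right₀ (by linarith [Nat.cast_nonneg (α := ℝ) φ.encode.length])
      (Nat.le_mul_of_pos_right _ (Nat.succ_pos b))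
  exact mul_le_mul hC hL (by positivity) (by positivity)

/-!
A fast algorithm for Nash stability is turned into a subexponential one for 3-SAT. A formula `φ`
with `n` variables is mapped in polynomial time to a game `φ.game` with weights of absolute value at
most `6`, bounded degree and pathwidth `O(n / log n)`, which has a Nash stable partition if and only
if `φ` is satisfiable. Since `(n / log n) ^ o(n / log n)` is `2 ^ o(n)`, an algorithm for games with
the running time that is excluded by the theorem would decide 3-SAT in time `2 ^ o(n)`, up to a
polynomial factor.

*The game.* The variables are divided into `O(n / log n)` groups of about `(log₂ n) / 2` variables
each. An assignment of the variables of one group is one of `t = O(√n)` labels. The game has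
`t + 1` layers of vertices for every clause. A line (a vertex in each layer, whose only arc has
weight `1` and leads to the same vertex in the previous layer) has a constant colour, where colours
are the classes of the partition. There is one line for each group, one for each label, and one
*truth line*. A label counts as assigned to a group if their lines have the same colour. In the layers of a clause, each of its three literals has a *walker*, which starts off the
truth line and off the line of the group of its variable. The step to layer `q + 1` tests the label
`q`: if that label makes the variable true and has the colour of the group, then a *comparer* leaves
the walker for this colour, and the walker moves to the truth line; otherwise the comparer stays
with the walker and the walker keeps its colour (`ThreeCNF.Stable.color_walker`). In the last layer
of a clause the walkers know the values of the three variables. There a *chaser* prefers its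
*runner*, which wants to avoid it, to everything but the truth line, and it is content with the
truth line only if some literal is satisfied. So no partition that leaves a clause unsatisfied is
stable (`ThreeCNF.Stable.exists_walker`), and conversely a satisfying assignment yields a stable colouring
(`ThreeCNF.stable_plan`). Arcs do not skip layers, so that pairs of consecutive layers form a path
decomposition (`ThreeCNF.param_le`).

*The running time.* Machines are obtained from structured programs on stacks. A small language of
arithmetic expressions with bounded sums, which can inspect the input, is compiled into such programs
with a polynomial time bound (`CountExpr.exists_runsIn`). The functions that describe the game are
definable by expressions (`ThreeCNF.definable_weightCode`), a program writes the weighted adjacency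
matrix entry by entry (`StackProg.exists_runIn_printMatrix`), and the program is composed with the
given machine, whose input stack is the output stack of the program
(`StackProg.outputsInTime_andThen`).
-/

/-! ### Stack programs and their compilation to multi-stack Turing machines -/

/-- Structured programs over stacks indexed by `ℕ` with entries in `Γ'`, together with one further
write-only output stack. -/
inductive StackProg
  | push (k : ℕ) (γ : Γ')
  | pop (k : ℕ)
  /-- Move the top of stack `k`, if there is one, to stack `l`. -/
  | move (k l : ℕ)
  /-- Push a symbol on the output stack. -/
  | out (γ : Γ')
  | seq (p q : StackProg)
  /-- Repeat `p` as long as stack `k` is not empty. -/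
  | loop (k : ℕ) (p : StackProg)
  /-- Run `p` if the top of stack `k` is `γ`, and `q` otherwise. -/
  | ite (k : ℕ) (γ : Γ') (p q : StackProg)

namespace StackProg

/-- The contents of the stacks, and of the output stack. -/
abbrev Store := (ℕ → List Γ') × List Γ'

open Function (update)

/-- `Run p s s' n`: the program `p`, started in the store `s`, ends in the store `s'` after `n`
elementary steps. -/
inductive Run : StackProg → Store → Store → ℕ → Prop
  | push (k γ s o) : Run (.push k γ) (s, o) (update s k (γ :: s k), o) 1
  | pop (k s o) : Run (.pop k) (s, o) (update s k (s k).tail, o) 1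
  | move_nil (k l s o) : s k = [] → Run (.move k l) (s, o) (s, o) 1
  | move_cons (k l s o γ r) : k ≠ l → s k = γ :: r →
      Run (.move k l) (s, o) (update (update s k r) l (γ :: s l), o) 1
  | out (γ s o) : Run (.out γ) (s, o) (s, γ :: o) 1
  | seq {p q s s' s'' n m} : Run p s s' n → Run q s' s'' m → Run (.seq p q) s s'' (n + m)
  | loop_nil {k p s} : s.1 k = [] → Run (.loop k p) s s 1
  | loop_cons {k p s s' s'' n m} : s.1 k ≠ [] → Run p s s' n → Run (.loop k p) s' s'' m →
      Run (.loop k p) s s'' (n + m + 1)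
  | ite_pos {k γ p q s s' n} : (s.1 k).head? = some γ → Run p s s' n →
      Run (.ite k γ p q) s s' (n + 1)
  | ite_neg {k γ p q s s' n} : (s.1 k).head? ≠ some γ → Run q s s' n →
      Run (.ite k γ p q) s s' (n + 1)

/-- The largest index of a stack that occurs in the program. -/
def maxReg : StackProg → ℕ
  | .push k _ => k
  | .pop k => k
  | .move k l => max k l
  | .out _ => 0
  | .seq p q => max p.maxReg q.maxReg
  | .loop k p => max k p.maxReg
  | .ite k _ p q => max k (max p.maxReg q.maxReg)

/-- The control points of a program. -/
def Pos : StackProg → Type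
  | .seq p q => Pos p ⊕ Pos q
  | .loop _ p => Unit ⊕ Pos p
  | .ite _ _ p q => Unit ⊕ (Pos p ⊕ Pos q)
  | _ => Unit

noncomputable instance instFintypePos : (p : StackProg) → Fintype (Pos p)
  | .push _ _ => inferInstanceAs (Fintype Unit)
  | .pop _ => inferInstanceAs (Fintype Unit)
  | .move _ _ => inferInstanceAs (Fintype Unit)
  | .out _ => inferInstanceAs (Fintype Unit)
  | .seq p q =>
    letI := instFintypePos p; letI := instFintypePos q; inferInstanceAs (Fintype (Pos p ⊕ Pos q))
  | .loop _ p => letI := instFintypePos p; inferInstanceAs (Fintype (Unit ⊕ Pos p))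
  | .ite _ _ p q =>
    letI := instFintypePos p; letI := instFintypePos q
    inferInstanceAs (Fintype (Unit ⊕ (Pos p ⊕ Pos q)))

/-- The control point at which a program starts. -/
def entry : (p : StackProg) → Pos p
  | .push _ _ => ()
  | .pop _ => ()
  | .move _ _ => ()
  | .out _ => ()
  | .seq p _ => Sum.inl (entry p)
  | .loop _ _ => Sum.inl ()
  | .ite _ _ _ _ => Sum.inl ()

section Compile

variable (M : Turing.TM2ComputableAux Γ' Bool) (N : ℕ)

/-- The stack alphabets of the combined machine: the stacks of a program, and those of `M`. -/
abbrev alphabet : Fin (N + 1) ⊕ M.tm.K → Type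
  | .inl _ => Γ'
  | .inr k => M.tm.Γ k

/-- The finite memory of the combined machine: a symbol that the program has just read, and the
memory of `M`. -/
abbrev Mem := Option Γ' × M.tm.σ

variable {Λ : Type}

/-- The statement of the combined machine at each control point of a program. The control points
are embedded into the labels by `e`, and `x` is the label to go to at the end. The output stack of
the program is the input stack of `M`. -/
def code : (p : StackProg) → (Pos p → Λ) → Λ → Pos p →
    Turing.TM2.Stmt (alphabet M N) Λ (Mem M)
  | .push k γ, _, x, _ => .push (.inl (Fin.ofNat (N + 1) k)) (fun _ => (γ : Γ')) (.goto fun _ => x)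
  | .pop k, _, x, _ => .pop (.inl (Fin.ofNat (N + 1) k)) (fun v _ => v) (.goto fun _ => x)
  | .move k l, _, x, _ => .pop (.inl (Fin.ofNat (N + 1) k)) (fun v o => (o, v.2))
      (.branch (fun v => v.1.isSome)
        (.push (.inl (Fin.ofNat (N + 1) l)) (fun v => (v.1.getD Γ'.blank : Γ'))
          (.load (fun v => (none, v.2)) (.goto fun _ => x)))
        (.goto fun _ => x))
  | .out γ, _, x, _ => .push (.inr M.tm.k₀) (fun _ => M.inputAlphabet.symm γ) (.goto fun _ => x)
  | .seq p q, e, _, .inl c => code p (e ∘ Sum.inl) (e (.inr (entry q))) c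
  | .seq _ q, e, x, .inr c => code q (e ∘ Sum.inr) x c
  | .loop k p, e, x, .inl _ => .peek (.inl (Fin.ofNat (N + 1) k)) (fun v o => (o, v.2))
      (.branch (fun v => v.1.isSome)
        (.load (fun v => (none, v.2)) (.goto fun _ => e (.inr (entry p))))
        (.goto fun _ => x))
  | .loop _ p, e, _, .inr c => code p (e ∘ Sum.inr) (e (.inl ())) c
  | .ite k γ p q, e, _, .inl _ => .peek (.inl (Fin.ofNat (N + 1) k)) (fun v o => (o, v.2))
      (.branch (fun v => decide (v.1 = some γ))
        (.load (fun v => (none, v.2)) (.goto fun _ => e (.inr (.inl (entry p)))))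
        (.load (fun v => (none, v.2)) (.goto fun _ => e (.inr (.inr (entry q))))))
  | .ite _ _ p _, e, x, .inr (.inl c) => code p (e ∘ Sum.inr ∘ Sum.inl) x c
  | .ite _ _ _ q, e, x, .inr (.inr c) => code q (e ∘ Sum.inr ∘ Sum.inr) x c

/-- The stacks of the combined machine that correspond to a store of a program. -/
def progStacks (s : Store) : (k : Fin (N + 1) ⊕ M.tm.K) → List (alphabet M N k)
  | .inl i => s.1 i
  | .inr k => (Turing.initList M.tm (s.2.map M.inputAlphabet.symm)).stk k

theorem progStacks_inl {s : Store} {k : ℕ} (hk : k ≤ N) :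
    progStacks M N s (.inl (Fin.ofNat (N + 1) k)) = s.1 k := by
  simp only [progStacks, Fin.val_ofNat]
  rw [Nat.mod_eq_of_lt (by omega)]

theorem update_progStacks_inl {s : ℕ → List Γ'} {o : List Γ'} {k : ℕ} (hk : k ≤ N) (r : List Γ') :
    update (progStacks M N (s, o)) (.inl (Fin.ofNat (N + 1) k)) r
      = progStacks M N (update s k r, o) := by
  funext j
  rcases j with i | j
  · by_cases h : i = Fin.ofNat (N + 1) k
    · subst h
      rw [Function.update_self, progStacks_inl _ _ hk]
      simp
    · rw [Function.update_of_ne (by simpa using h)]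
      have : (i : ℕ) ≠ k := by
        rintro rfl
        exact h (by ext; simp)
      simp [progStacks, Function.update_of_ne this]
  · rw [Function.update_of_ne (by simp)]
    rfl

theorem progStacks_inr_input (s : Store) :
    progStacks M N s (.inr M.tm.k₀) = s.2.map M.inputAlphabet.symm := by
  simp [progStacks, Turing.initList]

theorem update_progStacks_inr {s : ℕ → List Γ'} {o : List Γ'} (γ : Γ') :
    update (progStacks M N (s, o)) (.inr M.tm.k₀) (M.inputAlphabet.symm γ :: o.map M.inputAlphabet.symm)
      = progStacks M N (s, γ :: o) := by
  funext j
  rcases j with i | j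
  · rw [Function.update_of_ne (by simp)]
    rfl
  · by_cases h : j = M.tm.k₀
    · subst h
      rw [Function.update_self, progStacks_inr_input]
      simp
    · rw [Function.update_of_ne (by simpa using h)]
      simp [progStacks, Turing.initList, h]

/-- `Steps m n c c'`: the machine with statements `m` goes from `c` to `c'` in `n` steps. -/
def Steps {K Λ σ : Type} {Γ : K → Type} [DecidableEq K] (m : Λ → Turing.TM2.Stmt Γ Λ σ) (n : ℕ)
    (c c' : Turing.TM2.Cfg Γ Λ σ) : Prop :=
  (flip bind (Turing.TM2.step m))^[n] (some c) = some c'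

theorem Steps.trans {K Λ σ : Type} {Γ : K → Type} [DecidableEq K]
    {m : Λ → Turing.TM2.Stmt Γ Λ σ} {n n' : ℕ} {c c' c'' : Turing.TM2.Cfg Γ Λ σ}
    (h : Steps m n c c') (h' : Steps m n' c' c'') : Steps m (n + n') c c'' := by
  unfold Steps at *
  rw [add_comm, Function.iterate_add_apply, h, h']

theorem Steps.single {K Λ σ : Type} {Γ : K → Type} [DecidableEq K]
    {m : Λ → Turing.TM2.Stmt Γ Λ σ} {l : Λ} {v : σ} {S : ∀ k, List (Γ k)}
    {c' : Turing.TM2.Cfg Γ Λ σ} (h : Turing.TM2.stepAux (m l) v S = c') :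
    Steps m 1 ⟨some l, v, S⟩ c' := by
  subst h; rfl

/-- The compiled program simulates the program step by step. -/
theorem Run.steps {p : StackProg} {s s' : Store} {n : ℕ} (h : Run p s s' n) (hN : p.maxReg ≤ N)
    (m : Λ → Turing.TM2.Stmt (alphabet M N) Λ (Mem M)) (e : Pos p → Λ) (x : Λ)
    (hm : ∀ c, m (e c) = code M N p e x c) (v : M.tm.σ) :
    Steps m n ⟨some (e (entry p)), (none, v), progStacks M N s⟩
      ⟨some x, (none, v), progStacks M N s'⟩ := by
  induction h generalizing x with
  | push k γ s o =>
    apply Steps.single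
    rw [hm]
    simp only [code, Turing.TM2.stepAux, progStacks_inl M N (s := (s, o)) (show k ≤ N from hN)]
    rw [update_progStacks_inl M N (show k ≤ N from hN)]
  | pop k s o =>
    apply Steps.single
    rw [hm]
    simp only [code, Turing.TM2.stepAux, progStacks_inl M N (s := (s, o)) (show k ≤ N from hN)]
    rw [update_progStacks_inl M N (show k ≤ N from hN)]
  | move_nil k l s o h0 =>
    simp only [maxReg, max_le_iff] at hN
    apply Steps.single
    rw [hm]
    simp only [code, Turing.TM2.stepAux, progStacks_inl M N (s := (s, o)) hN.1]
    rw [update_progStacks_inl M N hN.1]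
    have h1 : update s k [] = s := by rw [← h0, Function.update_eq_self]
    simp [h0, h1]
  | move_cons k l s o γ r hkl h0 =>
    simp only [maxReg, max_le_iff] at hN
    apply Steps.single
    rw [hm]
    simp only [code, Turing.TM2.stepAux, progStacks_inl M N (s := (s, o)) hN.1, h0]
    rw [update_progStacks_inl M N hN.1]
    simp only [List.head?_cons, Option.isSome_some, cond_true, Option.getD_some, List.tail_cons]
    rw [progStacks_inl M N hN.2, update_progStacks_inl M N hN.2]
    simp [Function.update_of_ne hkl.symm]
  | out γ s o =>
    apply Steps.single
    rw [hm]
    simp only [code, Turing.TM2.stepAux, progStacks_inr_input]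
    rw [update_progStacks_inr]
  | seq h1 h2 ih1 ih2 =>
    simp only [maxReg, max_le_iff] at hN
    exact (ih1 hN.1 (e ∘ Sum.inl) _ (fun c => hm (.inl c))).trans
      (ih2 hN.2 (e ∘ Sum.inr) _ (fun c => hm (.inr c)))
  | @loop_nil k p s h0 =>
    simp only [maxReg, max_le_iff] at hN
    apply Steps.single
    rw [hm]
    simp only [entry, code, Turing.TM2.stepAux, progStacks_inl M N hN.1, h0]
    simp
  | @loop_cons k p s s' s'' n n' h0 h1 h2 ih1 ih2 =>
    have hN' := hN
    simp only [maxReg, max_le_iff] at hN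
    have h3 : Steps m 1 ⟨some (e (entry (.loop k p))), (none, v), progStacks M N s⟩
        ⟨some (e (.inr (entry p))), (none, v), progStacks M N s⟩ := by
      apply Steps.single
      rw [hm]
      obtain ⟨γ, r, h4⟩ := List.exists_cons_of_ne_nil h0
      simp only [entry, code, Turing.TM2.stepAux, progStacks_inl M N hN.1, h4]
      simp
    have h5 := ih1 hN.2 (e ∘ Sum.inr) (e (.inl ())) (fun c => hm (.inr c))
    have h6 := ih2 hN' e x hm
    have := (h3.trans h5).trans h6
    rwa [show 1 + n + n' = n + n' + 1 by omega] at this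
  | @ite_pos k γ p q s s' n h0 h1 ih =>
    simp only [maxReg, max_le_iff] at hN
    have h3 : Steps m 1 ⟨some (e (entry (.ite k γ p q))), (none, v), progStacks M N s⟩
        ⟨some (e (.inr (.inl (entry p)))), (none, v), progStacks M N s⟩ := by
      apply Steps.single
      rw [hm]
      simp only [entry, code, Turing.TM2.stepAux, progStacks_inl M N hN.1]
      simp [h0]
    rw [Nat.add_comm n 1]
    exact h3.trans (ih hN.2.1 (e ∘ Sum.inr ∘ Sum.inl) x (fun c => hm (.inr (.inl c))))
  | @ite_neg k γ p q s s' n h0 h1 ih =>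
    simp only [maxReg, max_le_iff] at hN
    have h3 : Steps m 1 ⟨some (e (entry (.ite k γ p q))), (none, v), progStacks M N s⟩
        ⟨some (e (.inr (.inr (entry q)))), (none, v), progStacks M N s⟩ := by
      apply Steps.single
      rw [hm]
      simp only [entry, code, Turing.TM2.stepAux, progStacks_inl M N hN.1]
      simp [h0]
    rw [Nat.add_comm n 1]
    exact h3.trans (ih hN.2.2 (e ∘ Sum.inr ∘ Sum.inr) x (fun c => hm (.inr (.inr c))))

/-! ### Running a machine on the output of a program -/

/-- The statements of `M`, as statements of the combined machine with labels `P ⊕ M.tm.Λ`. -/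
def liftStmt (P : Type) : Turing.TM2.Stmt M.tm.Γ M.tm.Λ M.tm.σ →
    Turing.TM2.Stmt (alphabet M N) (P ⊕ M.tm.Λ) (Mem M)
  | .push k f q => .push (.inr k) (fun v => f v.2) (liftStmt P q)
  | .peek k f q => .peek (.inr k) (fun v o => (v.1, f v.2 o)) (liftStmt P q)
  | .pop k f q => .pop (.inr k) (fun v o => (v.1, f v.2 o)) (liftStmt P q)
  | .load f q => .load (fun v => (v.1, f v.2)) (liftStmt P q)
  | .branch f q q' => .branch (fun v => f v.2) (liftStmt P q) (liftStmt P q')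
  | .goto f => .goto fun v => .inr (f v.2)
  | .halt => .halt

/-- Stacks of `M`, as stacks of the combined machine on which the program stacks are empty. -/
def liftStacks (S : ∀ k, List (M.tm.Γ k)) : (k : Fin (N + 1) ⊕ M.tm.K) → List (alphabet M N k)
  | .inl _ => []
  | .inr k => S k

/-- The configurations of `M`, as configurations of the combined machine. -/
def liftCfg (P : Type) (c : Turing.TM2.Cfg M.tm.Γ M.tm.Λ M.tm.σ) :
    Turing.TM2.Cfg (alphabet M N) (P ⊕ M.tm.Λ) (Mem M) :=
  ⟨c.l.map .inr, (none, c.var), liftStacks M N c.stk⟩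

theorem update_liftStacks (S : ∀ k, List (M.tm.Γ k)) (k : M.tm.K) (r : List (M.tm.Γ k)) :
    update (liftStacks M N S) (.inr k) r = liftStacks M N (update S k r) := by
  funext j
  rcases j with i | j
  · rw [Function.update_of_ne (by simp)]
    rfl
  · by_cases h : j = k
    · subst h
      simp [liftStacks]
    · rw [Function.update_of_ne (by simpa using h)]
      simp [liftStacks, Function.update_of_ne h]

theorem stepAux_liftStmt (P : Type) (q : Turing.TM2.Stmt M.tm.Γ M.tm.Λ M.tm.σ) (v : M.tm.σ)
    (S : ∀ k, List (M.tm.Γ k)) :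
    Turing.TM2.stepAux (liftStmt M N P q) (none, v) (liftStacks M N S)
      = liftCfg M N P (Turing.TM2.stepAux q v S) := by
  induction q generalizing v S with
  | push k f q ih =>
    simp only [liftStmt, Turing.TM2.stepAux]
    rw [← ih, ← update_liftStacks]
    rfl
  | peek k f q ih =>
    simp only [liftStmt, Turing.TM2.stepAux]
    rw [← ih]
    rfl
  | pop k f q ih =>
    simp only [liftStmt, Turing.TM2.stepAux]
    rw [← ih, ← update_liftStacks]
    rfl
  | load f q ih => simp only [liftStmt, Turing.TM2.stepAux]; rw [← ih]
  | branch f q q' ih ih' =>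
    simp only [liftStmt, Turing.TM2.stepAux]
    rw [ih, ih']
    cases f v <;> rfl
  | goto f => rfl
  | halt => rfl

/-- Once the program has ended, the combined machine runs in lockstep with `M`. -/
theorem steps_liftCfg {P : Type} {m : P ⊕ M.tm.Λ → Turing.TM2.Stmt (alphabet M N) (P ⊕ M.tm.Λ) (Mem M)}
    (hm : ∀ l, m (.inr l) = liftStmt M N P (M.tm.m l)) {n : ℕ}
    {c c' : Turing.TM2.Cfg M.tm.Γ M.tm.Λ M.tm.σ} (h : Steps M.tm.m n c c') :
    Steps m n (liftCfg M N P c) (liftCfg M N P c') := by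
  have h1 : Function.Semiconj (Option.map (liftCfg M N P)) (flip bind (Turing.TM2.step M.tm.m))
      (flip bind (Turing.TM2.step m)) := by
    rintro (_ | ⟨l, v, S⟩)
    · rfl
    · rcases l with _ | l
      · rfl
      · change some (liftCfg M N P (Turing.TM2.stepAux (M.tm.m l) v S))
          = some (Turing.TM2.stepAux (m (.inr l)) (none, v) (liftStacks M N S))
        rw [hm, stepAux_liftStmt]
  have h2 := (h1.iterate_right n).eq (some c)
  unfold Steps at *
  rw [h] at h2
  exact h2.symm

/-- The machine that runs the program `p` on its input, and then `M` on the output of `p`. -/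
noncomputable def andThen (p : StackProg) (M : Turing.TM2ComputableAux Γ' Bool) :
    Turing.TM2ComputableAux Γ' Bool where
  tm :=
    { K := Fin (p.maxReg + 1) ⊕ M.tm.K
      kFin := letI := M.tm.kFin; inferInstance
      k₀ := .inl 0
      k₁ := .inr M.tm.k₁
      Γ := alphabet M p.maxReg
      Λ := Pos p ⊕ M.tm.Λ
      main := .inl (entry p)
      ΛFin := letI := M.tm.ΛFin; inferInstance
      σ := Mem M
      initialState := (none, M.tm.initialState)
      σFin := letI := M.tm.σFin; inferInstance
      Γk₀Fin := inferInstanceAs (Fintype Γ')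
      m := Sum.elim (code M p.maxReg p .inl (.inr M.tm.main))
        fun l => liftStmt M p.maxReg (Pos p) (M.tm.m l) }
  inputAlphabet := Equiv.refl Γ'
  outputAlphabet := M.outputAlphabet

/-- The store of a program at the start: the input is on stack `0`. -/
def initStore (x : List Γ') : Store := (update (fun _ => []) 0 x, [])

theorem initList_stk_self (tm : Turing.FinTM2) (s : List (tm.Γ tm.k₀)) :
    (Turing.initList tm s).stk tm.k₀ = s := by
  simp [Turing.initList]

theorem initList_stk_of_ne {tm : Turing.FinTM2} (s : List (tm.Γ tm.k₀)) {k : tm.K}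
    (h : k ≠ tm.k₀) : (Turing.initList tm s).stk k = [] :=
  dif_neg h

theorem haltList_stk_self (tm : Turing.FinTM2) (s : List (tm.Γ tm.k₁)) :
    (Turing.haltList tm s).stk tm.k₁ = s := by
  simp [Turing.haltList]

theorem haltList_stk_of_ne {tm : Turing.FinTM2} (s : List (tm.Γ tm.k₁)) {k : tm.K}
    (h : k ≠ tm.k₁) : (Turing.haltList tm s).stk k = [] :=
  dif_neg h

/-- If `p` turns `x` into `y` in `n` steps and `M` answers `b` on `y` in time `t`, then the composed
machine answers `b` on `x` in time `n + t`. The stacks of `p` have to be empty at the end, as a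
machine halts with nothing but the answer on its stacks. -/
theorem outputsInTime_andThen {p : StackProg} {M : Turing.TM2ComputableAux Γ' Bool}
    {x y : List Γ'} {n t : ℕ} {b : List (M.tm.Γ M.tm.k₁)}
    (hp : Run p (initStore x) (fun _ => [], y) n)
    (hM : Nonempty (Turing.TM2OutputsInTime M.tm (y.map M.inputAlphabet.invFun) (some b) t)) :
    Nonempty (Turing.TM2OutputsInTime (p.andThen M).tm (x.map (p.andThen M).inputAlphabet.invFun)
      (some b) (n + t)) := by
  obtain ⟨⟨t', ht'⟩, htt⟩ := hM
  refine ⟨⟨⟨n + t', ?_⟩, by simpa using htt⟩⟩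
  have h1 := hp.steps M p.maxReg le_rfl (p.andThen M).tm.m .inl (.inr M.tm.main)
    (fun c => rfl) M.tm.initialState
  have h2 := steps_liftCfg M p.maxReg (m := (p.andThen M).tm.m) (fun l => rfl)
    (show Steps M.tm.m t' _ _ from ht')
  have h3 : (⟨some (.inr M.tm.main), (none, M.tm.initialState),
      progStacks M p.maxReg (fun _ => [], y)⟩ : Turing.TM2.Cfg (alphabet M p.maxReg) _ (Mem M))
      = liftCfg M p.maxReg (Pos p)
        (Turing.initList M.tm (y.map M.inputAlphabet.invFun)) := by
    refine congrArg (Turing.TM2.Cfg.mk _ _) ?_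
    funext j
    rcases j with i | j <;> rfl
  have h4 := Steps.trans (Eq.mp (congrArg (Steps (p.andThen M).tm.m n _) h3) h1) h2
  have h5 : (Turing.initList (p.andThen M).tm (x.map (p.andThen M).inputAlphabet.invFun))
      = ⟨some (.inl (entry p)), (none, M.tm.initialState), progStacks M p.maxReg (initStore x)⟩ := by
    refine congrArg (Turing.TM2.Cfg.mk _ _) ?_
    funext j
    rcases j with i | j
    · by_cases h : i = 0
      · subst h
        exact (initList_stk_self (p.andThen M).tm _).trans (List.map_id x)
      · have h' : (i : ℕ) ≠ 0 := fun h' => h (Fin.ext h')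
        refine (initList_stk_of_ne (tm := (p.andThen M).tm) _
          (fun h6 => h (Sum.inl_injective h6))).trans ?_
        exact (Function.update_of_ne (β := fun _ => List Γ') h' x (fun _ => [])).symm
    · refine (initList_stk_of_ne (tm := (p.andThen M).tm)
        (x.map (p.andThen M).inputAlphabet.invFun) Sum.inr_ne_inl).trans ?_
      by_cases h : j = M.tm.k₀
      · subst h
        exact (initList_stk_self M.tm _).symm
      · exact (initList_stk_of_ne _ h).symm
  have h6 : (Turing.haltList (p.andThen M).tm b)
      = liftCfg M p.maxReg (Pos p) (Turing.haltList M.tm b) := by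
    refine congrArg (Turing.TM2.Cfg.mk _ _) ?_
    funext j
    rcases j with i | j
    · exact haltList_stk_of_ne (tm := (p.andThen M).tm) b Sum.inl_ne_inr
    · by_cases h : j = M.tm.k₁
      · subst h
        exact (haltList_stk_self (p.andThen M).tm _).trans (haltList_stk_self M.tm _).symm
      · exact (haltList_stk_of_ne (tm := (p.andThen M).tm) _
          (fun h6 => h (Sum.inr_injective h6))).trans (haltList_stk_of_ne _ h).symm
  change (flip bind (Turing.TM2.step (p.andThen M).tm.m))^[n + t'] (some (Turing.initList _ _))
    = some (Turing.haltList (p.andThen M).tm b)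
  rw [h5, h6]
  exact h4

end Compile

end StackProg

namespace StackProg

open Function (update)

/-- The program `p` leads from `s` to `s'` in at most `c` steps. -/
def RunIn (p : StackProg) (s s' : Store) (c : ℕ) : Prop := ∃ n ≤ c, Run p s s' n

theorem RunIn.mono {p : StackProg} {s s' : Store} {c c' : ℕ} (h : RunIn p s s' c) (hc : c ≤ c') :
    RunIn p s s' c' :=
  let ⟨n, hn, hr⟩ := h; ⟨n, hn.trans hc, hr⟩

theorem RunIn.seq {p q : StackProg} {s s' s'' : Store} {c c' : ℕ} (h : RunIn p s s' c)
    (h' : RunIn q s' s'' c') : RunIn (.seq p q) s s'' (c + c') :=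
  let ⟨_, hn, hr⟩ := h; let ⟨_, hn', hr'⟩ := h'; ⟨_, Nat.add_le_add hn hn', hr.seq hr'⟩

theorem RunIn.push (k γ s o) : RunIn (.push k γ) (s, o) (update s k (γ :: s k), o) 1 :=
  ⟨_, le_rfl, Run.push ..⟩

theorem RunIn.pop (k s o) : RunIn (.pop k) (s, o) (update s k (s k).tail, o) 1 :=
  ⟨_, le_rfl, Run.pop ..⟩

/-- A loop that runs `p` exactly `n` times, passing through the stores `S 0, …, S n`. -/
theorem RunIn.loop {k : ℕ} {p : StackProg} {c : ℕ} (S : ℕ → Store) (n : ℕ)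
    (h : ∀ j < n, (S j).1 k ≠ [] ∧ RunIn p (S j) (S (j + 1)) c) (hn : (S n).1 k = []) :
    RunIn (.loop k p) (S 0) (S n) (n * (c + 1) + 1) := by
  induction n generalizing S with
  | zero => exact ⟨1, by omega, Run.loop_nil hn⟩
  | succ n ih =>
    obtain ⟨m, hm, hr⟩ := ih (fun j => S (j + 1)) (fun j hj => h (j + 1) (by omega)) hn
    obtain ⟨h1, m', hm', hr'⟩ := h 0 (by omega)
    exact ⟨_, by nlinarith, Run.loop_cons h1 hr' hr⟩

theorem RunIn.loop_move {k l : ℕ} (hkl : k ≠ l) (s : ℕ → List Γ') (o : List Γ') :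
    RunIn (.loop k (.move k l)) (s, o)
      (update (update s k []) l ((s k).reverse ++ s l), o) (2 * (s k).length + 1) := by
  generalize hL : s k = L
  induction L generalizing s with
  | nil =>
    refine ⟨1, by simp, ?_⟩
    have h1 : update (update s k []) l (([] : List Γ').reverse ++ s l) = s := by
      rw [← hL, Function.update_eq_self]; simp [hL]
    rw [h1]
    exact Run.loop_nil hL
  | cons γ r ih =>
    obtain ⟨n, hn, hr⟩ := ih (update (update s k r) l (γ :: s l)) (by simp [hkl])
    refine ⟨1 + n + 1, ?_, Run.loop_cons (m := n) (by simp [hL]) (Run.move_cons k l s o γ r hkl hL) ?_⟩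
    · simp only [List.length_cons]; omega
    · convert hr using 2
      funext j
      simp only [Function.update_apply]
      split_ifs <;> simp_all

theorem RunIn.loop_pop (k : ℕ) (s : ℕ → List Γ') (o : List Γ') :
    RunIn (.loop k (.pop k)) (s, o) (update s k [], o) (2 * (s k).length + 1) := by
  generalize hL : s k = L
  induction L generalizing s with
  | nil =>
    refine ⟨1, by simp, ?_⟩
    rw [← hL, Function.update_eq_self]
    exact Run.loop_nil hL
  | cons γ r ih =>
    obtain ⟨n, hn, hr⟩ := ih (update s k r) (by simp)
    refine ⟨1 + n + 1, ?_, Run.loop_cons (m := n) (by simp [hL]) (Run.pop k s o) ?_⟩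
    · simp only [List.length_cons]; omega
    · simpa [hL] using hr

/-- A number on a stack, in unary. -/
abbrev num (n : ℕ) : List Γ' := List.replicate n Γ'.blank

end StackProg

/-! ### Arithmetic with bounded sums over the positions of the input -/

/-- Expressions for natural numbers with `k` variables, that can inspect an input word. -/
inductive CountExpr : ℕ → Type
  | var {k} (i : Fin k) : CountExpr k
  | zero {k} : CountExpr k
  | one {k} : CountExpr k
  | add {k} (a b : CountExpr k) : CountExpr k
  /-- Truncated subtraction. -/
  | sub {k} (a b : CountExpr k) : CountExpr k
  /-- The sum of `f i` over `i < n`, where `i` becomes the variable `0` of `f`. -/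
  | sum {k} (n : CountExpr k) (f : CountExpr (k + 1)) : CountExpr k
  /-- The length of the input. -/
  | len {k} : CountExpr k
  /-- `1` if the symbol of the input at position `a` is `γ`, and `0` otherwise. -/
  | isSym {k} (γ : Γ') (a : CountExpr k) : CountExpr k

namespace CountExpr

open StackProg
open Function (update)

/-- The value of an expression for the input `x` and the values `w` of the variables. -/
def eval (x : List Γ') : {k : ℕ} → CountExpr k → (Fin k → ℕ) → ℕ
  | _, .var i, w => w i
  | _, .zero, _ => 0
  | _, .one, _ => 1
  | _, .add a b, w => eval x a w + eval x b w
  | _, .sub a b, w => eval x a w - eval x b w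
  | _, .sum n f, w => ∑ i ∈ Finset.range (eval x n w), eval x f (Fin.cons i w)
  | _, .len, _ => x.length
  | _, .isSym γ a, w => if x[eval x a w]? = some γ then 1 else 0

/-- The program that computes an expression. The input is on stack `0`, stack `1` is scratch space
for reading it, the variables are on the stacks `v i`, and the result is left on stack `d`. The
stacks above `d` have to be empty and are used for intermediate results. -/
def compile : {k : ℕ} → CountExpr k → (Fin k → ℕ) → ℕ → StackProg
  | _, .var i, v, d => .seq (.loop (v i) (.move (v i) (d + 1)))
      (.loop (d + 1) (.seq (.move (d + 1) (v i)) (.push d Γ'.blank)))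
  | _, .zero, _, d => .pop d
  | _, .one, _, d => .push d Γ'.blank
  | _, .add a b, v, d => .seq (compile a v d)
      (.seq (compile b v (d + 1)) (.loop (d + 1) (.move (d + 1) d)))
  | _, .sub a b, v, d => .seq (compile a v d)
      (.seq (compile b v (d + 1)) (.loop (d + 1) (.seq (.pop (d + 1)) (.pop d))))
  | _, .sum n f, v, d => .seq (compile n v (d + 1)) (.seq
      (.loop (d + 1) (.seq (.pop (d + 1)) (.seq (compile f (Fin.cons (d + 2) v) (d + 3))
        (.seq (.loop (d + 3) (.move (d + 3) d)) (.push (d + 2) Γ'.blank)))))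
      (.loop (d + 2) (.pop (d + 2))))
  | _, .len, _, d => .seq (.loop 0 (.seq (.move 0 1) (.push d Γ'.blank))) (.loop 1 (.move 1 0))
  | _, .isSym γ a, v, d => .seq (compile a v (d + 1)) (.seq
      (.loop (d + 1) (.seq (.pop (d + 1)) (.move 0 1)))
      (.seq (.ite 0 γ (.push d Γ'.blank) (.pop d)) (.loop 1 (.move 1 0))))

/-- The stacks `s` hold the input `x` and the values `w` of the variables, at the places where
`CountExpr.compile e v d` expects them, and `B` bounds these data. -/
structure Fits {k : ℕ} (s : ℕ → List Γ') (v : Fin k → ℕ) (d : ℕ) (x : List Γ') (w : Fin k → ℕ)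
    (B : ℕ) : Prop where
  two_le : 2 ≤ d
  var_mem : ∀ i, 2 ≤ v i ∧ v i < d
  input : s 0 = x
  scratch : s 1 = []
  val : ∀ i, s (v i) = num (w i)
  free : ∀ r, d ≤ r → s r = []
  length_le : x.length ≤ B
  val_le : ∀ i, w i ≤ B

theorem Fits.update_succ {k : ℕ} {s : ℕ → List Γ'} {v : Fin k → ℕ} {d : ℕ} {x : List Γ'}
    {w : Fin k → ℕ} {B : ℕ} (h : Fits s v d x w B) (r : List Γ') :
    Fits (update s d r) v (d + 1) x w B where
  two_le := by have := h.two_le; omega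
  var_mem i := by have := h.var_mem i; omega
  input := by have := h.two_le; rw [Function.update_of_ne (by omega), h.input]
  scratch := by have := h.two_le; rw [Function.update_of_ne (by omega), h.scratch]
  val i := by have := h.var_mem i; rw [Function.update_of_ne (by omega), h.val]
  free r hr := by rw [Function.update_of_ne (by omega), h.free r (by omega)]
  length_le := h.length_le
  val_le := h.val_le

theorem Fits.succ {k : ℕ} {s : ℕ → List Γ'} {v : Fin k → ℕ} {d : ℕ} {x : List Γ'}
    {w : Fin k → ℕ} {B : ℕ} (h : Fits s v d x w B) : Fits s v (d + 1) x w B := by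
  have := h.update_succ (s d)
  rwa [Function.update_eq_self] at this

/-- The compiled expression `e` computes the value of `e`, and value and running time are at most
`(B + 2) ^ C`, where `B` bounds the length of the input and the values of the variables. -/
def RunsIn {k : ℕ} (e : CountExpr k) (C : ℕ) : Prop :=
  ∀ s v d x w B o, Fits s v d x w B → eval x e w ≤ (B + 2) ^ C ∧
    RunIn (compile e v d) (s, o) (update s d (num (eval x e w)), o) ((B + 2) ^ C)

theorem le_two_add_pow (B C : ℕ) (hC : 1 ≤ C) : B + 2 ≤ (B + 2) ^ C :=
  Nat.le_self_pow (by omega) _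

theorem runsIn_var {k : ℕ} (i : Fin k) : RunsIn (.var i) 5 := by
  intro s v d x w B o h
  have hd := h.two_le
  have hv := h.var_mem i
  have hb := h.val_le i
  have hp := Nat.pow_le_pow_left (show 2 ≤ B + 2 by omega) 4
  have hp5 : (B + 2) ^ 5 = (B + 2) ^ 4 * (B + 2) := pow_succ _ _
  refine ⟨(hb.trans (by omega)).trans (le_two_add_pow B 5 (by norm_num)), ?_⟩
  have h1 := RunIn.loop_move (show v i ≠ d + 1 by omega) s o
  have h2 := RunIn.loop (k := d + 1)
    (p := .seq (.move (d + 1) (v i)) (.push d Γ'.blank)) (c := 2)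
    (fun j => (update (update (update s (v i) (num j)) (d + 1) (num (w i - j))) d (num j), o)) (w i)
    (fun j hj => ⟨by
      simp; omega, by
      obtain ⟨m, hm⟩ : ∃ m, w i - j = m + 1 := ⟨w i - j - 1, by omega⟩
      have hm' : w i - (j + 1) = m := by omega
      refine RunIn.seq ⟨1, le_rfl, Run.move_cons _ _ _ _ Γ'.blank (num m) (by omega) ?_⟩
        ⟨1, le_rfl, ?_⟩
      · simp [hm, List.replicate_succ]
      · convert Run.push d Γ'.blank _ o using 2
        funext r
        simp only [Function.update_apply, hm']
        split_ifs <;> first | omega | simp_all [List.replicate_succ]⟩)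
    (by simp)
  refine RunIn.mono (h1.seq (s'' := (update s d (num (w i)), o)) (c' := w i * (2 + 1) + 1) ?_) ?_
  · convert h2 using 2
    · funext r
      simp only [Function.update_apply]
      have := h.val i
      have := h.free d le_rfl
      have := h.free (d + 1) (by omega)
      split_ifs <;> first | omega | simp_all
    · funext r
      simp only [Function.update_apply]
      have := h.val i
      have := h.free (d + 1) (by omega)
      split_ifs <;> first | omega | simp_all
  · rw [h.val i, List.length_replicate]
    nlinarith

theorem runsIn_zero {k : ℕ} : RunsIn (.zero : CountExpr k) 1 := by
  intro s v d x w B o h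
  refine ⟨by simp [eval], ?_⟩
  have h1 := (RunIn.pop d s o).mono (show 1 ≤ (B + 2) ^ 1 by simp)
  rwa [h.free d le_rfl] at h1

theorem runsIn_one {k : ℕ} : RunsIn (.one : CountExpr k) 1 := by
  intro s v d x w B o h
  refine ⟨by simp [eval], ?_⟩
  have h1 := (RunIn.push d Γ'.blank s o).mono (show 1 ≤ (B + 2) ^ 1 by simp)
  rwa [h.free d le_rfl] at h1

theorem runsIn_add {k : ℕ} {a b : CountExpr k} {C D : ℕ} (ha : RunsIn a C) (hb : RunsIn b D) :
    RunsIn (.add a b) (C + D + 3) := by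
  intro s v d x w B o h
  obtain ⟨ha1, ha2⟩ := ha s v d x w B o h
  obtain ⟨hb1, hb2⟩ := hb _ v (d + 1) x w B o (h.update_succ (num (eval x a w)))
  have h3 := RunIn.loop_move (show d + 1 ≠ d by omega)
    (update (update s d (num (eval x a w))) (d + 1) (num (eval x b w))) o
  have hC : (B + 2) ^ C ≤ (B + 2) ^ (C + D) := Nat.pow_le_pow_right (by omega) (by omega)
  have hD : (B + 2) ^ D ≤ (B + 2) ^ (C + D) := Nat.pow_le_pow_right (by omega) (by omega)
  have h1 : 1 ≤ (B + 2) ^ (C + D) := Nat.one_le_pow _ _ (by omega)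
  have hp := Nat.pow_le_pow_left (show 2 ≤ B + 2 by omega) 3
  have hs : (B + 2) ^ (C + D + 3) = (B + 2) ^ (C + D) * (B + 2) ^ 3 := pow_add _ _ _
  refine ⟨by simp only [eval]; nlinarith, RunIn.mono (ha2.seq (hb2.seq (c' := 2 * eval x b w + 1) ?_)) ?_⟩
  · convert h3 using 2
    · funext r
      simp only [Function.update_apply, eval]
      have := h.free (d + 1) (by omega)
      split_ifs <;> first | omega | simp_all
      exact add_comm _ _
    · simp
  · nlinarith

theorem runsIn_sub {k : ℕ} {a b : CountExpr k} {C D : ℕ} (ha : RunsIn a C) (hb : RunsIn b D) :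
    RunsIn (.sub a b) (C + D + 3) := by
  intro s v d x w B o h
  obtain ⟨ha1, ha2⟩ := ha s v d x w B o h
  obtain ⟨hb1, hb2⟩ := hb _ v (d + 1) x w B o (h.update_succ (num (eval x a w)))
  have h3 := RunIn.loop (k := d + 1) (p := .seq (.pop (d + 1)) (.pop d)) (c := 2)
    (fun j => (update (update s d (num (eval x a w - j))) (d + 1) (num (eval x b w - j)), o))
    (eval x b w)
    (fun j hj => ⟨by simp; omega, by
      refine RunIn.seq (RunIn.pop _ _ _) ⟨1, le_rfl, ?_⟩
      convert Run.pop d _ o using 2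
      funext r
      simp only [Function.update_apply]
      split_ifs <;> first | omega | simp_all [Nat.sub_sub]⟩)
    (by simp)
  have hC : (B + 2) ^ C ≤ (B + 2) ^ (C + D) := Nat.pow_le_pow_right (by omega) (by omega)
  have hD : (B + 2) ^ D ≤ (B + 2) ^ (C + D) := Nat.pow_le_pow_right (by omega) (by omega)
  have h1 : 1 ≤ (B + 2) ^ (C + D) := Nat.one_le_pow _ _ (by omega)
  have hp := Nat.pow_le_pow_left (show 2 ≤ B + 2 by omega) 3
  have hs : (B + 2) ^ (C + D + 3) = (B + 2) ^ (C + D) * (B + 2) ^ 3 := pow_add _ _ _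
  refine ⟨by simp only [eval]; have := Nat.sub_le (eval x a w) (eval x b w); nlinarith,
    RunIn.mono (ha2.seq (hb2.seq (c' := eval x b w * (2 + 1) + 1) ?_)) ?_⟩
  · convert h3 using 2
    · simp
    · change update s d (num (eval x a w - eval x b w)) = _
      funext r
      simp only [Function.update_apply]
      have := h.free (d + 1) (by omega)
      split_ifs <;> first | omega | simp_all
  · nlinarith

theorem runsIn_len {k : ℕ} : RunsIn (.len : CountExpr k) 4 := by
  intro s v d x w B o h
  have hd := h.two_le
  have hp := Nat.pow_le_pow_left (show 2 ≤ B + 2 by omega) 3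
  have hs : (B + 2) ^ 4 = (B + 2) ^ 3 * (B + 2) := pow_succ _ _
  have hx := h.length_le
  refine ⟨by simp only [eval]; nlinarith, ?_⟩
  have h1 := RunIn.loop (k := 0) (p := .seq (.move 0 1) (.push d Γ'.blank)) (c := 2)
    (fun j => (update (update (update s 0 (x.drop j)) 1 (x.take j).reverse) d (num j), o))
    x.length
    (fun j hj => ⟨by
      simp [Function.update_of_ne (show 0 ≠ d by omega)]; omega, by
      refine RunIn.seq ⟨1, le_rfl, Run.move_cons _ _ _ _ x[j] (x.drop (j + 1)) (by omega) ?_⟩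
        ⟨1, le_rfl, ?_⟩
      · simp [Function.update_of_ne (show 0 ≠ d by omega)]
      · convert Run.push d Γ'.blank _ o using 2
        funext r
        simp only [Function.update_apply]
        split_ifs <;> first | omega | simp_all [List.replicate_succ]⟩)
    (by simp [Function.update_of_ne (show 0 ≠ d by omega)])
  have h2 := RunIn.loop_move (show 1 ≠ 0 by omega)
    (update (update (update s 0 (x.drop x.length)) 1 (x.take x.length).reverse) d (num x.length)) o
  refine RunIn.mono (RunIn.seq (s' := (update (update (update s 0 (x.drop x.length)) 1
    (x.take x.length).reverse) d (num x.length), o)) (c := x.length * (2 + 1) + 1)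
    (c' := 2 * x.length + 1) ?_ ?_) ?_
  · convert h1 using 2
    funext r
    simp only [Function.update_apply]
    have := h.free d le_rfl
    have := h.input
    have := h.scratch
    split_ifs <;> first | omega | simp_all
  · convert h2 using 2
    · funext r
      simp only [Function.update_apply]
      have := h.input
      have := h.scratch
      split_ifs <;> first | omega | simp_all [eval]
    · simp [Function.update_of_ne (show 1 ≠ d by omega)]
  · nlinarith

theorem runsIn_isSym {k : ℕ} {a : CountExpr k} {C : ℕ} (γ : Γ') (ha : RunsIn a C) :
    RunsIn (.isSym γ a) (C + 5) := by
  intro s v d x w B o h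
  obtain ⟨ha1, ha2⟩ := ha s v (d + 1) x w B o h.succ
  have hd := h.two_le
  set n := eval x a w with hn
  have h1 := RunIn.loop (k := d + 1) (p := .seq (.pop (d + 1)) (.move 0 1)) (c := 2)
    (fun j => (update (update (update s 0 (x.drop j)) 1 (x.take j).reverse) (d + 1)
      (num (n - j)), o)) n
    (fun j hj => ⟨by simp; omega, by
      refine RunIn.seq (RunIn.pop _ _ _) ⟨1, le_rfl, ?_⟩
      rcases lt_or_ge j x.length with hjx | hjx
      · convert Run.move_cons 0 1 _ o x[j] (x.drop (j + 1)) (by omega) ?_ using 2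
        · funext r
          simp only [Function.update_apply]
          split_ifs <;> first | omega | simp_all [Nat.sub_sub]
        · simp
      · have e1 : x.drop j = [] := List.drop_eq_nil_of_le hjx
        have e2 : x.drop (j + 1) = [] := List.drop_eq_nil_of_le (by omega)
        have e3 : x.take j = x := List.take_of_length_le hjx
        have e4 : x.take (j + 1) = x := List.take_of_length_le (by omega)
        rw [e1, e2, e3, e4]
        convert Run.move_nil 0 1 _ o ?_ using 2
        · funext r
          simp only [Function.update_apply]
          split_ifs <;> first | omega | simp_all [Nat.sub_sub]
        · simp⟩)
    (by simp)
  set s1 := update (update s 0 (x.drop n)) 1 (x.take n).reverse with hs1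
  have e1 : (s1 0).head? = x[n]? := by simp [hs1]
  have e2 : s1 d = [] := by
    rw [hs1, Function.update_of_ne (by omega), Function.update_of_ne (by omega), h.free d le_rfl]
  have h2 : RunIn (.ite 0 γ (.push d Γ'.blank) (.pop d)) (s1, o)
      (update s1 d (num (eval x (.isSym γ a) w)), o) 2 := by
    simp only [eval]
    split_ifs with hx
    · refine ⟨_, le_rfl, Run.ite_pos (by rw [e1, ← hx]) ?_⟩
      convert Run.push d Γ'.blank s1 o using 2
      rw [e2]; rfl
    · refine ⟨_, le_rfl, Run.ite_neg (by rw [e1]; exact hx) ?_⟩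
      convert Run.pop d s1 o using 2
      rw [e2]; rfl
  have h3 := RunIn.loop_move (show 1 ≠ 0 by omega)
    (update s1 d (num (eval x (.isSym γ a) w))) o
  have hC : 1 ≤ (B + 2) ^ C := Nat.one_le_pow _ _ (by omega)
  have hp := Nat.pow_le_pow_left (show 2 ≤ B + 2 by omega) 4
  have hs : (B + 2) ^ (C + 5) = (B + 2) ^ C * (B + 2) ^ 4 * (B + 2) := by ring
  have hx := h.length_le
  have hbig : 16 * ((B + 2) ^ C * (B + 2)) ≤ (B + 2) ^ (C + 5) := by
    rw [hs]; nlinarith [Nat.mul_le_mul_left ((B + 2) ^ C * (B + 2)) hp]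
  have hbig' : (B + 2) ^ C + (B + 2) ≤ 2 * ((B + 2) ^ C * (B + 2)) := by nlinarith
  refine ⟨by simp only [eval]; split_ifs <;> omega,
    RunIn.mono (ha2.seq (RunIn.seq (s' := (s1, o)) (c := n * (2 + 1) + 1) ?_
      (h2.seq (c' := 2 * x.length + 1) ?_))) ?_⟩
  · convert h1 using 2
    · funext r
      simp only [Function.update_apply]
      have := h.input
      have := h.scratch
      split_ifs <;> first | omega | simp_all
    · funext r
      simp only [hs1, Function.update_apply]
      have := h.free (d + 1) (by omega)
      split_ifs <;> first | omega | simp_all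
  · refine RunIn.mono (c := 2 * (update s1 d (num (eval x (.isSym γ a) w)) 1).length + 1) ?_ ?_
    · convert h3 using 2
      funext r
      simp only [hs1, Function.update_apply]
      have := h.input
      have := h.scratch
      split_ifs <;> first | omega | simp_all
    · rw [Function.update_of_ne (by omega), hs1]
      simp
  · omega

theorem runsIn_sum {k : ℕ} {n : CountExpr k} {f : CountExpr (k + 1)} {C D : ℕ}
    (hn : RunsIn n C) (hf : RunsIn f D) : RunsIn (.sum n f) (C + (C + 2) * D + 5) := by
  intro s v d x w B o h
  obtain ⟨hn1, hn2⟩ := hn s v (d + 1) x w B o h.succ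
  have hd := h.two_le
  set N := eval x n w with hN
  set P := B + 2 with hP
  set Q := P ^ ((C + 2) * D) with hQ
  have hPC : 1 ≤ P ^ C := Nat.one_le_pow _ _ (by omega)
  have hQ1 : 1 ≤ Q := Nat.one_le_pow _ _ (by omega)
  have hBig : (P ^ (C + 1) + 2) ^ D ≤ Q := by
    rw [hQ, pow_mul]
    refine Nat.pow_le_pow_left ?_ D
    have : P ^ (C + 2) = P ^ (C + 1) * P := pow_succ _ _
    have h3 : 2 ≤ P ^ (C + 1) := le_trans (by omega) (Nat.le_self_pow (show C + 1 ≠ 0 by omega) P)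
    nlinarith
  have hPC1 : P ^ (C + 1) = P ^ C * P := pow_succ _ _
  set F : ℕ → ℕ := fun i => eval x f (Fin.cons i w) with hF
  set A : ℕ → ℕ := fun j => ∑ i ∈ Finset.range j, F i with hA
  have hbody : ∀ j < N, F j ≤ Q ∧ RunIn (compile f (Fin.cons (d + 2) v) (d + 3))
      (update (update (update s d (num (A j))) (d + 1) (num (N - (j + 1)))) (d + 2) (num j), o)
      (update (update (update (update s d (num (A j))) (d + 1) (num (N - (j + 1)))) (d + 2)
        (num j)) (d + 3) (num (F j)), o) Q := by
    intro j hj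
    obtain ⟨h1, h2⟩ := hf (update (update (update s d (num (A j))) (d + 1) (num (N - (j + 1))))
      (d + 2) (num j)) (Fin.cons (d + 2) v) (d + 3) x (Fin.cons j w) (P ^ (C + 1)) o
      { two_le := by omega
        var_mem := by
          refine Fin.cases ?_ fun i => ?_
          · simp only [Fin.cons_zero]; omega
          · have := h.var_mem i
            simp only [Fin.cons_succ]; omega
        input := by
          rw [Function.update_of_ne (by omega), Function.update_of_ne (by omega),
            Function.update_of_ne (by omega), h.input]
        scratch := by
          rw [Function.update_of_ne (by omega), Function.update_of_ne (by omega),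
            Function.update_of_ne (by omega), h.scratch]
        val := by
          refine Fin.cases ?_ fun i => ?_
          · simp
          · have := h.var_mem i
            simp only [Fin.cons_succ]
            rw [Function.update_of_ne (by omega), Function.update_of_ne (by omega),
              Function.update_of_ne (by omega), h.val]
        free := fun r hr => by
          rw [Function.update_of_ne (by omega), Function.update_of_ne (by omega),
            Function.update_of_ne (by omega), h.free r (by omega)]
        length_le := by have := h.length_le; nlinarith
        val_le := by
          refine Fin.cases ?_ fun i => ?_
          · simp only [Fin.cons_zero]; nlinarith
          · have := h.val_le i
            simp only [Fin.cons_succ]; nlinarith }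
    exact ⟨h1.trans hBig, h2.mono hBig⟩
  have hA1 : ∀ j ≤ N, A j ≤ j * Q := fun j hj => by
    simpa using Finset.sum_le_card_nsmul (Finset.range j) F Q
      (fun i hi => (hbody i (by have := Finset.mem_range.1 hi; omega)).1)
  have h1 := RunIn.loop (k := d + 1)
    (p := .seq (.pop (d + 1)) (.seq (compile f (Fin.cons (d + 2) v) (d + 3))
        (.seq (.loop (d + 3) (.move (d + 3) d)) (.push (d + 2) Γ'.blank)))) (c := 3 * Q + 3)
    (fun j => (update (update (update s d (num (A j))) (d + 1) (num (N - j))) (d + 2) (num j), o))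
    N (fun j hj => ⟨by simp; omega, by
      obtain ⟨hF1, hF2⟩ := hbody j hj
      have hm := RunIn.loop_move (show d + 3 ≠ d by omega) (update (update (update (update s d
        (num (A j))) (d + 1) (num (N - (j + 1)))) (d + 2) (num j)) (d + 3) (num (F j))) o
      refine RunIn.mono (RunIn.seq (RunIn.pop _ _ _) (RunIn.seq (c := Q) ?_ (RunIn.seq hm
        (c' := 1) ?_))) ?_
      · convert hF2 using 2
        funext r
        simp only [Function.update_apply]
        split_ifs <;> (first | omega | rfl | (subst r; simp [Nat.sub_sub]))
      · refine ⟨1, le_rfl, ?_⟩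
        convert Run.push (d + 2) Γ'.blank _ o using 2
        funext r
        have hA2 : A (j + 1) = F j + A j := by
          rw [hA]; simp only [Finset.sum_range_succ]; rw [add_comm]
        have h3' := h.free (d + 3) (by omega)
        simp only [Function.update_apply, hA2]
        split_ifs <;> (first | omega | rfl | (subst r; simp [h3']))
      · simp
        omega⟩)
    (by simp)
  have h2 := RunIn.loop_pop (d + 2)
    (update (update (update s d (num (A N))) (d + 1) (num (N - N))) (d + 2) (num N)) o
  have hAN := hA1 N le_rfl
  have hv : eval x (.sum n f) w = A N := rfl
  have hp := Nat.pow_le_pow_left (show 2 ≤ P by omega) 5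
  have hs : P ^ (C + (C + 2) * D + 5) = P ^ C * Q * P ^ 5 := by rw [pow_add, pow_add]
  have hNQ : N * Q ≤ P ^ C * Q := Nat.mul_le_mul_right _ hn1
  have hPQ : P ^ C ≤ P ^ C * Q := Nat.le_mul_of_pos_right _ hQ1
  have hbig : 32 * (P ^ C * Q) ≤ P ^ (C + (C + 2) * D + 5) := by
    rw [hs]; nlinarith [Nat.mul_le_mul_left (P ^ C * Q) hp]
  rw [hv]
  refine ⟨by omega, RunIn.mono (hn2.seq (RunIn.seq (s' := (update (update (update s d
    (num (A N))) (d + 1) (num (N - N))) (d + 2) (num N), o)) (c := N * (3 * Q + 3 + 1) + 1)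
    (c' := 2 * N + 1) ?_ ?_)) ?_⟩
  · convert h1 using 2
    funext r
    have h0' := h.free d le_rfl
    have h2' := h.free (d + 2) (by omega)
    have hA0 : A 0 = 0 := by simp [hA]
    simp only [Function.update_apply, hA0]
    split_ifs <;> (first | omega | rfl | (subst r; simp [h0', h2']))
  · convert h2 using 2
    · funext r
      have h1' := h.free (d + 1) (by omega)
      have h2' := h.free (d + 2) (by omega)
      simp only [Function.update_apply]
      split_ifs <;> (first | omega | rfl | (subst r; simp [h1', h2']))
    · simp
  · have : N * (3 * Q + 3 + 1) = 3 * (N * Q) + 4 * N := by ring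
    omega

/-- Every expression is computed in time polynomial in the length of the input and the values of the
variables. -/
theorem exists_runsIn {k : ℕ} (e : CountExpr k) : ∃ C, RunsIn e C := by
  induction e with
  | var i => exact ⟨_, runsIn_var i⟩
  | zero => exact ⟨_, runsIn_zero⟩
  | one => exact ⟨_, runsIn_one⟩
  | add a b ha hb => exact ⟨_, runsIn_add ha.choose_spec hb.choose_spec⟩
  | sub a b ha hb => exact ⟨_, runsIn_sub ha.choose_spec hb.choose_spec⟩
  | sum n f hn hf => exact ⟨_, runsIn_sum hn.choose_spec hf.choose_spec⟩
  | len => exact ⟨_, runsIn_len⟩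
  | isSym γ a ha => exact ⟨_, runsIn_isSym γ ha.choose_spec⟩

end CountExpr

namespace StackProg

open Function (update)

/-! ### Writing a matrix to the output -/

/-- Put the word `w` in front of the output. -/
def outs : List Γ' → StackProg
  | [] => .pop 1
  | γ :: w => .seq (outs w) (.out γ)

theorem RunIn.outs (w : List Γ') {s : ℕ → List Γ'} (hs : s 1 = []) (o : List Γ') :
    RunIn (outs w) (s, o) (s, w ++ o) (w.length + 1) := by
  induction w with
  | nil =>
    have h := RunIn.pop 1 s o
    rw [hs, List.tail_nil, ← hs, Function.update_eq_self] at h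
    exact h
  | cons γ w ih => exact ih.seq ⟨1, le_rfl, Run.out ..⟩

/-- Empty stack `k` and put in front of the output the word of the list whose index is the number
on stack `k`. -/
def emit (k : ℕ) : List (List Γ') → StackProg
  | [] => .pop k
  | w :: ws => .ite k Γ'.blank (.seq (.pop k) (emit k ws)) (outs w)

theorem exists_runIn_emit {k : ℕ} (hk : k ≠ 1) (ws : List (List Γ')) : ∃ c, ∀ (m : ℕ)
    (hm : m < ws.length) (s : ℕ → List Γ') (o : List Γ'), s k = num m → s 1 = [] →
      RunIn (emit k ws) (s, o) (update s k [], ws[m] ++ o) c := by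
  induction ws with
  | nil => exact ⟨0, fun m hm => absurd hm (by simp)⟩
  | cons w ws ih =>
    obtain ⟨c, hc⟩ := ih
    refine ⟨c + w.length + 3, fun m hm s o h1 h2 => ?_⟩
    rcases m with _ | m
    · obtain ⟨n, hn, hr⟩ := RunIn.outs w h2 o
      have h3 : update s k [] = s := by
        rw [show ([] : List Γ') = s k from h1.symm, Function.update_eq_self]
      rw [h3]
      exact ⟨n + 1, by omega, Run.ite_neg (by simp [h1]) hr⟩
    · have h3 := RunIn.pop k s o
      have h4 := hc m (by simpa using hm) (update s k (num m)) o (by simp)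
        (by rw [Function.update_of_ne hk.symm, h2])
      rw [h1, show (num (m + 1)).tail = num m from rfl] at h3
      obtain ⟨n, hn, hr⟩ := h3.seq h4
      rw [Function.update_idem] at hr
      exact ⟨n + 1, by omega, Run.ite_pos (by simp [h1, List.replicate_succ]) hr⟩

/-- A loop that counts stack `k` down from `N` to `0` and puts `g i` in front of the output when
the stack goes down to `i`. -/
theorem RunIn.loop_down {k : ℕ} {p : StackProg} {c : ℕ} {s : ℕ → List Γ'} {g : ℕ → List Γ'} {N : ℕ}
    (h : ∀ i < N, ∀ o, RunIn p (update s k (num (i + 1)), o) (update s k (num i), g i ++ o) c)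
    (o : List Γ') :
    RunIn (.loop k p) (update s k (num N), o) (update s k [], (List.range N).flatMap g ++ o)
      (N * (c + 1) + 1) := by
  induction N generalizing o with
  | zero => exact ⟨1, by omega, Run.loop_nil (by simp)⟩
  | succ N ih =>
    obtain ⟨m, hm, hr⟩ := h N (by omega) o
    obtain ⟨m', hm', hr'⟩ := ih (fun i hi => h i (by omega)) (g N ++ o)
    refine ⟨m + m' + 1, by nlinarith, Run.loop_cons (by simp [List.replicate_succ]) hr ?_⟩
    rw [List.range_succ, List.flatMap_append, List.append_assoc]
    simpa using hr'

/-- The program that outputs the number `N` in unary, a comma, and the `N × N` matrix whose entry at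
`(u, v)` is the word of `ws` with index `c (u, v)`. -/
def printMatrix (N : CountExpr 0) (c : CountExpr 2) (ws : List (List Γ')) : StackProg :=
  .seq (N.compile ![] 2) (.seq ((CountExpr.var 0).compile ![2] 3) (.seq
    (.loop 3 (.seq (.pop 3) (.seq ((CountExpr.var 0).compile ![2] 4)
      (.loop 4 (.seq (.pop 4) (.seq (c.compile ![3, 4] 5) (emit 5 ws)))))))
    (.seq (.out .comma) (.seq (.loop 2 (.seq (.pop 2) (.out (.bit true)))) (.loop 0 (.pop 0))))))

/-- The output of `printMatrix N c ws` on the input `x`. -/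
def matrixWord (N : CountExpr 0) (c : CountExpr 2) (ws : List (List Γ')) (x : List Γ') : List Γ' :=
  List.replicate (N.eval x ![]) (Γ'.bit true) ++ Γ'.comma ::
    (List.range (N.eval x ![])).flatMap fun u => (List.range (N.eval x ![])).flatMap fun v =>
      ws.getD (c.eval x ![u, v]) []

/-- The matrix is written backwards, as the output is a stack. Stack `2` holds `N`, stacks `3` and `4`
hold the indices `u` and `v` and count down, and stack `5` receives the index of the entry. -/
theorem exists_runIn_printMatrix (N : CountExpr 0) (c : CountExpr 2) (ws : List (List Γ')) :
    ∃ C, ∀ x, (∀ u < N.eval x ![], ∀ v < N.eval x ![], c.eval x ![u, v] < ws.length) →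
      N.eval x ![] ≤ (x.length + 2) ^ C ∧
      RunIn (printMatrix N c ws) (initStore x) (fun _ => [], matrixWord N c ws x)
        ((x.length + 2) ^ C) := by
  obtain ⟨C, hN⟩ := CountExpr.exists_runsIn N
  obtain ⟨D, hc⟩ := CountExpr.exists_runsIn c
  obtain ⟨E, hE⟩ := exists_runIn_emit (show 5 ≠ 1 by omega) ws
  refine ⟨(5 * C + (C + 2) * D + 10 + E) * 3 + 5, fun x hx => ?_⟩
  set n := N.eval x ![] with hn
  set B := x.length with hB
  set s : ℕ → List Γ' := update (fun _ => []) 0 x with hs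
  set P := (B + 2) ^ C with hP
  set Q := (P + B + 2) ^ D with hQ
  set R := (P + B + 2) ^ 5 with hR
  set g : ℕ → ℕ → List Γ' := fun u v => ws.getD (c.eval x ![u, v]) [] with hg
  -- the size of the matrix
  obtain ⟨hn1, h1⟩ := hN s ![] 2 x ![] B []
    { two_le := le_rfl
      var_mem := fun i => i.elim0
      input := by simp [hs]
      scratch := by simp [hs]
      val := fun i => i.elim0
      free := fun r hr => by rw [hs, Function.update_of_ne (by omega)]
      length_le := le_rfl
      val_le := fun i => i.elim0 }
  rw [← hn] at hn1 h1
  set s2 := update s 2 (num n) with hs2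
  have e2 : s2 2 = num n := by simp [hs2]
  have e0 : s2 0 = x := by simp [hs2, hs]
  have e1 : s2 1 = [] := by simp [hs2, hs]
  have ef : ∀ r, 3 ≤ r → s2 r = [] := fun r hr => by
    rw [hs2, Function.update_of_ne (by omega), hs, Function.update_of_ne (by omega)]
  -- the copy for the outer loop
  obtain ⟨-, h2⟩ := CountExpr.runsIn_var (0 : Fin 1) s2 ![2] 3 x ![n] (P + B) []
    { two_le := by omega
      var_mem := by simp
      input := e0
      scratch := e1
      val := by simp [e2]
      free := ef
      length_le := by omega
      val_le := by simp; omega }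
  -- the outer loop
  have h3 := RunIn.loop_down (k := 3) (s := s2) (N := n) (c := 1 + (R + (n * (1 + (Q + E) + 1) + 1)))
    (g := fun u => (List.range n).flatMap (g u))
    (p := .seq (.pop 3) (.seq ((CountExpr.var 0).compile ![2] 4)
      (.loop 4 (.seq (.pop 4) (.seq (c.compile ![3, 4] 5) (emit 5 ws)))))) (fun u hu o => by
      have h4 := RunIn.pop 3 (update s2 3 (num (u + 1))) o
      rw [Function.update_idem, Function.update_self,
        show (num (u + 1)).tail = num u from rfl] at h4
      obtain ⟨-, h5⟩ := CountExpr.runsIn_var (0 : Fin 1) (update s2 3 (num u)) ![2] 4 x ![n]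
        (P + B) o
        { two_le := by omega
          var_mem := by simp
          input := by simp [e0]
          scratch := by simp [e1]
          val := by simp [e2]
          free := fun r hr => by rw [Function.update_of_ne (by omega), ef r (by omega)]
          length_le := by omega
          val_le := by simp; omega }
      have h6 := RunIn.loop_down (k := 4) (s := update s2 3 (num u)) (N := n) (c := 1 + (Q + E))
        (g := g u) (p := .seq (.pop 4) (.seq (c.compile ![3, 4] 5) (emit 5 ws)))
        (fun v hv o => by
          have h7 := RunIn.pop 4 (update (update s2 3 (num u)) 4 (num (v + 1))) o
          rw [Function.update_idem, Function.update_self,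
            show (num (v + 1)).tail = num v from rfl] at h7
          obtain ⟨-, h8⟩ := hc (update (update s2 3 (num u)) 4 (num v)) ![3, 4] 5 x ![u, v]
            (P + B) o
            { two_le := by omega
              var_mem := by simp [Fin.forall_fin_two]
              input := by simp [e0]
              scratch := by simp [e1]
              val := by simp [Fin.forall_fin_two]
              free := fun r hr => by
                rw [Function.update_of_ne (by omega), Function.update_of_ne (by omega),
                  ef r (by omega)]
              length_le := by omega
              val_le := by simp [Fin.forall_fin_two]; omega }
          have h9 := hE _ (hx u hu v hv) _ o (Function.update_self 5 (num (c.eval x ![u, v]))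
            (update (update s2 3 (num u)) 4 (num v))) (by simp [e1])
          rw [Function.update_idem] at h9
          have h10 : update (update (update s2 3 (num u)) 4 (num v)) 5 []
              = update (update s2 3 (num u)) 4 (num v) := by
            rw [Function.update_eq_self_iff]
            simp [ef]
          rw [h10] at h9
          have h11 : g u v = ws[c.eval x ![u, v]]'(hx u hu v hv) := by
            rw [hg]
            exact List.getD_eq_getElem _ _ _
          rw [h11]
          exact h7.seq (h8.seq h9)) o
      have h12 : update (update s2 3 (num u)) 4 [] = update s2 3 (num u) := by
        rw [Function.update_eq_self_iff]
        simp [ef]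
      rw [h12] at h6
      exact h4.seq (h5.seq h6)) []
  have h13 : update s2 3 [] = s2 := by
    rw [Function.update_eq_self_iff]
    simp [ef]
  rw [h13] at h3
  -- the number of rows
  set o1 := (List.range n).flatMap fun u => (List.range n).flatMap (g u) with ho1
  have h14 := RunIn.loop_down (k := 2) (s := s) (N := n) (c := 2) (g := fun _ => [Γ'.bit true])
    (p := .seq (.pop 2) (.out (.bit true))) (fun i _ o => by
      have h4 := RunIn.pop 2 (update s 2 (num (i + 1))) o
      rw [Function.update_idem, Function.update_self,
        show (num (i + 1)).tail = num i from rfl] at h4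
      exact h4.seq ⟨1, le_rfl, Run.out ..⟩) (Γ'.comma :: (o1 ++ []))
  have h15 : update s 2 [] = s := by
    rw [Function.update_eq_self_iff]
    simp [hs]
  rw [h15] at h14
  have h16 : (List.range n).flatMap (fun _ => [Γ'.bit true]) = List.replicate n (Γ'.bit true) := by
    rw [← List.map_eq_flatMap, List.map_const', List.length_range]
  rw [h16, List.append_nil] at h14
  have h17 := RunIn.loop_pop 0 s (List.replicate n (Γ'.bit true) ++ Γ'.comma :: o1)
  have h18 : update s 0 [] = fun _ => [] := by
    funext r
    by_cases hr : r = 0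
    · simp [hr]
    · rw [Function.update_of_ne hr, hs, Function.update_of_ne hr]
  rw [h18] at h17
  have h19 : s 0 = x := by simp [hs]
  rw [h19] at h17
  rw [List.append_nil] at h3
  have hfin := h1.seq (h2.seq (h3.seq ((show RunIn (.out .comma) (s2, o1) (s2, .comma :: o1) 1 from
    ⟨1, le_rfl, Run.out ..⟩).seq (h14.seq h17))))
  -- the running time
  have hP1 : 1 ≤ P := Nat.one_le_pow _ _ (by omega)
  have hS : P + B + 2 ≤ (B + 2) ^ (C + 2) := by
    have h20 : (B + 2) ^ (C + 2) = P * (B + 2) ^ 2 := pow_add _ _ _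
    have h21 : B + 3 ≤ (B + 2) ^ 2 := by nlinarith
    have h22 := Nat.mul_le_mul_left P h21
    nlinarith
  have hQ' : Q ≤ (B + 2) ^ ((C + 2) * D) := by
    rw [pow_mul]; exact Nat.pow_le_pow_left hS D
  have hR' : R ≤ (B + 2) ^ ((C + 2) * 5) := by
    rw [pow_mul]; exact Nat.pow_le_pow_left hS 5
  have hmono : ∀ a b, a ≤ b → (B + 2) ^ a ≤ (B + 2) ^ b := fun a b h =>
    Nat.pow_le_pow_right (by omega) h
  have hE' : E ≤ (B + 2) ^ E :=
    (Nat.lt_two_pow_self).le.trans (Nat.pow_le_pow_left (by omega) E)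
  set m := 5 * C + (C + 2) * D + 10 + E with hm
  set Y := (B + 2) ^ m with hY
  have y1 : P ≤ Y := hmono _ _ (by omega)
  have y2 : Q ≤ Y := hQ'.trans (hmono _ _ (by omega))
  have y3 : R ≤ Y := hR'.trans (hmono _ _ (by omega))
  have y4 : E ≤ Y := hE'.trans (hmono _ _ (by omega))
  have y5 : 1 ≤ Y := Nat.one_le_pow _ _ (by omega)
  have y6 : B + 2 ≤ Y := by simpa using hmono 1 m (by omega)
  have y7 : (B + 2) ^ (m * 3 + 5) = Y ^ 3 * (B + 2) ^ 5 := by rw [pow_add, pow_mul]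
  have y8 : 32 * Y ^ 3 ≤ (B + 2) ^ (m * 3 + 5) := by
    rw [y7, mul_comm]
    exact Nat.mul_le_mul_left _ (Nat.pow_le_pow_left (show 2 ≤ B + 2 by omega) 5)
  have yn : n ≤ Y := hn1.trans y1
  have y9 : n * (1 + (Q + E) + 1) ≤ Y * (4 * Y) := Nat.mul_le_mul yn (by omega)
  have y10 : Y ≤ Y * Y := Nat.le_mul_of_pos_left _ y5
  have y11 : n * (1 + (R + (n * (1 + (Q + E) + 1) + 1)) + 1) ≤ Y * (8 * (Y * Y)) :=
    Nat.mul_le_mul yn (by nlinarith)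
  have y12 : Y ^ 3 = Y * (Y * Y) := by ring
  have y13 : Y * Y ≤ Y * (Y * Y) := Nat.mul_le_mul_left _ y10
  have y14 : Y * (8 * (Y * Y)) = 8 * (Y * (Y * Y)) := by ring
  refine ⟨by omega, hfin.mono ?_⟩
  rw [← hP, ← hR, ← hB]
  omega

end StackProg

/-! ### Functions that are definable by expressions -/

namespace CountExpr

/-- Renaming of variables. -/
def rename : {k m : ℕ} → CountExpr k → (Fin k → Fin m) → CountExpr m
  | _, _, .var i, ρ => .var (ρ i)
  | _, _, .zero, _ => .zero
  | _, _, .one, _ => .one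
  | _, _, .add a b, ρ => .add (rename a ρ) (rename b ρ)
  | _, _, .sub a b, ρ => .sub (rename a ρ) (rename b ρ)
  | _, _, .sum n f, ρ => .sum (rename n ρ) (rename f (Fin.cons 0 (Fin.succ ∘ ρ)))
  | _, _, .len, _ => .len
  | _, _, .isSym γ a, ρ => .isSym γ (rename a ρ)

theorem eval_rename (x : List Γ') {k m : ℕ} (e : CountExpr k) (ρ : Fin k → Fin m)
    (w : Fin m → ℕ) : eval x (rename e ρ) w = eval x e (w ∘ ρ) := by
  induction e generalizing m with
  | sum n f hn hf =>
    simp only [rename, eval, hn, hf]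
    refine Finset.sum_congr rfl fun i _ => congrArg _ (funext fun j => ?_)
    refine Fin.cases ?_ (fun j => ?_) j <;> simp
  | _ => simp_all [rename, eval]

/-- Substitution of expressions for the variables. -/
def subst : {k m : ℕ} → CountExpr k → (Fin k → CountExpr m) → CountExpr m
  | _, _, .var i, σ => σ i
  | _, _, .zero, _ => .zero
  | _, _, .one, _ => .one
  | _, _, .add a b, σ => .add (subst a σ) (subst b σ)
  | _, _, .sub a b, σ => .sub (subst a σ) (subst b σ)
  | _, _, .sum n f, σ =>
    .sum (subst n σ) (subst f (Fin.cons (.var 0) fun i => rename (σ i) Fin.succ))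
  | _, _, .len, _ => .len
  | _, _, .isSym γ a, σ => .isSym γ (subst a σ)

theorem eval_subst (x : List Γ') {k m : ℕ} (e : CountExpr k) (σ : Fin k → CountExpr m)
    (w : Fin m → ℕ) : eval x (subst e σ) w = eval x e (fun i => eval x (σ i) w) := by
  induction e generalizing m with
  | sum n f hn hf =>
    simp only [subst, eval, hn, hf]
    refine Finset.sum_congr rfl fun i _ => congrArg _ (funext fun j => ?_)
    refine Fin.cases ?_ (fun j => ?_) j
    · simp [eval]
    · simp [eval_rename, Function.comp_def]
  | _ => simp_all [subst, eval]

end CountExpr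

/-- A function of instances `a` and `k` numbers is definable if it is the value of an expression
that reads the encoding of `a`. -/
def CountDefinable {α : Type} (enc : α → List Γ') (k : ℕ) (f : α → (Fin k → ℕ) → ℕ) : Prop :=
  ∃ e : CountExpr k, ∀ a w, e.eval (enc a) w = f a w

open Classical in
/-- A relation is definable if its indicator function is. -/
def CountDefinablePred {α : Type} (enc : α → List Γ') (k : ℕ) (p : α → (Fin k → ℕ) → Prop) : Prop :=
  CountDefinable enc k fun a w => if p a w then 1 else 0

section Definable

variable {α : Type} {enc : α → List Γ'} {k : ℕ}

namespace CountDefinable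

variable {f g : α → (Fin k → ℕ) → ℕ}

theorem of_eq (hf : CountDefinable enc k f) (h : ∀ a w, f a w = g a w) : CountDefinable enc k g := by
  rwa [← show f = g from funext fun a => funext fun w => h a w]

theorem var (i : Fin k) : CountDefinable enc k fun _ w => w i := ⟨.var i, fun _ _ => rfl⟩

theorem length : CountDefinable enc k fun a _ => (enc a).length := ⟨.len, fun _ _ => rfl⟩

theorem add (hf : CountDefinable enc k f) (hg : CountDefinable enc k g) :
    CountDefinable enc k fun a w => f a w + g a w :=
  let ⟨e, he⟩ := hf; let ⟨e', he'⟩ := hg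
  ⟨.add e e', fun a w => by rw [CountExpr.eval, he, he']⟩

theorem sub (hf : CountDefinable enc k f) (hg : CountDefinable enc k g) :
    CountDefinable enc k fun a w => f a w - g a w :=
  let ⟨e, he⟩ := hf; let ⟨e', he'⟩ := hg
  ⟨.sub e e', fun a w => by rw [CountExpr.eval, he, he']⟩

theorem const (n : ℕ) : CountDefinable enc k fun _ _ => n := by
  induction n with
  | zero => exact ⟨.zero, fun _ _ => rfl⟩
  | succ n ih => exact ih.add ⟨.one, fun _ _ => rfl⟩

/-- Composition with functions of another number of variables. -/
theorem comp {m : ℕ} {f : α → (Fin m → ℕ) → ℕ} (hf : CountDefinable enc m f)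
    {g : Fin m → α → (Fin k → ℕ) → ℕ} (hg : ∀ i, CountDefinable enc k (g i)) :
    CountDefinable enc k fun a w => f a fun i => g i a w := by
  obtain ⟨e, he⟩ := hf
  choose e' he' using hg
  exact ⟨e.subst e', fun a w => by simp only [CountExpr.eval_subst, he', he]⟩

theorem tail (hf : CountDefinable enc k f) :
    CountDefinable enc (k + 1) fun a w => f a (Fin.tail w) :=
  hf.comp fun i => var i.succ

theorem comp₀ {F : α → ℕ} (hF : CountDefinable enc 0 fun a _ => F a) :
    CountDefinable enc k fun a _ => F a :=
  hF.comp (g := fun i => i.elim0) fun i => i.elim0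

theorem comp₁ {F : α → ℕ → ℕ} (hF : CountDefinable enc 1 fun a w => F a (w 0))
    (hf : CountDefinable enc k f) : CountDefinable enc k fun a w => F a (f a w) :=
  hF.comp (g := fun _ => f) fun _ => hf

theorem sum {n : α → (Fin k → ℕ) → ℕ} (hn : CountDefinable enc k n)
    {F : α → (Fin k → ℕ) → ℕ → ℕ}
    (hF : CountDefinable enc (k + 1) fun a w => F a (Fin.tail w) (w 0)) :
    CountDefinable enc k fun a w => ∑ i ∈ Finset.range (n a w), F a w i := by
  obtain ⟨e, he⟩ := hn
  obtain ⟨e', he'⟩ := hF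
  exact ⟨.sum e e', fun a w => by simp [CountExpr.eval, he, he']⟩

theorem mul (hf : CountDefinable enc k f) (hg : CountDefinable enc k g) :
    CountDefinable enc k fun a w => f a w * g a w :=
  (hf.sum (F := fun a w _ => g a w) hg.tail).of_eq fun a w => by simp

theorem ite {p : α → (Fin k → ℕ) → Prop} [∀ a w, Decidable (p a w)]
    (hp : CountDefinablePred enc k p) (hf : CountDefinable enc k f)
    (hg : CountDefinable enc k g) :
    CountDefinable enc k fun a w => if p a w then f a w else g a w :=
  ((mul hp hf).add (((const 1).sub hp).mul hg)).of_eq fun a w => by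
    by_cases h : p a w <;> simp [h]

end CountDefinable

namespace CountDefinablePred

variable {p q : α → (Fin k → ℕ) → Prop} {f g : α → (Fin k → ℕ) → ℕ}

theorem of_iff (hp : CountDefinablePred enc k p) (h : ∀ a w, p a w ↔ q a w) :
    CountDefinablePred enc k q := by
  rwa [← show p = q from funext fun a => funext fun w => propext (h a w)]

theorem symbol_eq (γ : Γ') (hf : CountDefinable enc k f) :
    CountDefinablePred enc k fun a w => (enc a)[f a w]? = some γ :=
  let ⟨e, he⟩ := hf
  ⟨.isSym γ e, fun a w => by simp only [CountExpr.eval, he]; congr⟩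

theorem not (hp : CountDefinablePred enc k p) : CountDefinablePred enc k fun a w => ¬ p a w :=
  ((CountDefinable.const 1).sub hp).of_eq fun a w => by by_cases h : p a w <;> simp [h]

theorem and (hp : CountDefinablePred enc k p) (hq : CountDefinablePred enc k q) :
    CountDefinablePred enc k fun a w => p a w ∧ q a w :=
  (CountDefinable.mul hp hq).of_eq fun a w => by
    by_cases h : p a w <;> by_cases h' : q a w <;> simp [h, h']

theorem or (hp : CountDefinablePred enc k p) (hq : CountDefinablePred enc k q) :
    CountDefinablePred enc k fun a w => p a w ∨ q a w :=
  (hp.not.and hq.not).not.of_iff fun a w => by tauto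

theorem lt (hf : CountDefinable enc k f) (hg : CountDefinable enc k g) :
    CountDefinablePred enc k fun a w => f a w < g a w :=
  ((CountDefinable.const 1).sub ((CountDefinable.const 1).sub (hg.sub hf))).of_eq fun a w => by
    split_ifs <;> omega

theorem le (hf : CountDefinable enc k f) (hg : CountDefinable enc k g) :
    CountDefinablePred enc k fun a w => f a w ≤ g a w :=
  (lt hg hf).not.of_iff fun _ _ => not_lt

theorem eq (hf : CountDefinable enc k f) (hg : CountDefinable enc k g) :
    CountDefinablePred enc k fun a w => f a w = g a w :=
  ((le hf hg).and (le hg hf)).of_iff fun _ _ => le_antisymm_iff.symm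

theorem forall_lt {n : α → (Fin k → ℕ) → ℕ} (hn : CountDefinable enc k n)
    {P : α → (Fin k → ℕ) → ℕ → Prop}
    (hP : CountDefinablePred enc (k + 1) fun a w => P a (Fin.tail w) (w 0)) :
    CountDefinablePred enc k fun a w => ∀ i < n a w, P a w i := by
  classical
  have h := CountDefinable.sum (F := fun a w i => if ¬ P a w i then 1 else 0) hn
    (CountDefinable.of_eq hP.not fun a w => by congr)
  refine (eq h (.const 0)).of_iff fun a w => ?_
  simp [Finset.sum_eq_zero_iff]

end CountDefinablePred

namespace CountDefinable

variable {f g : α → (Fin k → ℕ) → ℕ}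

theorem div (hf : CountDefinable enc k f) (hg : CountDefinable enc k g) :
    CountDefinable enc k fun a w => f a w / g a w := by
  have h : CountDefinable enc k fun a w => ∑ i ∈ Finset.range (f a w),
      if 0 < g a w ∧ (i + 1) * g a w ≤ f a w then 1 else 0 :=
    hf.sum (F := fun a w i => if 0 < g a w ∧ (i + 1) * g a w ≤ f a w then 1 else 0)
      (ite ((CountDefinablePred.lt (const 0) hg.tail).and
        (.le (((var 0).add (const 1)).mul hg.tail) hf.tail)) (const 1) (const 0))
  refine h.of_eq fun a w => ?_
  rcases Nat.eq_zero_or_pos (g a w) with h0 | h0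
  · simp [h0]
  · rw [← Finset.sum_filter, Finset.sum_const, smul_eq_mul, mul_one]
    have : (Finset.range (f a w)).filter (fun i => 0 < g a w ∧ (i + 1) * g a w ≤ f a w)
        = Finset.range (f a w / g a w) := by
      ext i
      simp only [Finset.mem_filter, Finset.mem_range, h0, true_and]
      rw [← Nat.le_div_iff_mul_le h0]
      have := Nat.div_le_self (f a w) (g a w)
      omega
    rw [this, Finset.card_range]

theorem mod (hf : CountDefinable enc k f) (hg : CountDefinable enc k g) :
    CountDefinable enc k fun a w => f a w % g a w :=
  (hf.sub (hg.mul (hf.div hg))).of_eq fun _ _ => Nat.mod_eq_sub_mul_div.symm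

end CountDefinable

/-! ### Powers of two -/

/-- Powers of two are the numbers without odd divisors other than `1`. -/
theorem exists_eq_two_pow_iff (y : ℕ) :
    (∃ i, y = 2 ^ i) ↔ 0 < y ∧ ∀ d < y + 1, d = 1 ∨ d % 2 = 0 ∨ y % d ≠ 0 := by
  constructor
  · rintro ⟨i, rfl⟩
    refine ⟨by positivity, fun d _ => ?_⟩
    by_contra! h
    obtain ⟨j, -, rfl⟩ := (Nat.dvd_prime_pow Nat.prime_two).1 (Nat.dvd_of_mod_eq_zero h.2.2)
    rcases j with _ | j
    · exact h.1 rfl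
    · exact h.2.1 (by rw [pow_succ]; simp)
  · rintro ⟨h0, h⟩
    rcases Nat.eq_two_pow_or_exists_odd_prime_and_dvd y with ⟨i, hi⟩ | ⟨p, hp, hd, ho⟩
    · exact ⟨i, hi⟩
    · have h1 := hp.ne_one
      have h2 := Nat.odd_iff.1 ho
      have h3 := Nat.mod_eq_zero_of_dvd hd
      have := h p (by have := Nat.le_of_dvd h0 hd; omega)
      omega

theorem CountDefinablePred.isPowTwo {f : α → (Fin k → ℕ) → ℕ} (hf : CountDefinable enc k f) :
    CountDefinablePred enc k fun a w => ∃ i, f a w = 2 ^ i := by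
  refine CountDefinablePred.of_iff (p := fun a w => 0 < f a w ∧ ∀ d < f a w + 1,
    d = 1 ∨ d % 2 = 0 ∨ f a w % d ≠ 0) ?_ fun a w => (exists_eq_two_pow_iff _).symm
  have h : CountDefinablePred enc k fun a w => ∀ d < f a w + 1,
      d = 1 ∨ d % 2 = 0 ∨ f a w % d ≠ 0 :=
    .forall_lt (hf.add (.const 1)) (P := fun a w d => d = 1 ∨ d % 2 = 0 ∨ f a w % d ≠ 0)
      ((CountDefinablePred.eq (.var 0) (.const 1)).or
        ((CountDefinablePred.eq ((CountDefinable.var 0).mod (.const 2)) (.const 0)).or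
          (CountDefinablePred.eq (hf.tail.mod (.var 0)) (.const 0)).not))
  exact (CountDefinablePred.lt (.const 0) hf).and h

open Classical in
/-- Sums over the powers of two below a bound. -/
theorem sum_range_isPowTwo (N : ℕ) (h : ℕ → ℕ) :
    (∑ y ∈ Finset.range N, if ∃ i, y = 2 ^ i then h y else 0)
      = ∑ i ∈ (Finset.range N).filter (fun i => 2 ^ i < N), h (2 ^ i) := by
  rw [← Finset.sum_filter]
  symm
  refine Finset.sum_bij (fun i _ => 2 ^ i) (fun i hi => ?_) (fun i _ j _ hij => ?_)
    (fun y hy => ?_) (fun _ _ => rfl)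
  · simp only [Finset.mem_filter, Finset.mem_range] at hi ⊢
    exact ⟨hi.2, i, rfl⟩
  · exact Nat.pow_right_injective le_rfl hij
  · simp only [Finset.mem_filter, Finset.mem_range] at hy
    obtain ⟨h1, i, rfl⟩ := hy
    exact ⟨i, by simp only [Finset.mem_filter, Finset.mem_range]
                 exact ⟨(Nat.lt_two_pow_self).trans h1, h1⟩, rfl⟩

open Classical in
/-- The exponent of a power of two is the number of smaller powers of two. -/
theorem card_isPowTwo_lt (i : ℕ) :
    (∑ y ∈ Finset.range (2 ^ i), if ∃ j, y = 2 ^ j then 1 else 0) = i := by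
  rw [sum_range_isPowTwo _ (fun _ => 1), Finset.sum_const, smul_eq_mul, mul_one]
  have : (Finset.range (2 ^ i)).filter (fun j => 2 ^ j < 2 ^ i) = Finset.range i := by
    ext j
    simp only [Finset.mem_filter, Finset.mem_range, Nat.pow_lt_pow_iff_right (le_refl 2)]
    have := @Nat.lt_two_pow_self i
    omega
  rw [this, Finset.card_range]

open Classical in
/-- `2 ^ j` is definable as a function of `j` and of a bound for its value. -/
theorem CountDefinable.two_pow {f N : α → (Fin k → ℕ) → ℕ} (hf : CountDefinable enc k f)
    (hN : CountDefinable enc k N) (h : ∀ a w, 2 ^ f a w < N a w) :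
    CountDefinable enc k fun a w => 2 ^ f a w := by
  have h1 : CountDefinable enc 1 fun _ w =>
      ∑ z ∈ Finset.range (w 0), if ∃ j, z = 2 ^ j then 1 else 0 :=
    CountDefinable.sum (F := fun _ _ z => if ∃ j, z = 2 ^ j then 1 else 0) (.var 0)
      (.ite (.isPowTwo (.var 0)) (.const 1) (.const 0))
  have h2 : CountDefinable enc k fun a w => ∑ y ∈ Finset.range (N a w), if ∃ i, y = 2 ^ i then
      (if (∑ z ∈ Finset.range y, if ∃ j, z = 2 ^ j then 1 else 0) = f a w then y else 0) else 0 :=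
    CountDefinable.sum (F := fun a w y => if ∃ i, y = 2 ^ i then
      (if (∑ z ∈ Finset.range y, if ∃ j, z = 2 ^ j then 1 else 0) = f a w then y else 0) else 0) hN
      (.ite (.isPowTwo (.var 0)) (.ite (.eq (CountDefinable.comp₁
        (F := fun _ y => ∑ z ∈ Finset.range y, if ∃ j, z = 2 ^ j then 1 else 0) h1 (.var 0))
        hf.tail) (.var 0) (.const 0)) (.const 0))
  refine h2.of_eq fun a w => ?_
  rw [sum_range_isPowTwo _ (fun y => if (∑ z ∈ Finset.range y, if ∃ j, z = 2 ^ j then 1 else 0)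
    = f a w then y else 0)]
  simp only [card_isPowTwo_lt]
  rw [Finset.sum_ite_eq' _ (f a w) (fun i => 2 ^ i), if_pos]
  simp only [Finset.mem_filter, Finset.mem_range]
  exact ⟨(Nat.lt_two_pow_self).trans (h a w), h a w⟩

end Definable

/-! ### Reading a formula -/

/-- The number of occurrences of `γ` in the `ℓ`-th of the segments into which the commas divide `x`. -/
def segCount (γ : Γ') : List Γ' → ℕ → ℕ
  | [], _ => 0
  | c :: x, ℓ => if c = .comma then (if ℓ = 0 then 0 else segCount γ x (ℓ - 1)) else
      (if ℓ = 0 ∧ c = γ then 1 else 0) + segCount γ x ℓ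

theorem segCount_append_comma_zero (γ : Γ') {s x : List Γ'} (hs : Γ'.comma ∉ s) :
    segCount γ (s ++ .comma :: x) 0 = s.count γ := by
  induction s with
  | nil => simp [segCount]
  | cons c s ih =>
    simp only [List.mem_cons, not_or] at hs
    rw [List.cons_append, segCount, if_neg (Ne.symm hs.1), ih hs.2, List.count_cons]
    simp [add_comm]

theorem segCount_append_comma_succ (γ : Γ') {s x : List Γ'} (hs : Γ'.comma ∉ s) (ℓ : ℕ) :
    segCount γ (s ++ .comma :: x) (ℓ + 1) = segCount γ x ℓ := by
  induction s with
  | nil => simp [segCount]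
  | cons c s ih =>
    simp only [List.mem_cons, not_or] at hs
    rw [List.cons_append, segCount, if_neg (Ne.symm hs.1), ih hs.2]
    simp

/-- A position belongs to the segment `ℓ` if it has `ℓ` commas to its left. -/
theorem segCount_eq_sum {γ : Γ'} (hγ : γ ≠ .comma) (x : List Γ') (ℓ : ℕ) :
    segCount γ x ℓ = ∑ p ∈ Finset.range x.length,
      if (∑ q ∈ Finset.range p, if x[q]? = some Γ'.comma then 1 else 0) = ℓ ∧ x[p]? = some γ
      then 1 else 0 := by
  induction x generalizing ℓ with
  | nil => simp [segCount]
  | cons c x ih =>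
    rw [List.length_cons, Finset.sum_range_succ']
    simp only [Finset.sum_range_succ', List.getElem?_cons_succ, List.getElem?_cons_zero,
      Finset.range_zero, Finset.sum_empty, Option.some.injEq]
    rw [segCount]
    by_cases hc : c = .comma
    · subst hc
      rcases ℓ with _ | ℓ
      · simp [hγ.symm]
      · simp [ih, hγ.symm]
    · simp only [hc, if_false, add_zero]
      rw [ih, add_comm]
      congr 2
      simp only [eq_comm]

theorem count_comma_eq_sum (x : List Γ') :
    x.count Γ'.comma = ∑ p ∈ Finset.range x.length, if x[p]? = some Γ'.comma then 1 else 0 := by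
  induction x with
  | nil => simp
  | cons c x ih =>
    rw [List.length_cons, Finset.sum_range_succ', List.count_cons, ih]
    simp

namespace CountDefinable

variable {α : Type} {enc : α → List Γ'} {k : ℕ} {f : α → (Fin k → ℕ) → ℕ}

theorem segCount {γ : Γ'} (hγ : γ ≠ .comma) (hf : CountDefinable enc k f) :
    CountDefinable enc k fun a w => segCount γ (enc a) (f a w) := by
  have h1 : CountDefinable enc 1 fun a w =>
      ∑ q ∈ Finset.range (w 0), if (enc a)[q]? = some Γ'.comma then 1 else 0 :=
    sum (F := fun a _ q => if (enc a)[q]? = some Γ'.comma then 1 else 0) (var 0)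
      (ite (.symbol_eq _ (var 0)) (const 1) (const 0))
  have h2 : CountDefinable enc k fun a w => ∑ p ∈ Finset.range (enc a).length,
      if (∑ q ∈ Finset.range p, if (enc a)[q]? = some Γ'.comma then 1 else 0) = f a w ∧
        (enc a)[p]? = some γ then 1 else 0 :=
    sum (F := fun a w p =>
        if (∑ q ∈ Finset.range p, if (enc a)[q]? = some Γ'.comma then 1 else 0) = f a w ∧
        (enc a)[p]? = some γ then 1 else 0) length
      (ite (.and (.eq (comp₁
        (F := fun a p => ∑ q ∈ Finset.range p, if (enc a)[q]? = some Γ'.comma then 1 else 0)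
        h1 (var 0)) hf.tail) (.symbol_eq _ (var 0))) (const 1) (const 0))
  exact h2.of_eq fun a w => (segCount_eq_sum hγ _ _).symm

theorem count_comma : CountDefinable enc k fun a _ => (enc a).count Γ'.comma := by
  refine of_eq (sum (F := fun a _ p => if (enc a)[p]? = some Γ'.comma then 1 else 0) length
      (ite (.symbol_eq _ (var 0)) (const 1) (const 0))) fun a w => (count_comma_eq_sum _).symm

end CountDefinable

namespace ThreeCNF

variable (φ : ThreeCNF)

/-- The literals of the formula, clause by clause. -/
def literals : List (Fin φ.n × Bool) := φ.clauses.flatMap fun c => [c 0, c 1, c 2]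

theorem encode_eq : φ.encode = List.replicate φ.n (Γ'.bit true) ++ Γ'.comma ::
    φ.literals.flatMap encodeLiteral := by
  rw [encode, literals, List.flatMap_assoc]
  simp

theorem getElem?_literals (c : ℕ) (r : Fin 3) :
    φ.literals[3 * c + r]? = φ.clauses[c]?.map (· r) := by
  rw [literals]
  generalize φ.clauses = C
  induction C generalizing c with
  | nil => simp
  | cons d C ih =>
    rcases c with _ | c
    · fin_cases r <;> simp
    · rw [List.flatMap_cons, show 3 * (c + 1) + (r : ℕ) = (3 * c + r) + 3 by ring,
        List.getElem?_append_right (by simp)]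
      simpa using ih c

theorem length_literals : φ.literals.length = 3 * φ.clauses.length := by
  simp [literals, List.length_flatMap, mul_comm]

/-- The variable of the literal with index `ℓ`. -/
def litVar (ℓ : ℕ) : ℕ := (φ.literals[ℓ]?.map fun l => (l.1 : ℕ)).getD 0

/-- `1` if the literal with index `ℓ` is negated, and `0` otherwise. -/
def litNeg (ℓ : ℕ) : ℕ := (φ.literals[ℓ]?.map fun l => if l.2 then 0 else 1).getD 0

theorem segCount_literals (γ : Γ') {n : ℕ} (l : List (Fin n × Bool)) (ℓ : ℕ) :
    segCount γ (l.flatMap encodeLiteral) ℓ = (l[ℓ]?.map fun l =>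
      (Γ'.bit l.2 :: List.replicate l.1 (Γ'.bit true)).count γ).getD 0 := by
  induction l generalizing ℓ with
  | nil => simp [segCount]
  | cons a l ih =>
    have h : (a :: l).flatMap encodeLiteral
        = (Γ'.bit a.2 :: List.replicate a.1 (Γ'.bit true)) ++ .comma :: l.flatMap encodeLiteral := by
      simp [encodeLiteral]
    have h' : Γ'.comma ∉ Γ'.bit a.2 :: List.replicate a.1 (Γ'.bit true) := by
      simp [List.mem_replicate]
    rw [h]
    rcases ℓ with _ | ℓ
    · rw [segCount_append_comma_zero _ h']
      simp
    · rw [segCount_append_comma_succ _ h', ih]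
      simp

theorem segCount_encode_zero : segCount (.bit true) φ.encode 0 = φ.n := by
  rw [encode_eq, segCount_append_comma_zero _ (by simp [List.mem_replicate])]
  simp

theorem segCount_encode_succ (γ : Γ') (ℓ : ℕ) :
    segCount γ φ.encode (ℓ + 1) = segCount γ (φ.literals.flatMap encodeLiteral) ℓ := by
  rw [encode_eq, segCount_append_comma_succ _ (by simp [List.mem_replicate])]

theorem litNeg_eq (ℓ : ℕ) : φ.litNeg ℓ = segCount (.bit false) φ.encode (ℓ + 1) := by
  rw [segCount_encode_succ, segCount_literals, litNeg]
  congr 2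
  funext l
  rcases l with ⟨v, _ | _⟩ <;> simp [List.count_replicate]

/-- The first symbol of the segment of a literal is its sign, all others are `Γ'.bit true`. -/
theorem litVar_eq (ℓ : ℕ) : φ.litVar ℓ = segCount (.bit true) φ.encode (ℓ + 1) +
    segCount (.bit false) φ.encode (ℓ + 1) - 1 := by
  simp only [segCount_encode_succ, segCount_literals, litVar]
  rcases φ.literals[ℓ]? with _ | ⟨v, _ | _⟩ <;> simp [List.count_replicate]

theorem count_comma_encode : φ.encode.count .comma = 3 * φ.clauses.length + 1 := by
  have h : ∀ l : List (Fin φ.n × Bool), (l.flatMap encodeLiteral).count .comma = l.length := by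
    intro l
    induction l with
    | nil => simp
    | cons a l ih => simp [ih, encodeLiteral, List.count_replicate]
  rw [encode_eq, List.count_append, List.count_cons, h, length_literals]
  simp [List.count_replicate]

theorem definable_n : CountDefinable encode 0 fun φ _ => φ.n :=
  ((CountDefinable.const 0).segCount (γ := .bit true) (by simp)).of_eq fun φ _ =>
    φ.segCount_encode_zero

theorem definable_clauses : CountDefinable encode 0 fun φ _ => φ.clauses.length :=
  (CountDefinable.count_comma.div (.const 3)).of_eq fun φ _ => by
    rw [count_comma_encode]; omega

theorem definable_litNeg : CountDefinable encode 1 fun φ w => φ.litNeg (w 0) :=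
  (((CountDefinable.var 0).add (.const 1)).segCount (γ := .bit false) (by simp)).of_eq fun φ w =>
    (φ.litNeg_eq _).symm

theorem definable_litVar : CountDefinable encode 1 fun φ w => φ.litVar (w 0) :=
  (((((CountDefinable.var 0).add (.const 1)).segCount (γ := .bit true) (by simp)).add
    (((CountDefinable.var 0).add (.const 1)).segCount (γ := .bit false) (by simp))).sub
      (.const 1)).of_eq fun φ w => (φ.litVar_eq _).symm

end ThreeCNF

/-! ### The game of a formula -/

namespace ThreeCNF

variable (φ : ThreeCNF)

/-- The number of variables in a group, about half the binary logarithm of the number of all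
variables. -/
def bits : ℕ := Nat.log 4 (φ.n + 1) + 1

/-- The number of labels: a label stands for an assignment of the variables of one group. -/
def labels : ℕ := 2 ^ φ.bits

/-- The number of groups of variables. -/
def groups : ℕ := φ.n / φ.bits + 1

/-- The number of vertices in a layer. -/
def width : ℕ := 9 + φ.groups + φ.labels

/-- The number of layers: every clause has one layer more than there are labels. -/
def layers : ℕ := φ.clauses.length * (φ.labels + 1)

/-- The number of vertices. -/
def size : ℕ := φ.layers * φ.width

/-- The layer of a vertex. -/
def layer (u : ℕ) : ℕ := u / φ.width

/-- The column of a vertex. -/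
def col (u : ℕ) : ℕ := u % φ.width

/-- The first vertex in the layer of a vertex. -/
def base (u : ℕ) : ℕ := φ.width * φ.layer u

/-- The position of the layer of a vertex among the layers of the same clause. -/
def phase (u : ℕ) : ℕ := φ.layer u % (φ.labels + 1)

/-- The index of the `r`-th literal of the clause to which the layer of a vertex belongs. -/
def litIndex (u r : ℕ) : ℕ := 3 * (φ.layer u / (φ.labels + 1)) + r

/-- The group of the variable of a literal. The group `i` consists of the variables from `i * φ.bits`
to `i * φ.bits + φ.bits - 1`. -/
def litGroup (ℓ : ℕ) : ℕ := φ.litVar ℓ / φ.bits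

/-- The label `k` makes the variable of the literal `ℓ` true, provided that it is assigned to the
group of that variable. -/
def LitBit (ℓ k : ℕ) : Prop := k / 2 ^ (φ.litVar ℓ % φ.bits) % 2 = 1

instance (ℓ k : ℕ) : Decidable (φ.LitBit ℓ k) := inferInstanceAs (Decidable (_ = _))

/-- The arcs with source `u`: their targets and weights. In every layer, the columns are
* `0`: the vertex of the truth line;
* `1` and `2`: the chaser and the runner, which are active in the last layer of a clause only;
* `3 + r` for `r < 3`: the vertex of the walker of the `r`-th literal of the clause;
* `6 + r` for `r < 3`: the comparer of the walker of the `r`-th literal;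
* `9 + i`: the vertex of the line of the `i`-th group of variables;
* `9 + φ.groups + k`: the vertex of the line of the label `k`.

In the first layer of a clause the walkers start. In the layer of phase `q + 1`, the comparers test
the label `q` and the walkers make a step. In the layer of phase `φ.labels`, the last one, the chaser
weighs the truth line against its runner: for a positive literal it likes the walker, for a negative
literal it likes the truth line better and dislikes the walker. -/
def arcs (u : ℕ) : List (ℕ × ℤ) :=
  if φ.col u = 0 ∨ 9 ≤ φ.col u then
    if φ.layer u = 0 then [] else [(u - φ.width, 1)]
  else if φ.col u = 1 then
    if φ.phase u = φ.labels then
      [(φ.base u, 3 + φ.litNeg (φ.litIndex u 0) + φ.litNeg (φ.litIndex u 1) +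
        φ.litNeg (φ.litIndex u 2)), (φ.base u + 3, 1 - 2 * φ.litNeg (φ.litIndex u 0)),
        (φ.base u + 4, 1 - 2 * φ.litNeg (φ.litIndex u 1)),
        (φ.base u + 5, 1 - 2 * φ.litNeg (φ.litIndex u 2)), (φ.base u + 2, 4)]
    else []
  else if φ.col u = 2 then
    if φ.phase u = φ.labels then [(φ.base u + 1, -1)] else []
  else if φ.col u < 6 then
    if φ.phase u = 0 then
      [(φ.base u, -1), (φ.base u + 9 + φ.litGroup (φ.litIndex u (φ.col u - 3)), -1)]
    else [(u - φ.width, 2), (u + 3, 2), (φ.base u, 3)]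
  else
    if φ.phase u = 0 then []
    else if φ.LitBit (φ.litIndex u (φ.col u - 6)) (φ.phase u - 1) then
      [(u - 3 - φ.width, 3), (φ.base u + 9 + φ.litGroup (φ.litIndex u (φ.col u - 6)), 2),
        (φ.base u + 9 + φ.groups + (φ.phase u - 1), 2)]
    else [(u - 3 - φ.width, 3)]

/-- The weight of the pair `(u, v)`. -/
def weight (u v : ℕ) : ℤ := ((φ.arcs u).map fun a => if v = a.1 then a.2 else 0).sum

/-- `φ.weight u v + 1`, computed with natural numbers, since expressions have no negative values.
All positive terms are added before the negative ones are subtracted, so that truncation has no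
effect. -/
def weightCode (u v : ℕ) : ℕ :=
  if φ.col u = 0 ∨ 9 ≤ φ.col u then
    if φ.layer u = 0 then 1 else 1 + (if v = u - φ.width then 1 else 0)
  else if φ.col u = 1 then
    if φ.phase u = φ.labels then
      1 + (if v = φ.base u then 3 + φ.litNeg (φ.litIndex u 0) + φ.litNeg (φ.litIndex u 1) +
        φ.litNeg (φ.litIndex u 2) else 0)
      + (if v = φ.base u + 3 then 1 else 0) + (if v = φ.base u + 4 then 1 else 0)
      + (if v = φ.base u + 5 then 1 else 0) + (if v = φ.base u + 2 then 4 else 0)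
      - ((if v = φ.base u + 3 then 2 * φ.litNeg (φ.litIndex u 0) else 0)
        + (if v = φ.base u + 4 then 2 * φ.litNeg (φ.litIndex u 1) else 0)
        + (if v = φ.base u + 5 then 2 * φ.litNeg (φ.litIndex u 2) else 0))
    else 1
  else if φ.col u = 2 then
    if φ.phase u = φ.labels then 1 - (if v = φ.base u + 1 then 1 else 0) else 1
  else if φ.col u < 6 then
    if φ.phase u = 0 then
      1 - ((if v = φ.base u then 1 else 0)
        + (if v = φ.base u + 9 + φ.litGroup (φ.litIndex u (φ.col u - 3)) then 1 else 0))
    else 1 + (if v = u - φ.width then 2 else 0) + (if v = u + 3 then 2 else 0)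
      + (if v = φ.base u then 3 else 0)
  else
    if φ.phase u = 0 then 1
    else if φ.LitBit (φ.litIndex u (φ.col u - 6)) (φ.phase u - 1) then
      1 + (if v = u - 3 - φ.width then 3 else 0)
      + (if v = φ.base u + 9 + φ.litGroup (φ.litIndex u (φ.col u - 6)) then 2 else 0)
      + (if v = φ.base u + 9 + φ.groups + (φ.phase u - 1) then 2 else 0)
    else 1 + (if v = u - 3 - φ.width then 3 else 0)

theorem litNeg_le_one (ℓ : ℕ) : φ.litNeg ℓ ≤ 1 := by
  rw [litNeg]
  rcases φ.literals[ℓ]? with _ | ⟨v, _ | _⟩ <;> simp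

theorem bits_pos : 0 < φ.bits := Nat.succ_pos _

theorem labels_pos : 0 < φ.labels := by rw [labels]; positivity

theorem width_pos : 0 < φ.width := by rw [width]; omega

theorem base_add_col (u : ℕ) : φ.base u + φ.col u = u := Nat.div_add_mod u φ.width

theorem col_lt (u : ℕ) : φ.col u < φ.width := Nat.mod_lt _ φ.width_pos

theorem width_le_base {u : ℕ} (h : φ.layer u ≠ 0) : φ.width ≤ φ.base u :=
  Nat.le_mul_of_pos_right _ (Nat.pos_of_ne_zero h)

theorem layer_ne_zero_of_phase {u : ℕ} (h : φ.phase u ≠ 0) : φ.layer u ≠ 0 := by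
  rintro h0
  rw [phase, h0, Nat.zero_mod] at h
  exact h rfl

theorem litGroup_lt (ℓ : ℕ) : φ.litGroup ℓ < φ.groups := by
  rw [litGroup, groups, Nat.lt_succ_iff]
  refine Nat.div_le_div_right ?_
  rw [litVar]
  rcases φ.literals[ℓ]? with _ | ⟨v, _⟩
  · simp
  · simp [v.2.le]

theorem weightCode_eq (u v : ℕ) :
    (φ.weightCode u v : ℤ) = φ.weight u v + 1 ∧ φ.weightCode u v < 8 := by
  have h0 := φ.litNeg_le_one (φ.litIndex u 0)
  have h1 := φ.litNeg_le_one (φ.litIndex u 1)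
  have h2 := φ.litNeg_le_one (φ.litIndex u 2)
  have hb := φ.base_add_col u
  have hc := φ.col_lt u
  have hw := φ.width_pos
  have hw' : φ.width = 9 + φ.groups + φ.labels := rfl
  have hl := φ.width_le_base (u := u)
  have hp := φ.layer_ne_zero_of_phase (u := u)
  have hg := φ.litGroup_lt (φ.litIndex u (φ.col u - 6))
  rw [weight, arcs, weightCode]
  generalize φ.litNeg (φ.litIndex u 0) = n0 at *
  generalize φ.litNeg (φ.litIndex u 1) = n1 at *
  generalize φ.litNeg (φ.litIndex u 2) = n2 at *
  generalize φ.litGroup (φ.litIndex u (φ.col u - 3)) = i at *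
  generalize φ.litGroup (φ.litIndex u (φ.col u - 6)) = j at *
  generalize φ.col u = c at *
  generalize φ.base u = b at *
  by_cases hA : c = 0 ∨ 9 ≤ c
  · simp only [hA, if_true]
    split_ifs <;> simp_all
  simp only [hA, if_false]
  by_cases hB : c = 1
  · simp only [hB, if_true]
    by_cases hq : φ.phase u = φ.labels
    · simp only [hq, if_true, List.map_cons, List.map_nil, List.sum_cons, List.sum_nil]
      clear hl hp hg hw' hA hc
      split_ifs <;> omega
    · simp [hq]
  simp only [hB, if_false]
  by_cases hC : c = 2
  · simp only [hC, if_true]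
    split_ifs <;> simp_all
  simp only [hC, if_false]
  by_cases hD : c < 6
  · simp only [hD, if_true]
    by_cases hq : φ.phase u = 0
    · simp only [hq, if_true, List.map_cons, List.map_nil, List.sum_cons, List.sum_nil]
      clear hl hp hg hw' hA hc
      split_ifs <;> omega
    · simp only [hq, if_false, List.map_cons, List.map_nil, List.sum_cons, List.sum_nil]
      have := hl (hp hq)
      clear hl hp hg hw' hA
      split_ifs <;> omega
  simp only [hD, if_false]
  by_cases hq : φ.phase u = 0
  · simp [hq]
  simp only [hq, if_false]
  have := hl (hp hq)
  clear hl hp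
  by_cases hE : φ.LitBit (φ.litIndex u (c - 6)) (φ.phase u - 1)
  · simp only [hE, if_true, List.map_cons, List.map_nil, List.sum_cons, List.sum_nil]
    split_ifs <;> omega
  · simp only [hE, if_false, List.map_cons, List.map_nil, List.sum_cons, List.sum_nil]
    split_ifs <;> omega

/-! ### The game is definable -/

/-- An a priori bound for powers of two, as needed for `CountDefinable.two_pow`. -/
theorem labels_le : φ.labels ≤ 2 * (φ.n + 1) := by
  have h1 : 4 ^ Nat.log 4 (φ.n + 1) ≤ φ.n + 1 := Nat.pow_log_le_self 4 (by omega)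
  have h2 : 2 ^ Nat.log 4 (φ.n + 1) ≤ 4 ^ Nat.log 4 (φ.n + 1) := Nat.pow_le_pow_left (by omega) _
  rw [labels, bits, pow_succ]
  omega

theorem definable_bits : CountDefinable encode 0 fun φ _ => φ.bits := by
  classical
  have h : CountDefinable encode 0 fun φ _ => ∑ y ∈ Finset.range (2 * φ.n + 3),
      if ∃ i, y = 2 ^ i then (if y * y ≤ φ.n + 1 then 1 else 0) else 0 :=
    CountDefinable.sum (F := fun φ _ y =>
        if ∃ i, y = 2 ^ i then (if y * y ≤ φ.n + 1 then 1 else 0) else 0)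
      (((CountDefinable.const 2).mul definable_n).add (.const 3))
      (.ite (.isPowTwo (.var 0)) (.ite (.le (.mul (.var 0) (.var 0)) (definable_n.comp₀.add (.const 1)))
        (.const 1) (.const 0)) (.const 0))
  refine h.of_eq fun φ _ => ?_
  rw [sum_range_isPowTwo _ (fun y => if y * y ≤ φ.n + 1 then 1 else 0), ← Finset.sum_filter,
    Finset.sum_const, smul_eq_mul, mul_one, Finset.filter_filter]
  have : (Finset.range (2 * φ.n + 3)).filter
      (fun i => 2 ^ i < 2 * φ.n + 3 ∧ 2 ^ i * 2 ^ i ≤ φ.n + 1) = Finset.range φ.bits := by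
    ext i
    have h1 : 2 ^ i * 2 ^ i = 4 ^ i := by rw [← mul_pow]; norm_num
    have h2 : i < 2 ^ i := Nat.lt_two_pow_self
    have h3 := Nat.le_log_iff_pow_le (b := 4) (x := i) (y := φ.n + 1) (by omega) (by omega)
    simp only [Finset.mem_filter, Finset.mem_range, h1, bits, Nat.lt_succ_iff, h3]
    have h4 : 2 ^ i ≤ 4 ^ i := Nat.pow_le_pow_left (by omega) _
    omega
  rw [this, Finset.card_range]

theorem definable_labels : CountDefinable encode 0 fun φ _ => φ.labels :=
  definable_bits.two_pow (((CountDefinable.const 2).mul definable_n).add (.const 3))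
    fun φ _ => by have := φ.labels_le; rw [labels] at this; omega

theorem definable_groups : CountDefinable encode 0 fun φ _ => φ.groups :=
  (definable_n.div definable_bits).add (.const 1)

theorem definable_width : CountDefinable encode 0 fun φ _ => φ.width :=
  ((CountDefinable.const 9).add definable_groups).add definable_labels

theorem definable_size : CountDefinable encode 0 fun φ _ => φ.size :=
  (definable_clauses.mul (definable_labels.add (.const 1))).mul definable_width

section

variable {k : ℕ} {f g : ThreeCNF → (Fin k → ℕ) → ℕ}

theorem definable_layer (hf : CountDefinable encode k f) :
    CountDefinable encode k fun φ w => φ.layer (f φ w) :=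
  hf.div definable_width.comp₀

theorem definable_col (hf : CountDefinable encode k f) :
    CountDefinable encode k fun φ w => φ.col (f φ w) :=
  hf.mod definable_width.comp₀

theorem definable_base (hf : CountDefinable encode k f) :
    CountDefinable encode k fun φ w => φ.base (f φ w) :=
  definable_width.comp₀.mul (definable_layer hf)

theorem definable_phase (hf : CountDefinable encode k f) :
    CountDefinable encode k fun φ w => φ.phase (f φ w) :=
  (definable_layer hf).mod (definable_labels.comp₀.add (.const 1))

theorem definable_litIndex (hf : CountDefinable encode k f) (hg : CountDefinable encode k g) :
    CountDefinable encode k fun φ w => φ.litIndex (f φ w) (g φ w) :=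
  ((CountDefinable.const 3).mul
    ((definable_layer hf).div (definable_labels.comp₀.add (.const 1)))).add hg

theorem definable_litGroup (hf : CountDefinable encode k f) :
    CountDefinable encode k fun φ w => φ.litGroup (f φ w) :=
  (definable_litVar.comp₁ hf).div definable_bits.comp₀

theorem definable_litBit (hf : CountDefinable encode k f) (hg : CountDefinable encode k g) :
    CountDefinablePred encode k fun φ w => φ.LitBit (f φ w) (g φ w) := by
  refine .eq (.mod (.div hg (.two_pow ((definable_litVar.comp₁ hf).mod definable_bits.comp₀)
    (((CountDefinable.const 2).mul definable_n.comp₀).add (.const 3)) fun φ w => ?_))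
    (.const 2)) (.const 1)
  have h1 := φ.labels_le
  have h2 : 2 ^ (φ.litVar (f φ w) % φ.bits) ≤ φ.labels :=
    Nat.pow_le_pow_right (by omega) (Nat.mod_lt _ φ.bits_pos).le
  omega

end

theorem definable_weightCode :
    CountDefinable encode 2 fun φ w => φ.weightCode (w 0) (w 1) := by
  have hu : CountDefinable encode 2 fun _ w => w 0 := .var 0
  have hv : CountDefinable encode 2 fun _ w => w 1 := .var 1
  have hw : CountDefinable encode 2 fun φ _ => φ.width := definable_width.comp₀
  have hg : CountDefinable encode 2 fun φ _ => φ.groups := definable_groups.comp₀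
  have ht : CountDefinable encode 2 fun φ _ => φ.labels := definable_labels.comp₀
  have hc := definable_col hu
  have hl := definable_layer hu
  have hb := definable_base hu
  have hq := definable_phase hu
  have hn : ∀ r, CountDefinable encode 2 fun φ w => φ.litNeg (φ.litIndex (w 0) r) := fun r =>
    definable_litNeg.comp₁ (definable_litIndex hu (.const r))
  have hi : ∀ r, CountDefinable encode 2 fun φ w =>
      φ.litGroup (φ.litIndex (w 0) (φ.col (w 0) - r)) := fun r =>
    definable_litGroup (definable_litIndex hu (hc.sub (.const r)))
  have hB : CountDefinablePred encode 2 fun φ w =>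
      φ.LitBit (φ.litIndex (w 0) (φ.col (w 0) - 6)) (φ.phase (w 0) - 1) :=
    definable_litBit (definable_litIndex hu (hc.sub (.const 6))) (hq.sub (.const 1))
  have d1 := CountDefinable.const (enc := encode) (k := 2)
  unfold weightCode
  repeat' first
    | with_reducible exact hB
    | with_reducible exact hu
    | with_reducible exact hv
    | with_reducible exact hw
    | with_reducible exact hg
    | with_reducible exact ht
    | with_reducible exact hc
    | with_reducible exact hl
    | with_reducible exact hb
    | with_reducible exact hq
    | with_reducible exact hn _
    | with_reducible exact hi _
    | with_reducible exact d1 _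
    | with_reducible apply CountDefinable.ite
    | with_reducible apply CountDefinablePred.or
    | with_reducible apply CountDefinablePred.eq
    | with_reducible apply CountDefinablePred.lt
    | with_reducible apply CountDefinablePred.le
    | with_reducible apply CountDefinable.add
    | with_reducible apply CountDefinable.sub
    | with_reducible apply CountDefinable.mul

end ThreeCNF

namespace ThreeCNF

variable (φ : ThreeCNF)

/-- The game of a formula. -/
def game : ASHG (Fin φ.size) where
  graph := ⟨fun u v => φ.weight u v ≠ 0⟩
  weight u v := φ.weight u v
  weight_eq_zero u v h := by simpa using h

/-- The instance of Nash Stability of a formula. -/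
def toASHG : ASHGInstance := ⟨φ.size, φ.game⟩

/-! ### The encoding of the game -/

/-- The entries of the weighted adjacency matrix for the weights `-1, …, 6`. -/
def entryWords : List (List Γ') := (List.range 8).map fun c : ℕ =>
  Γ'.bit (decide (c ≠ 1)) :: Γ'.bit (decide (c < 1)) ::
    (((c : ℤ) - 1).natAbs.bits.map Γ'.bit ++ [Γ'.comma])

theorem encodeEntry_game (u v : Fin φ.size) :
    ASHGInstance.encodeEntry φ.game u v = entryWords.getD (φ.weightCode u v) [] := by
  obtain ⟨h1, h2⟩ := φ.weightCode_eq u v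
  have h3 : φ.weight u v = (φ.weightCode u v : ℤ) - 1 := by omega
  rw [List.getD_eq_getElem _ _ (by simpa [entryWords] using h2)]
  simp only [entryWords, List.getElem_map, List.getElem_range, ASHGInstance.encodeEntry, game, h3]
  congr 3
  · simp only [eq_iff_iff]
    omega
  · simp only [decide_eq_decide]
    omega

theorem flatMap_finRange {β : Type} (n : ℕ) (f : ℕ → List β) :
    (List.finRange n).flatMap (fun i : Fin n => f i) = (List.range n).flatMap f := by
  rw [← List.map_coe_finRange_eq_range, List.flatMap_map]

theorem encode_toASHG : φ.toASHG.encode = List.replicate φ.size (Γ'.bit true) ++ Γ'.comma ::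
    (List.range φ.size).flatMap fun u => (List.range φ.size).flatMap fun v =>
      entryWords.getD (φ.weightCode u v) [] := by
  rw [ASHGInstance.encode]
  congr 2
  rw [← flatMap_finRange]
  refine List.flatMap_congr fun u _ => ?_
  rw [← flatMap_finRange]
  exact List.flatMap_congr fun v _ => φ.encodeEntry_game u v

/-- A program writes the encoding of the game in polynomial time. -/
theorem exists_program : ∃ (p : StackProg) (C : ℕ), ∀ φ : ThreeCNF,
    φ.size ≤ (φ.encode.length + 2) ^ C ∧
    StackProg.RunIn p (StackProg.initStore φ.encode) (fun _ => [], φ.toASHG.encode)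
      ((φ.encode.length + 2) ^ C) := by
  obtain ⟨N, hN⟩ := definable_size
  obtain ⟨c, hc⟩ := definable_weightCode
  obtain ⟨C, hC⟩ := StackProg.exists_runIn_printMatrix N c entryWords
  refine ⟨StackProg.printMatrix N c entryWords, C, fun φ => ?_⟩
  have h1 : ∀ u v, c.eval φ.encode ![u, v] = φ.weightCode u v := fun u v => hc φ ![u, v]
  have h2 := hC φ.encode (fun u _ v _ => by
    rw [h1]
    simpa [entryWords] using (φ.weightCode_eq u v).2)
  have h3 : StackProg.matrixWord N c entryWords φ.encode = φ.toASHG.encode := by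
    rw [encode_toASHG, StackProg.matrixWord, hN φ]
    simp only [h1]
  rwa [h3, hN φ] at h2

/-! ### Size of weights, degrees and pathwidth -/

theorem maxWeight_le : φ.game.maxWeight ≤ 6 := by
  refine Finset.sup_le fun e _ => ?_
  have := φ.weightCode_eq e.1 e.2
  simp only [game]
  omega

/-- Every arc stays in a layer or leads to the previous layer, and it starts in one of the columns
`1, …, 8` or leads to the same column of the previous layer. -/
theorem of_mem_arcs {u : ℕ} {a : ℕ × ℤ} (ha : a ∈ φ.arcs u) :
    a.1 ≠ u ∧ (φ.layer a.1 = φ.layer u ∨ φ.layer a.1 + 1 = φ.layer u) ∧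
      (φ.col u < 9 ∨ a.1 + φ.width = u) ∧ a.1 < φ.base u + φ.width := by
  have hb := φ.base_add_col u
  have hc := φ.col_lt u
  have hw' : φ.width = 9 + φ.groups + φ.labels := rfl
  have hp := φ.layer_ne_zero_of_phase (u := u)
  have hph : φ.phase u ≤ φ.labels := Nat.lt_succ_iff.1 (Nat.mod_lt _ (Nat.succ_pos _))
  have hbe : φ.base u = φ.width * φ.layer u := rfl
  have hw := φ.width_pos
  have key : ∀ x, φ.base u ≤ x → x < φ.base u + φ.width → φ.layer x = φ.layer u := by
    intro x h1 h2
    rw [hbe] at h1 h2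
    exact Nat.div_eq_of_lt_le (by linarith) (by rw [Nat.succ_mul]; linarith)
  have key' : φ.layer u ≠ 0 → φ.width ≤ φ.base u ∧
      ∀ x, φ.base u ≤ x + φ.width → x < φ.base u → φ.layer x + 1 = φ.layer u := by
    intro h0
    refine ⟨φ.width_le_base h0, fun x h1 h2 => ?_⟩
    obtain ⟨l, hl⟩ : ∃ l, φ.layer u = l + 1 := ⟨φ.layer u - 1, by omega⟩
    rw [hl, Nat.succ_inj]
    rw [hbe, hl, mul_add] at h1 h2
    exact Nat.div_eq_of_lt_le (by linarith) (by rw [Nat.succ_mul]; linarith)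
  have hg := φ.litGroup_lt (φ.litIndex u (φ.col u - 6))
  have hg' := φ.litGroup_lt (φ.litIndex u (φ.col u - 3))
  rw [arcs] at ha
  split_ifs at ha with h1 h2 h2 h3 h3 h4 h5 h6 h6 h7
  all_goals simp only [List.mem_cons, List.not_mem_nil, or_false] at ha
  · obtain ⟨k1, k2⟩ := key' h2
    subst ha
    exact ⟨by simp only; omega, .inr (k2 _ (by simp only; omega) (by simp only; omega)),
      .inr (by simp only; omega), by simp only; omega⟩
  · rcases ha with ha | ha | ha | ha | ha <;> subst ha <;>
    exact ⟨by simp only; omega, .inl (key _ (by simp only; omega) (by simp only; omega)),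
      .inl (by omega), by simp only; omega⟩
  · subst ha
    exact ⟨by simp only; omega, .inl (key _ (by simp only; omega) (by simp only; omega)),
      .inl (by omega), by simp only; omega⟩
  · rcases ha with ha | ha <;> subst ha <;>
    exact ⟨by simp only; omega, .inl (key _ (by simp only; omega) (by simp only; omega)),
      .inl (by omega), by simp only; omega⟩
  · obtain ⟨k1, k2⟩ := key' (hp h6)
    rcases ha with ha | ha | ha <;> subst ha
    · exact ⟨by simp only; omega, .inr (k2 _ (by simp only; omega) (by simp only; omega)),
        .inl (by omega), by simp only; omega⟩
    all_goals
      exact ⟨by simp only; omega, .inl (key _ (by simp only; omega) (by simp only; omega)),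
        .inl (by omega), by simp only; omega⟩
  · obtain ⟨k1, k2⟩ := key' (hp h6)
    rcases ha with ha | ha | ha <;> subst ha
    · exact ⟨by simp only; omega, .inr (k2 _ (by simp only; omega) (by simp only; omega)),
        .inl (by omega), by simp only; omega⟩
    all_goals
      exact ⟨by simp only; omega, .inl (key _ (by simp only; omega) (by simp only; omega)),
        .inl (by omega), by simp only; omega⟩
  · obtain ⟨k1, k2⟩ := key' (hp h6)
    subst ha
    exact ⟨by simp only; omega, .inr (k2 _ (by simp only; omega) (by simp only; omega)),
      .inl (by omega), by simp only; omega⟩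

theorem length_arcs_le (u : ℕ) : (φ.arcs u).length ≤ 5 := by
  rw [arcs]
  split_ifs <;> simp

theorem exists_mem_arcs {u v : ℕ} (h : φ.weight u v ≠ 0) : ∃ a ∈ φ.arcs u, a.1 = v := by
  by_contra! h'
  refine h (List.sum_eq_zero fun x hx => ?_)
  obtain ⟨a, ha, rfl⟩ := List.mem_map.1 hx
  exact if_neg (h' a ha).symm

theorem layer_lt {u : ℕ} (hu : u < φ.size) : φ.layer u < φ.layers :=
  Nat.div_lt_of_lt_mul (by rwa [size, mul_comm] at hu)

theorem base_add_width_le {u : ℕ} (hu : u < φ.size) : φ.base u + φ.width ≤ φ.size := by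
  calc φ.base u + φ.width = (φ.layer u + 1) * φ.width := by rw [base]; ring
    _ ≤ φ.size := Nat.mul_le_mul_right _ (φ.layer_lt hu)

theorem lt_size_of_mem_arcs {u : ℕ} (hu : u < φ.size) {a : ℕ × ℤ} (ha : a ∈ φ.arcs u) :
    a.1 < φ.size :=
  (φ.of_mem_arcs ha).2.2.2.trans_le (φ.base_add_width_le hu)

/-- A vertex has at most five arcs. The arcs to a vertex start in the columns below `9` of its layer
and the next one, except for a line's arc from the same column of the next layer. -/
theorem maxDegree_le : φ.game.maxDegree ≤ 24 := by
  classical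
  unfold ASHG.maxDegree
  refine SimpleGraph.maxDegree_le_of_forall_degree_le _ _ fun u => ?_
  rw [← SimpleGraph.card_neighborFinset_eq_degree]
  let S : Finset ℕ := ((φ.arcs u).map Prod.fst).toFinset ∪ ({(u : ℕ) + φ.width} ∪
    ((Finset.range 9).image (fun j => φ.base u + j) ∪
      (Finset.range 9).image (fun j => φ.base u + φ.width + j)))
  have hS : S.card ≤ 24 := by
    have h1 : ((φ.arcs u).map Prod.fst).toFinset.card ≤ 5 :=
      (List.toFinset_card_le _).trans (by simpa using φ.length_arcs_le u)
    have h2 : ((Finset.range 9).image (fun j => φ.base u + j)).card ≤ 9 :=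
      Finset.card_image_le.trans (by simp)
    have h3 : ((Finset.range 9).image (fun j => φ.base u + φ.width + j)).card ≤ 9 :=
      Finset.card_image_le.trans (by simp)
    have h4 := Finset.card_union_le ((φ.arcs u).map Prod.fst).toFinset ({(u : ℕ) + φ.width} ∪
      ((Finset.range 9).image (fun j => φ.base u + j) ∪
      (Finset.range 9).image (fun j => φ.base u + φ.width + j)))
    have h5 := Finset.card_union_le ({(u : ℕ) + φ.width} : Finset ℕ)
      ((Finset.range 9).image (fun j => φ.base u + j) ∪
      (Finset.range 9).image (fun j => φ.base u + φ.width + j))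
    have h6 := Finset.card_union_le ((Finset.range 9).image (fun j => φ.base u + j))
      ((Finset.range 9).image (fun j => φ.base u + φ.width + j))
    rw [Finset.card_singleton] at h5
    change (_ ∪ _ : Finset ℕ).card ≤ 24
    omega
  refine le_trans ?_ hS
  refine Finset.card_le_card_of_injOn Fin.val (fun v hv => ?_) Fin.val_injective.injOn
  rw [Finset.mem_coe, SimpleGraph.mem_neighborFinset] at hv
  obtain ⟨-, hv | hv⟩ := hv
  · obtain ⟨a, ha, hav⟩ := φ.exists_mem_arcs hv
    exact Finset.mem_union_left _ (List.mem_toFinset.2 (List.mem_map.2 ⟨a, ha, hav⟩))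
  · obtain ⟨a, ha, hav⟩ := φ.exists_mem_arcs hv
    obtain ⟨-, h1, h2, -⟩ := φ.of_mem_arcs ha
    have hb := φ.base_add_col v
    rw [hav] at h1 h2
    refine Finset.mem_union_right _ ?_
    rcases h2 with h2 | h2
    · refine Finset.mem_union_right _ ?_
      rcases h1 with h1 | h1
      · refine Finset.mem_union_left _ (Finset.mem_image.2 ⟨φ.col v, Finset.mem_range.2 h2, ?_⟩)
        rw [base, h1]; exact hb
      · refine Finset.mem_union_right _ (Finset.mem_image.2 ⟨φ.col v, Finset.mem_range.2 h2, ?_⟩)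
        have : φ.base v = φ.base u + φ.width := by simp only [base, ← h1]; ring
        omega
    · exact Finset.mem_union_left _ (Finset.mem_singleton.2 h2.symm)

/-- The path decomposition whose bags are the pairs of consecutive layers. -/
def pathDecomposition : PathDecomposition φ.game.underlying where
  length := φ.layers + 1
  bag i := Finset.univ.filter fun v => φ.layer v = i ∨ φ.layer v + 1 = i
  vertex_mem v := by
    refine ⟨⟨φ.layer v, ?_⟩, by simp⟩
    have := φ.layer_lt v.2
    exact this.trans (Nat.lt_succ_self _)
  edge_mem := by
    have key : ∀ u v : Fin φ.size, φ.weight u v ≠ 0 → ∃ i : Fin (φ.layers + 1),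
        (φ.layer u = i ∨ φ.layer u + 1 = i) ∧ (φ.layer v = i ∨ φ.layer v + 1 = i) := by
      intro u v h
      obtain ⟨a, ha, hav⟩ := φ.exists_mem_arcs h
      obtain ⟨-, h1, -⟩ := φ.of_mem_arcs ha
      rw [hav] at h1
      have := φ.layer_lt u.2
      exact ⟨⟨φ.layer u, this.trans (Nat.lt_succ_self _)⟩, .inl rfl, h1⟩
    rintro u v ⟨-, h | h⟩
    · obtain ⟨i, hi⟩ := key u v h
      exact ⟨i, by simpa using hi⟩
    · obtain ⟨i, hi⟩ := key v u h
      exact ⟨i, by simpa using hi.symm⟩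
  consecutive v i j k hij hjk hi hk := by
    simp only [Finset.mem_filter, Finset.mem_univ, true_and] at hi hk ⊢
    have : (i : ℕ) ≤ j := hij
    have : (j : ℕ) ≤ k := hjk
    omega

theorem card_bag_le (i : Fin (φ.layers + 1)) :
    (φ.pathDecomposition.bag i).card ≤ 2 * φ.width := by
  have h1 : (φ.pathDecomposition.bag i).card
      ≤ (Finset.Ico (φ.width * i - φ.width) (φ.width * i + φ.width)).card := by
    refine Finset.card_le_card_of_injOn Fin.val (fun v hv => ?_) Fin.val_injective.injOn
    simp only [pathDecomposition, Finset.coe_filter, Finset.mem_univ, true_and,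
      Set.mem_ofPred_eq] at hv
    have hb := φ.base_add_col v
    have hc := φ.col_lt v
    rw [Finset.coe_Ico, Set.mem_Ico]
    rcases hv with hv | hv
    · rw [base, hv] at hb
      omega
    · rw [base] at hb
      rw [← hv, mul_add]
      omega
  rw [Nat.card_Ico] at h1
  omega

theorem pathwidth_le : pathwidth φ.game.underlying ≤ 2 * φ.width :=
  Nat.sInf_le ⟨φ.pathDecomposition, fun i => (φ.card_bag_le i).trans (Nat.le_succ _)⟩

theorem param_le : φ.toASHG.param ≤ 48 * φ.width :=
  calc φ.toASHG.param ≤ 2 * φ.width * 24 := Nat.mul_le_mul φ.pathwidth_le φ.maxDegree_le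
    _ = 48 * φ.width := by ring

end ThreeCNF

namespace ASHG

theorem utility_eq_sum {V : Type*} [DecidableEq V] (G : ASHG V) (h : ∀ v, G.weight v v = 0) (v : V) (S : Finset V) :
    G.utility v S = ∑ u ∈ S, G.weight v u := by
  rw [utility]
  exact Finset.sum_erase _ (h v)

variable {V : Type*} [Fintype V] [DecidableEq V] (G : ASHG V)

/-- A Nash stable partition gives a Nash stable colouring. -/
theorem HasNashStablePartition.exists_coloring {G : ASHG V} (h : G.HasNashStablePartition)
    (hG : ∀ v, G.weight v v = 0) : ∃ c : V → Finset V, ∀ v,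
      0 ≤ (∑ u with c u = c v, G.weight v u) ∧
      ∀ s, (∑ u with c u = s, G.weight v u) ≤ ∑ u with c u = c v, G.weight v u := by
  obtain ⟨π, hπ⟩ := h
  have h1 : ∀ S ∈ π.parts, (Finset.univ.filter fun u => π.part u = S) = S := by
    intro S hS
    ext u
    simp only [Finset.mem_filter, Finset.mem_univ, true_and]
    exact ⟨fun h => h ▸ π.mem_part (Finset.mem_univ u), fun h => π.part_eq_of_mem hS h⟩
  refine ⟨π.part, fun v => ?_⟩
  obtain ⟨h2, h3⟩ := hπ v (π.part v) (π.part_mem.2 (Finset.mem_univ v))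
    (π.mem_part (Finset.mem_univ v))
  rw [h1 _ (π.part_mem.2 (Finset.mem_univ v)), ← G.utility_eq_sum hG]
  refine ⟨h2, fun s => ?_⟩
  by_cases hs : s ∈ π.parts
  · rw [h1 s hs, ← G.utility_eq_sum hG]
    exact h3 s hs
  · rw [Finset.sum_eq_zero fun u hu => ?_]
    · exact h2
    · exact absurd ((Finset.mem_filter.1 hu).2 ▸ π.part_mem.2 (Finset.mem_univ u)) hs

/-- A Nash stable colouring gives a Nash stable partition. -/
theorem hasNashStablePartition_of_coloring (hG : ∀ v, G.weight v v = 0) (c : V → ℕ)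
    (h : ∀ v, 0 ≤ (∑ u with c u = c v, G.weight v u) ∧
      ∀ s, (∑ u with c u = s, G.weight v u) ≤ ∑ u with c u = c v, G.weight v u) :
    G.HasNashStablePartition := by
  classical
  let π := Finpartition.ofSetoid (Setoid.ker c)
  have h1 : ∀ S ∈ π.parts, ∀ v ∈ S, S = Finset.univ.filter fun u => c u = c v := by
    intro S hS v hv
    rw [← π.part_eq_of_mem hS hv]
    ext u
    rw [Finpartition.mem_part_ofSetoid_iff_rel, Setoid.ker_def]
    simp [eq_comm]
  refine ⟨π, fun v S hS hv => ?_⟩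
  rw [G.utility_eq_sum hG, h1 S hS v hv]
  refine ⟨(h v).1, fun T hT => ?_⟩
  obtain ⟨u, hu⟩ := π.nonempty_of_mem_parts hT
  rw [G.utility_eq_sum hG, h1 T hT u hu]
  exact (h v).2 _

end ASHG

namespace ThreeCNF

variable (φ : ThreeCNF)

/-- The utility of the vertex `u` in the colour class `s`. -/
def gain {κ : Type} [DecidableEq κ] (c : ℕ → κ) (u : ℕ) (s : κ) : ℤ :=
  ((φ.arcs u).map fun a => if c a.1 = s then a.2 else 0).sum

/-- The vertex `u` does not gain by moving to another or to a new colour class. -/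
def StableAt {κ : Type} [DecidableEq κ] (c : ℕ → κ) (u : ℕ) : Prop :=
  0 ≤ φ.gain c u (c u) ∧ ∀ s, φ.gain c u s ≤ φ.gain c u (c u)

/-- A colouring in which no vertex gains by moving to another or to a new colour class. -/
def Stable {κ : Type} [DecidableEq κ] (c : ℕ → κ) : Prop := ∀ u < φ.size, φ.StableAt c u

theorem weight_self (u : ℕ) : φ.weight u u = 0 := by
  by_contra h
  obtain ⟨a, ha, hau⟩ := φ.exists_mem_arcs h
  exact (φ.of_mem_arcs ha).1 hau

theorem sum_weight_eq_gain {κ : Type} [DecidableEq κ] (c : ℕ → κ) {u : ℕ}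
    (hu : u < φ.size) (s : κ) :
    ∑ v ∈ Finset.univ.filter fun v : Fin φ.size => c v = s, φ.weight u v = φ.gain c u s := by
  have h1 : ∀ l : List (ℕ × ℤ), (∀ a ∈ l, a.1 < φ.size) →
      ∑ v ∈ Finset.univ.filter fun v : Fin φ.size => c v = s, (l.map fun a => if (v : ℕ) = a.1 then a.2 else 0).sum
        = (l.map fun a => if c a.1 = s then a.2 else 0).sum := by
    intro l hl
    induction l with
    | nil => simp
    | cons a l ih =>
      simp only [List.map_cons, List.sum_cons, Finset.sum_add_distrib]
      rw [ih fun b hb => hl b (List.mem_cons_of_mem _ hb)]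
      congr 1
      have h2 : ∀ v : Fin φ.size, ((v : ℕ) = a.1 ↔ v = ⟨a.1, hl a List.mem_cons_self⟩) :=
        fun v => by rw [Fin.ext_iff]
      simp only [h2]
      rw [Finset.sum_ite_eq']
      simp
  exact h1 _ fun a ha => φ.lt_size_of_mem_arcs hu ha

theorem exists_stable_of_hasNashStablePartition (h : φ.game.HasNashStablePartition) :
    ∃ c : ℕ → Finset (Fin φ.size), φ.Stable c := by
  obtain ⟨c, hc⟩ := h.exists_coloring fun v => φ.weight_self v
  refine ⟨fun u => if h : u < φ.size then c ⟨u, h⟩ else ∅, fun u hu => ?_⟩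
  simp only [StableAt, ← φ.sum_weight_eq_gain _ hu]
  simpa [hu, game] using hc ⟨u, hu⟩

theorem hasNashStablePartition_of_stable {c : ℕ → ℕ} (h : φ.Stable c) :
    φ.game.HasNashStablePartition := by
  refine φ.game.hasNashStablePartition_of_coloring (fun v => φ.weight_self v) (fun u => c u)
    fun v => ?_
  have := h v v.2
  simp only [StableAt, ← φ.sum_weight_eq_gain c v.2] at this
  exact this

end ThreeCNF

namespace ThreeCNF

variable (φ : ThreeCNF)

/-! ### Utilities of the vertices, column by column -/

theorem layer_mul_add {L j : ℕ} (hj : j < φ.width) : φ.layer (φ.width * L + j) = L := by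
  rw [layer, Nat.mul_add_div φ.width_pos, Nat.div_eq_of_lt hj, add_zero]

theorem col_mul_add {L j : ℕ} (hj : j < φ.width) : φ.col (φ.width * L + j) = j := by
  rw [col, Nat.mul_add_mod, Nat.mod_eq_of_lt hj]

theorem base_mul_add {L j : ℕ} (hj : j < φ.width) : φ.base (φ.width * L + j) = φ.width * L := by
  rw [base, φ.layer_mul_add hj]

theorem phase_mul_add {m q j : ℕ} (hq : q ≤ φ.labels) (hj : j < φ.width) :
    φ.phase (φ.width * (m * (φ.labels + 1) + q) + j) = q := by
  rw [phase, φ.layer_mul_add hj, mul_comm, Nat.mul_add_mod, Nat.mod_eq_of_lt (by omega)]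

theorem litIndex_mul_add {m q j : ℕ} (hq : q ≤ φ.labels) (hj : j < φ.width) (r : ℕ) :
    φ.litIndex (φ.width * (m * (φ.labels + 1) + q) + j) r = 3 * m + r := by
  rw [litIndex, φ.layer_mul_add hj, mul_comm m, Nat.mul_add_div (by omega),
    Nat.div_eq_of_lt (by omega), add_zero]

theorem mul_add_lt_size {L j : ℕ} (hL : L < φ.layers) (hj : j < φ.width) :
    φ.width * L + j < φ.size := by
  have : φ.width * (L + 1) ≤ φ.width * φ.layers := Nat.mul_le_mul_left _ hL
  rw [size, mul_comm φ.layers]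
  rw [Nat.mul_succ] at this
  omega

theorem clause_mul_add_lt_layers {m q : ℕ} (hm : m < φ.clauses.length) (hq : q ≤ φ.labels) :
    m * (φ.labels + 1) + q < φ.layers := by
  have : (m + 1) * (φ.labels + 1) ≤ φ.layers := Nat.mul_le_mul_right _ hm
  rw [Nat.succ_mul] at this
  omega

section

variable {κ : Type} [DecidableEq κ] (c : ℕ → κ) {u : ℕ} (s : κ)

theorem gain_line_zero (h : φ.col u = 0 ∨ 9 ≤ φ.col u) (hl : φ.layer u = 0) :
    φ.gain c u s = 0 := by
  simp [gain, arcs, h, hl]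

theorem gain_line (h : φ.col u = 0 ∨ 9 ≤ φ.col u) (hl : φ.layer u ≠ 0) :
    φ.gain c u s = if c (u - φ.width) = s then 1 else 0 := by
  simp [gain, arcs, h, hl]

theorem gain_chaser_of_phase_ne (h : φ.col u = 1) (hq : φ.phase u ≠ φ.labels) :
    φ.gain c u s = 0 := by
  simp [gain, arcs, h, hq]

theorem gain_chaser (h : φ.col u = 1) (hq : φ.phase u = φ.labels) :
    φ.gain c u s = (if c (φ.base u) = s then 3 else 0) + (if c (φ.base u + 2) = s then 4 else 0) +
      ∑ r ∈ Finset.range 3, ((φ.litNeg (φ.litIndex u r) : ℤ) *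
        (if c (φ.base u) = s then 1 else 0) +
        (1 - 2 * (φ.litNeg (φ.litIndex u r) : ℤ)) * if c (φ.base u + (3 + r)) = s then 1 else 0) := by
  rw [gain, arcs, if_neg (by omega), if_pos h, if_pos hq]
  simp only [List.map_cons, List.map_nil, List.sum_cons, List.sum_nil, Finset.sum_range_succ,
    Finset.sum_range_zero, Nat.reduceAdd, add_zero]
  split_ifs <;> ring

theorem gain_runner_of_phase_ne (h : φ.col u = 2) (hq : φ.phase u ≠ φ.labels) :
    φ.gain c u s = 0 := by
  simp [gain, arcs, h, hq]

theorem gain_runner (h : φ.col u = 2) (hq : φ.phase u = φ.labels) :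
    φ.gain c u s = if c (φ.base u + 1) = s then -1 else 0 := by
  simp [gain, arcs, h, hq]

theorem gain_walker_zero (h : 3 ≤ φ.col u) (h' : φ.col u < 6) (hq : φ.phase u = 0) :
    φ.gain c u s = (if c (φ.base u) = s then -1 else 0) +
      if c (φ.base u + (9 + φ.litGroup (φ.litIndex u (φ.col u - 3)))) = s then -1 else 0 := by
  have h0 : φ.col u ≠ 0 := by omega
  have h1 : φ.col u ≠ 1 := by omega
  have h2 : φ.col u ≠ 2 := by omega
  have h9 : ¬ 9 ≤ φ.col u := by omega
  simp [gain, arcs, h', hq, h0, h1, h2, h9, add_assoc]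

theorem gain_walker (h : 3 ≤ φ.col u) (h' : φ.col u < 6) (hq : φ.phase u ≠ 0) :
    φ.gain c u s = (if c (u - φ.width) = s then 2 else 0) + (if c (u + 3) = s then 2 else 0) +
      if c (φ.base u) = s then 3 else 0 := by
  have h0 : φ.col u ≠ 0 := by omega
  have h1 : φ.col u ≠ 1 := by omega
  have h2 : φ.col u ≠ 2 := by omega
  have h9 : ¬ 9 ≤ φ.col u := by omega
  simp [gain, arcs, h', hq, h0, h1, h2, h9, add_assoc]

theorem gain_comparer_zero (h : 6 ≤ φ.col u) (h' : φ.col u < 9) (hq : φ.phase u = 0) :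
    φ.gain c u s = 0 := by
  have h0 : φ.col u ≠ 0 := by omega
  have h1 : φ.col u ≠ 1 := by omega
  have h2 : φ.col u ≠ 2 := by omega
  have h9 : ¬ 9 ≤ φ.col u := by omega
  simp [gain, arcs, h.not_gt, hq, h0, h1, h2, h9]

theorem gain_comparer (h : 6 ≤ φ.col u) (h' : φ.col u < 9) (hq : φ.phase u ≠ 0) :
    φ.gain c u s = (if c (u - 3 - φ.width) = s then 3 else 0) +
      if φ.LitBit (φ.litIndex u (φ.col u - 6)) (φ.phase u - 1) then
        (if c (φ.base u + (9 + φ.litGroup (φ.litIndex u (φ.col u - 6)))) = s then 2 else 0) +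
        (if c (φ.base u + (9 + φ.groups + (φ.phase u - 1))) = s then 2 else 0) else 0 := by
  have h0 : φ.col u ≠ 0 := by omega
  have h1 : φ.col u ≠ 1 := by omega
  have h2 : φ.col u ≠ 2 := by omega
  have h9 : ¬ 9 ≤ φ.col u := by omega
  by_cases hB : φ.LitBit (φ.litIndex u (φ.col u - 6)) (φ.phase u - 1) <;>
    simp [gain, arcs, h.not_gt, hq, h0, h1, h2, h9, hB, add_assoc]

end

/-! ### A stable colouring yields a satisfying assignment -/

namespace Stable

variable {φ} {κ : Type} [DecidableEq κ] {c : ℕ → κ}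

/-- The vertices of a line all have the same colour. -/
theorem color_line (h : φ.Stable c) {j : ℕ} (hj : j = 0 ∨ 9 ≤ j) (hjw : j < φ.width) :
    ∀ {L : ℕ}, L < φ.layers → c (φ.width * L + j) = c j := by
  intro L
  induction L with
  | zero => simp
  | succ L ih =>
    intro hL
    rw [← ih (by omega)]
    have h1 := (h _ (φ.mul_add_lt_size hL hjw)).2 (c (φ.width * L + j))
    have h2 : φ.width * (L + 1) + j - φ.width = φ.width * L + j := by
      rw [Nat.mul_succ]; omega
    rw [φ.gain_line c _ (by rwa [φ.col_mul_add hjw]) (by rw [φ.layer_mul_add hjw]; omega),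
      φ.gain_line c _ (by rwa [φ.col_mul_add hjw]) (by rw [φ.layer_mul_add hjw]; omega), h2] at h1
    by_contra h3
    rw [if_pos rfl, if_neg (Ne.symm h3)] at h1
    omega

theorem color_base (h : φ.Stable c) {L : ℕ} (hL : L < φ.layers) : c (φ.width * L) = c 0 :=
  h.color_line (Or.inl rfl) φ.width_pos hL

/-- One step of a walker: it moves to the truth line if the label of the layer makes the literal's
variable true and is assigned to its group, and keeps its colour otherwise. The comparer gains `3` at
the walker, and `4` at the common colour of group and label in the first case; in the second case it
gains at most `2` away from the walker. If the walker had the colour of the group, then the comparer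
would stay with it, whence the last condition. -/
theorem color_walker_succ (h : φ.Stable c) {m r q : ℕ} (hm : m < φ.clauses.length) (hr : r < 3)
    (hq : q < φ.labels) :
    c (φ.width * (m * (φ.labels + 1) + (q + 1)) + (3 + r)) =
      if φ.LitBit (3 * m + r) q ∧ c (9 + φ.litGroup (3 * m + r)) = c (9 + φ.groups + q) ∧
        c (φ.width * (m * (φ.labels + 1) + q) + (3 + r)) ≠ c (9 + φ.litGroup (3 * m + r))
      then c 0 else c (φ.width * (m * (φ.labels + 1) + q) + (3 + r)) := by
  have hw : φ.width = 9 + φ.groups + φ.labels := rfl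
  have hg := φ.litGroup_lt (3 * m + r)
  have hL := φ.clause_mul_add_lt_layers hm hq
  have hjr : 3 + r < φ.width := by omega
  have hjr' : 6 + r < φ.width := by omega
  set L := m * (φ.labels + 1) + (q + 1) with hLdef
  have hL' : φ.width * L = φ.width * (m * (φ.labels + 1) + q) + φ.width := by
    rw [hLdef, ← add_assoc, Nat.mul_succ]
  have hcz := h.color_base hL
  have hcg := h.color_line (j := 9 + φ.litGroup (3 * m + r)) (by omega) (by omega) hL
  have hcl := h.color_line (j := 9 + φ.groups + q) (by omega) (by omega) hL
  have hh := h _ (φ.mul_add_lt_size hL hjr')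
  have ha := h _ (φ.mul_add_lt_size hL hjr)
  simp only [StableAt, fun s => φ.gain_comparer c (u := φ.width * L + (6 + r)) s
      (by rw [φ.col_mul_add hjr']; omega) (by rw [φ.col_mul_add hjr']; omega)
      (by rw [hLdef, φ.phase_mul_add hq hjr']; omega),
    show φ.width * L + (6 + r) - 3 - φ.width = φ.width * (m * (φ.labels + 1) + q) + (3 + r) by
      omega, φ.base_mul_add hjr', φ.col_mul_add hjr', Nat.add_sub_cancel_left] at hh
  rw [hLdef, φ.phase_mul_add hq hjr', φ.litIndex_mul_add hq hjr', ← hLdef,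
    Nat.succ_sub_one, hcg, hcl] at hh
  simp only [StableAt, fun s => φ.gain_walker c (u := φ.width * L + (3 + r)) s
      (by rw [φ.col_mul_add hjr]; omega) (by rw [φ.col_mul_add hjr]; omega)
      (by rw [hLdef, φ.phase_mul_add hq hjr]; omega),
    show φ.width * L + (3 + r) - φ.width = φ.width * (m * (φ.labels + 1) + q) + (3 + r) by
      omega, show φ.width * L + (3 + r) + 3 = φ.width * L + (6 + r) by omega,
    φ.base_mul_add hjr, hcz] at ha
  generalize c (φ.width * L + (6 + r)) = x at *
  generalize c (φ.width * L + (3 + r)) = y at *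
  generalize c (φ.width * (m * (φ.labels + 1) + q) + (3 + r)) = y₀ at *
  generalize c (9 + φ.litGroup (3 * m + r)) = ξ at *
  generalize c (9 + φ.groups + q) = π at *
  generalize c 0 = z at *
  have h1 := hh.2 y₀
  have h2 := hh.2 ξ
  have h3 := ha.2 y₀
  have h4 := ha.2 z
  clear hh ha hcz hcg hcl
  grind

/-- A walker starts off the truth line and off the line of its group: it has no other arcs there, and
both have negative weight. -/
theorem color_walker_zero (h : φ.Stable c) {m r : ℕ} (hm : m < φ.clauses.length) (hr : r < 3) :
    c (φ.width * (m * (φ.labels + 1) + 0) + (3 + r)) ≠ c 0 ∧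
    c (φ.width * (m * (φ.labels + 1) + 0) + (3 + r)) ≠ c (9 + φ.litGroup (3 * m + r)) := by
  have hw : φ.width = 9 + φ.groups + φ.labels := rfl
  have hg := φ.litGroup_lt (3 * m + r)
  have hL := φ.clause_mul_add_lt_layers hm φ.labels.zero_le
  have hjr : 3 + r < φ.width := by omega
  have h1 := (h _ (φ.mul_add_lt_size hL hjr)).1
  rw [φ.gain_walker_zero c _ (by rw [φ.col_mul_add hjr]; omega) (by rw [φ.col_mul_add hjr]; omega)
    (φ.phase_mul_add φ.labels.zero_le hjr), φ.base_mul_add hjr, φ.col_mul_add hjr,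
    Nat.add_sub_cancel_left, φ.litIndex_mul_add φ.labels.zero_le hjr, h.color_base hL,
    h.color_line (Or.inr (Nat.le_add_right _ _)) (by omega) hL] at h1
  grind

/-- A walker is on the truth line after `q` steps if and only if one of these steps has found a
label that makes its literal's variable true and is assigned to the group of the variable. -/
theorem color_walker (h : φ.Stable c) {m r : ℕ} (hm : m < φ.clauses.length) (hr : r < 3) {q : ℕ}
    (hq : q ≤ φ.labels) :
    (c (φ.width * (m * (φ.labels + 1) + q) + (3 + r)) = c 0 ∨
      c (φ.width * (m * (φ.labels + 1) + q) + (3 + r)) ≠ c (9 + φ.litGroup (3 * m + r))) ∧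
    (c (φ.width * (m * (φ.labels + 1) + q) + (3 + r)) = c 0 ↔ ∃ k < q, φ.LitBit (3 * m + r) k ∧
      c (9 + φ.litGroup (3 * m + r)) = c (9 + φ.groups + k)) := by
  induction q with
  | zero =>
    have h1 := h.color_walker_zero hm hr
    simpa using And.intro (Or.inr h1.2) h1.1
  | succ q ih =>
    have ih := ih (Nat.le_of_succ_le hq)
    have h1 := h.color_walker_succ hm hr hq
    have h2 : (∃ k < q + 1, φ.LitBit (3 * m + r) k ∧
        c (9 + φ.litGroup (3 * m + r)) = c (9 + φ.groups + k)) ↔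
        (∃ k < q, φ.LitBit (3 * m + r) k ∧
          c (9 + φ.litGroup (3 * m + r)) = c (9 + φ.groups + k)) ∨
        φ.LitBit (3 * m + r) q ∧ c (9 + φ.litGroup (3 * m + r)) = c (9 + φ.groups + q) := by
      simp only [Nat.lt_succ_iff_lt_or_eq, or_and_right, exists_or, exists_eq_left]
    rw [h2]
    rw [← ih.2]
    clear h2
    grind

/-- In the last layer of a clause some walker is on the truth line if its literal is positive, or
off the truth line if its literal is negative: otherwise the chaser would gain `4` at the runner,
`3` on the truth line, and at most `3` elsewhere, whereas the runner avoids the chaser. -/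
theorem exists_walker (h : φ.Stable c) {m : ℕ} (hm : m < φ.clauses.length) :
    ∃ r < 3, (φ.litNeg (3 * m + r) = 0 ↔
      c (φ.width * (m * (φ.labels + 1) + φ.labels) + (3 + r)) = c 0) := by
  by_contra! hcon
  have hw : φ.width = 9 + φ.groups + φ.labels := rfl
  have hL := φ.clause_mul_add_lt_layers hm le_rfl
  have h1 : 1 < φ.width := by omega
  have h2 : 2 < φ.width := by omega
  set L := m * (φ.labels + 1) + φ.labels with hLdef
  have hrun := (h _ (φ.mul_add_lt_size hL h2)).1
  rw [φ.gain_runner c _ (φ.col_mul_add h2) (by rw [hLdef, φ.phase_mul_add le_rfl h2]),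
    φ.base_mul_add h2] at hrun
  have hch := (h _ (φ.mul_add_lt_size hL h1)).2 (c (φ.width * L + 2))
  set x := c (φ.width * L + 1)
  set y := c (φ.width * L + 2)
  have hxy : x ≠ y := by
    intro hxy
    rw [if_pos hxy] at hrun
    omega
  have hgain : ∀ s, φ.gain c (φ.width * L + 1) s =
      (if c 0 = s then 3 else 0) + (if y = s then 4 else 0) +
      ∑ r ∈ Finset.range 3, ((φ.litNeg (3 * m + r) : ℤ) * (if c 0 = s then 1 else 0) +
        (1 - 2 * (φ.litNeg (3 * m + r) : ℤ)) *
          if c (φ.width * L + (3 + r)) = s then 1 else 0) := by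
    intro s
    rw [φ.gain_chaser c _ (φ.col_mul_add h1) (by rw [hLdef, φ.phase_mul_add le_rfl h1]),
      φ.base_mul_add h1, h.color_base hL]
    simp only [hLdef, φ.litIndex_mul_add le_rfl h1]
    rfl
  -- The share of an unsatisfied literal is `0` on the truth line and at most `1` elsewhere.
  have hterm : ∀ s, ∀ r ∈ Finset.range 3,
      0 ≤ ((φ.litNeg (3 * m + r) : ℤ) * (if c 0 = s then 1 else 0) +
        (1 - 2 * (φ.litNeg (3 * m + r) : ℤ)) *
          if c (φ.width * L + (3 + r)) = s then 1 else 0) ∧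
      ((φ.litNeg (3 * m + r) : ℤ) * (if c 0 = s then 1 else 0) +
        (1 - 2 * (φ.litNeg (3 * m + r) : ℤ)) *
          if c (φ.width * L + (3 + r)) = s then 1 else 0) ≤ if c 0 = s then 0 else 1 := by
    intro s r hr
    have h3 := hcon r (Finset.mem_range.1 hr)
    have h4 := φ.litNeg_le_one (3 * m + r)
    generalize φ.litNeg (3 * m + r) = n at *
    generalize c (φ.width * L + (3 + r)) = w at *
    interval_cases n <;> grind
  rw [hgain, hgain, if_pos rfl, if_neg hxy.symm] at hch
  have h5 := Finset.sum_nonneg fun r hr => (hterm y r hr).1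
  have h6 := Finset.sum_le_sum fun r hr => (hterm x r hr).2
  rw [Finset.sum_const, Finset.card_range] at h6
  split_ifs at hch h6 <;> simp_all <;> omega

/-- A stable colouring yields a satisfying assignment: a variable is true if it is made true by
some label whose colour is that of its group. -/
theorem satisfiable (h : φ.Stable c) : φ.Satisfiable := by
  refine ⟨fun v => decide (∃ k < φ.labels, (k / 2 ^ ((v : ℕ) % φ.bits) % 2 = 1) ∧
    c (9 + v / φ.bits) = c (9 + φ.groups + k)), fun d hd => ?_⟩
  obtain ⟨m, hm, rfl⟩ := List.getElem_of_mem hd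
  obtain ⟨r, hr, h1⟩ := h.exists_walker hm
  rw [(h.color_walker hm hr le_rfl).2] at h1
  have h2 := φ.getElem?_literals m ⟨r, hr⟩
  rw [List.getElem?_eq_getElem hm, Option.map_some] at h2
  refine ⟨⟨r, hr⟩, ?_⟩
  simp only [litNeg, LitBit, litGroup, litVar, h2, Option.map_some, Option.getD_some] at h1
  rcases hb : (φ.clauses[m] ⟨r, hr⟩).2 <;> simpa [hb] using h1

end Stable

end ThreeCNF

/-! ### A satisfying assignment yields a stable colouring -/

namespace ThreeCNF

variable (φ : ThreeCNF) (val : ℕ → Bool)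

/-- The label that stands for the restriction of the assignment `val` to the `i`-th group. -/
def key (i : ℕ) : ℕ := Nat.ofBits fun j : Fin φ.bits => val (i * φ.bits + j)

theorem key_lt (i : ℕ) : φ.key val i < φ.labels := Nat.ofBits_lt_two_pow _

theorem litBit_key (ℓ : ℕ) : φ.LitBit ℓ (φ.key val (φ.litGroup ℓ)) ↔ val (φ.litVar ℓ) = true := by
  have h1 := Nat.testBit_ofBits_lt (fun j : Fin φ.bits => val (φ.litGroup ℓ * φ.bits + j))
    (φ.litVar ℓ % φ.bits) (Nat.mod_lt _ φ.bits_pos)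
  rw [Nat.testBit_eq_decide_div_mod_eq] at h1
  simp only [litGroup, Nat.div_add_mod'] at h1
  rw [LitBit, ← h1]
  exact decide_eq_true_iff.symm

/-- The colour of the vertex in column `j` of the `q`-th layer of the `m`-th clause: `0` is the
colour of the truth line, the label `k` has colour `1 + k` and so have the groups to which it is
assigned, walkers start with colour `φ.labels + 1`, and the runner has colour `φ.labels + 2`. -/
def planColor (m q j : ℕ) : ℕ :=
  if j < 2 then 0
  else if j = 2 then φ.labels + 2
  else if j < 6 then
    if φ.key val (φ.litGroup (3 * m + (j - 3))) < q ∧ val (φ.litVar (3 * m + (j - 3))) = true then 0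
    else φ.labels + 1
  else if j < 9 then
    if φ.key val (φ.litGroup (3 * m + (j - 6))) + 1 = q ∧ val (φ.litVar (3 * m + (j - 6))) = true
    then q
    else if φ.key val (φ.litGroup (3 * m + (j - 6))) + 1 < q ∧
      val (φ.litVar (3 * m + (j - 6))) = true then 0
    else φ.labels + 1
  else if j < 9 + φ.groups then 1 + φ.key val (j - 9)
  else 1 + (j - 9 - φ.groups)

/-- The colouring that belongs to the assignment `val`. -/
def plan (u : ℕ) : ℕ := φ.planColor val (φ.layer u / (φ.labels + 1)) (φ.phase u) (φ.col u)

theorem plan_mul_add {m q j : ℕ} (hq : q ≤ φ.labels) (hj : j < φ.width) :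
    φ.plan val (φ.width * (m * (φ.labels + 1) + q) + j) = φ.planColor val m q j := by
  rw [plan, φ.phase_mul_add hq hj, φ.col_mul_add hj, φ.layer_mul_add hj, mul_comm m,
    Nat.mul_add_div (by omega), Nat.div_eq_of_lt (by omega), add_zero]

theorem planColor_line {j : ℕ} (hj : j = 0 ∨ 9 ≤ j) (m q m' q' : ℕ) :
    φ.planColor val m q j = φ.planColor val m' q' j := by
  unfold planColor
  split_ifs <;> first | rfl | omega

theorem planColor_walker {r : ℕ} (hr : r < 3) (m q : ℕ) : φ.planColor val m q (3 + r) =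
    if φ.key val (φ.litGroup (3 * m + r)) < q ∧ val (φ.litVar (3 * m + r)) = true then 0
    else φ.labels + 1 := by
  rw [planColor, if_neg (by omega), if_neg (by omega), if_pos (by omega), Nat.add_sub_cancel_left]

theorem planColor_comparer {r : ℕ} (hr : r < 3) (m q : ℕ) : φ.planColor val m q (6 + r) =
    if φ.key val (φ.litGroup (3 * m + r)) + 1 = q ∧ val (φ.litVar (3 * m + r)) = true then q
    else if φ.key val (φ.litGroup (3 * m + r)) + 1 < q ∧ val (φ.litVar (3 * m + r)) = true then 0
    else φ.labels + 1 := by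
  rw [planColor, if_neg (by omega), if_neg (by omega), if_neg (by omega), if_pos (by omega),
    Nat.add_sub_cancel_left]

theorem planColor_group {i : ℕ} (hi : i < φ.groups) (m q : ℕ) :
    φ.planColor val m q (9 + i) = 1 + φ.key val i := by
  rw [planColor, if_neg (by omega), if_neg (by omega), if_neg (by omega), if_neg (by omega),
    if_pos (by omega), Nat.add_sub_cancel_left]

theorem planColor_label (k m q : ℕ) : φ.planColor val m q (9 + φ.groups + k) = 1 + k := by
  rw [planColor, if_neg (by omega), if_neg (by omega), if_neg (by omega), if_neg (by omega),
    if_neg (by omega)]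
  omega

theorem plan_mul_add_sub_width {m q j : ℕ} (hq : q ≤ φ.labels) (hj : j < φ.width) (hq0 : q ≠ 0) :
    φ.plan val (φ.width * (m * (φ.labels + 1) + q) + j - φ.width) =
      φ.planColor val m (q - 1) j := by
  obtain ⟨p, rfl⟩ := Nat.exists_eq_succ_of_ne_zero hq0
  rw [Nat.add_succ, Nat.mul_succ, Nat.succ_sub_one, Nat.add_right_comm, Nat.add_sub_cancel]
  exact φ.plan_mul_add val (by omega) hj

theorem stableAt_plan_line {u : ℕ} (h : φ.col u = 0 ∨ 9 ≤ φ.col u) :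
    φ.StableAt (φ.plan val) u := by
  by_cases h0 : φ.layer u = 0
  · simp [StableAt, φ.gain_line_zero _ _ h h0]
  · have h1 : φ.plan val (u - φ.width) = φ.plan val u := by
      have h2 : φ.col (u - φ.width) = φ.col u := by
        rw [col, col, Nat.mod_eq_sub_mod (a := u)]
        by_contra h3
        exact h0 (Nat.div_eq_of_lt (by omega))
      rw [plan, plan, h2]
      exact φ.planColor_line val h _ _ _ _
    simp only [StableAt, φ.gain_line _ _ h h0, h1]
    refine ⟨by simp, fun s => ?_⟩
    split_ifs <;> simp_all

theorem stableAt_plan_runner {m q : ℕ} (hq : q ≤ φ.labels) :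
    φ.StableAt (φ.plan val) (φ.width * (m * (φ.labels + 1) + q) + 2) := by
  have hj : 2 < φ.width := by rw [width]; omega
  have hphase := φ.phase_mul_add (m := m) hq hj
  by_cases hqt : q = φ.labels
  · simp only [StableAt, fun s => φ.gain_runner (φ.plan val) s (φ.col_mul_add hj)
      (hphase.trans hqt), φ.base_mul_add hj, φ.plan_mul_add val hq hj,
      φ.plan_mul_add val hq (show 1 < φ.width by omega)]
    simp only [planColor]
    refine ⟨by simp, fun s => ?_⟩
    split_ifs <;> simp_all
  · simp [StableAt, φ.gain_runner_of_phase_ne _ _ (φ.col_mul_add hj) (hphase.trans_ne hqt)]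

theorem stableAt_plan_walker {m q r : ℕ} (hq : q ≤ φ.labels) (hr : r < 3) :
    φ.StableAt (φ.plan val) (φ.width * (m * (φ.labels + 1) + q) + (3 + r)) := by
  have hw : φ.width = 9 + φ.groups + φ.labels := rfl
  have hg := φ.litGroup_lt (3 * m + r)
  have hk := φ.key_lt val (φ.litGroup (3 * m + r))
  have hj : 3 + r < φ.width := by omega
  have hcol := φ.col_mul_add (L := m * (φ.labels + 1) + q) hj
  have hphase := φ.phase_mul_add (m := m) hq hj
  have hbase := φ.base_mul_add (L := m * (φ.labels + 1) + q) hj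
  have hplan0 := φ.plan_mul_add val (m := m) hq φ.width_pos
  rw [add_zero] at hplan0
  by_cases hq0 : q = 0
  · simp only [StableAt, fun s => φ.gain_walker_zero (φ.plan val) s (hcol.symm ▸ by omega)
      (hcol.symm ▸ by omega) (hphase.trans hq0), hbase, hcol, Nat.add_sub_cancel_left,
      φ.litIndex_mul_add hq hj, hplan0, φ.plan_mul_add val hq hj,
      φ.plan_mul_add val hq (show 9 + φ.litGroup (3 * m + r) < φ.width by omega),
      φ.planColor_walker val hr, φ.planColor_group val hg]
    simp only [planColor, hq0]
    clear hcol hphase hbase hplan0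
    refine ⟨?_, fun s => ?_⟩ <;> grind
  · have hu : φ.width * (m * (φ.labels + 1) + q) + (3 + r) + 3 =
        φ.width * (m * (φ.labels + 1) + q) + (6 + r) := by omega
    simp only [StableAt, fun s => φ.gain_walker (φ.plan val) s (hcol.symm ▸ by omega)
      (hcol.symm ▸ by omega) (hphase.trans_ne hq0), hbase, hplan0, φ.plan_mul_add val hq hj,
      φ.plan_mul_add_sub_width val hq hj hq0, hu,
      φ.plan_mul_add val hq (show 6 + r < φ.width by omega),
      φ.planColor_walker val hr, φ.planColor_comparer val hr]
    simp only [planColor]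
    clear hcol hphase hbase hplan0 hu
    generalize φ.key val (φ.litGroup (3 * m + r)) = k at *
    generalize φ.labels = t at *
    refine ⟨?_, fun s => ?_⟩ <;> grind

theorem stableAt_plan_comparer {m q r : ℕ} (hq : q ≤ φ.labels) (hr : r < 3) :
    φ.StableAt (φ.plan val) (φ.width * (m * (φ.labels + 1) + q) + (6 + r)) := by
  have hw : φ.width = 9 + φ.groups + φ.labels := rfl
  have hg := φ.litGroup_lt (3 * m + r)
  have hk := φ.key_lt val (φ.litGroup (3 * m + r))
  have hbit := φ.litBit_key val (3 * m + r)
  have hj : 6 + r < φ.width := by omega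
  have hcol := φ.col_mul_add (L := m * (φ.labels + 1) + q) hj
  have hphase := φ.phase_mul_add (m := m) hq hj
  have hbase := φ.base_mul_add (L := m * (φ.labels + 1) + q) hj
  by_cases hq0 : q = 0
  · simp [StableAt, φ.gain_comparer_zero _ _ (hcol.symm ▸ by omega) (hcol.symm ▸ by omega)
      (hphase.trans hq0)]
  · have hu : φ.width * (m * (φ.labels + 1) + q) + (6 + r) - 3 - φ.width =
        φ.width * (m * (φ.labels + 1) + q) + (3 + r) - φ.width := by omega
    simp only [StableAt, fun s => φ.gain_comparer (φ.plan val) s (hcol.symm ▸ by omega)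
      (hcol.symm ▸ by omega) (hphase.trans_ne hq0), hbase, hcol, hphase,
      φ.litIndex_mul_add hq hj, Nat.add_sub_cancel_left, hu, φ.plan_mul_add val hq hj,
      φ.plan_mul_add_sub_width val hq (show 3 + r < φ.width by omega) hq0,
      φ.plan_mul_add val hq (show 9 + φ.litGroup (3 * m + r) < φ.width by omega),
      φ.plan_mul_add val hq (show 9 + φ.groups + (q - 1) < φ.width by omega),
      φ.planColor_walker val hr, φ.planColor_comparer val hr, φ.planColor_group val hg,
      φ.planColor_label val]
    clear hcol hphase hbase hu
    by_cases hkq : φ.key val (φ.litGroup (3 * m + r)) = q - 1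
    · rw [hkq] at hbit ⊢
      generalize φ.labels = t at *
      refine ⟨?_, fun s => ?_⟩ <;> grind
    · clear hbit
      generalize φ.key val (φ.litGroup (3 * m + r)) = k at *
      generalize φ.labels = t at *
      refine ⟨?_, fun s => ?_⟩ <;> grind

/-- The chaser is on the truth line, where it gains at least `4` because some literal is satisfied.
It would gain `4` at the runner and at most `3` at the walkers off the truth line. -/
theorem stableAt_plan_chaser {m q : ℕ} (hq : q ≤ φ.labels) (hval : ∃ r < 3,
    (φ.litNeg (3 * m + r) = 0 ↔ val (φ.litVar (3 * m + r)) = true)) :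
    φ.StableAt (φ.plan val) (φ.width * (m * (φ.labels + 1) + q) + 1) := by
  have hw : φ.width = 9 + φ.groups + φ.labels := rfl
  have hj : 1 < φ.width := by omega
  have hcol := φ.col_mul_add (L := m * (φ.labels + 1) + q) hj
  have hphase := φ.phase_mul_add (m := m) hq hj
  have hplan0 := φ.plan_mul_add val (m := m) hq φ.width_pos
  rw [add_zero] at hplan0
  by_cases hqt : q = φ.labels
  · obtain ⟨f, hf⟩ : ∃ f : ℕ → ℕ → ℤ, ∀ s r, f s r =
        (φ.litNeg (3 * m + r) : ℤ) * (if 0 = s then 1 else 0) +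
          (1 - 2 * (φ.litNeg (3 * m + r) : ℤ)) *
            if (if val (φ.litVar (3 * m + r)) = true then 0 else φ.labels + 1) = s
              then 1 else 0 := ⟨_, fun _ _ => rfl⟩
    have hgain : ∀ s, φ.gain (φ.plan val) (φ.width * (m * (φ.labels + 1) + q) + 1) s =
        (if 0 = s then 3 else 0) + (if φ.labels + 2 = s then 4 else 0) +
        ∑ r ∈ Finset.range 3, f s r := by
      intro s
      rw [φ.gain_chaser _ _ hcol (hphase.trans hqt), φ.base_mul_add hj, hplan0,
        φ.plan_mul_add val hq (show 2 < φ.width by omega)]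
      congr 1
      refine Finset.sum_congr rfl fun r hr => ?_
      have hr := Finset.mem_range.1 hr
      rw [hf, φ.litIndex_mul_add hq hj, φ.plan_mul_add val hq (show 3 + r < φ.width by omega),
        φ.planColor_walker val hr]
      simp only [hqt, φ.key_lt, true_and]
      rfl
    have hnonneg : ∀ r, 0 ≤ f 0 r := by
      intro r
      have h1 := φ.litNeg_le_one (3 * m + r)
      rw [hf]
      generalize φ.litNeg (3 * m + r) = n at *
      interval_cases n <;> grind
    have hle : ∀ s r, 0 ≠ s → f s r ≤ if φ.labels + 1 = s then 1 else 0 := by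
      intro s r hs
      have h1 := φ.litNeg_le_one (3 * m + r)
      rw [hf]
      generalize φ.litNeg (3 * m + r) = n at *
      interval_cases n <;> grind
    have hzero : φ.plan val (φ.width * (m * (φ.labels + 1) + q) + 1) = 0 :=
      φ.plan_mul_add val hq hj
    have h4 : 4 ≤ φ.gain (φ.plan val) (φ.width * (m * (φ.labels + 1) + q) + 1) 0 := by
      obtain ⟨r, hr, h⟩ := hval
      have h1 : f 0 r = 1 := by
        have h1 := φ.litNeg_le_one (3 * m + r)
        rw [hf]
        generalize φ.litNeg (3 * m + r) = n at *
        interval_cases n <;> grind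
      have h2 := Finset.single_le_sum (fun r _ => hnonneg r) (Finset.mem_range.2 hr)
      rw [hgain, if_pos rfl, if_neg (by omega)]
      omega
    rw [StableAt, hzero]
    refine ⟨by omega, fun s => ?_⟩
    by_cases hs : 0 = s
    · rw [← hs]
    refine le_trans ?_ h4
    have h2 := Finset.sum_le_sum fun r (_ : r ∈ Finset.range 3) => hle s r hs
    rw [Finset.sum_const, Finset.card_range] at h2
    rw [hgain, if_neg hs]
    split_ifs at h2 ⊢ <;> simp at h2 <;> omega
  · simp [StableAt, φ.gain_chaser_of_phase_ne _ _ hcol (hphase.trans_ne hqt)]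

theorem stable_plan (hval : ∀ m < φ.clauses.length, ∃ r < 3,
    (φ.litNeg (3 * m + r) = 0 ↔ val (φ.litVar (3 * m + r)) = true)) : φ.Stable (φ.plan val) := by
  intro u hu
  by_cases hA : φ.col u = 0 ∨ 9 ≤ φ.col u
  · exact φ.stableAt_plan_line val hA
  have hL := φ.layer_lt hu
  have hq : φ.phase u ≤ φ.labels := Nat.lt_succ_iff.1 (Nat.mod_lt _ (Nat.succ_pos _))
  have hm : φ.layer u / (φ.labels + 1) < φ.clauses.length :=
    Nat.div_lt_of_lt_mul (by rwa [layers, mul_comm] at hL)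
  have hu' : φ.width * (φ.layer u / (φ.labels + 1) * (φ.labels + 1) + φ.phase u) + φ.col u = u := by
    rw [phase, Nat.div_add_mod', layer, col, Nat.div_add_mod]
  rw [← hu']
  by_cases hB : φ.col u = 1
  · rw [hB]
    exact φ.stableAt_plan_chaser val hq (hval _ hm)
  by_cases hC : φ.col u = 2
  · rw [hC]
    exact φ.stableAt_plan_runner val hq
  by_cases hD : φ.col u < 6
  · obtain ⟨r, hr⟩ := Nat.exists_eq_add_of_le (show 3 ≤ φ.col u by omega)
    rw [hr]
    exact φ.stableAt_plan_walker val hq (by omega)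
  · obtain ⟨r, hr⟩ := Nat.exists_eq_add_of_le (show 6 ≤ φ.col u by omega)
    rw [hr]
    exact φ.stableAt_plan_comparer val hq (by omega)

theorem hasNashStablePartition_iff : φ.game.HasNashStablePartition ↔ φ.Satisfiable := by
  constructor
  · intro h
    obtain ⟨c, hc⟩ := φ.exists_stable_of_hasNashStablePartition h
    exact hc.satisfiable
  · rintro ⟨a, ha⟩
    refine φ.hasNashStablePartition_of_stable
      (φ.stable_plan (fun v => if h : v < φ.n then a ⟨v, h⟩ else false) fun m hm => ?_)
    obtain ⟨r, hr⟩ := ha _ (List.getElem_mem hm)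
    refine ⟨r, r.2, ?_⟩
    have h2 := φ.getElem?_literals m r
    rw [List.getElem?_eq_getElem hm, Option.map_some] at h2
    simp only [litNeg, litVar, h2, Option.map_some, Option.getD_some, Fin.is_lt, dif_pos, Fin.eta,
      hr]
    cases (φ.clauses[m] r).2 <;> simp

end ThreeCNF

/-! ### The parameter and the running time -/

namespace ThreeCNF

variable (φ : ThreeCNF)

theorem lt_sq_labels : φ.n + 1 < φ.labels ^ 2 := by
  have h1 : φ.n + 1 < 4 ^ φ.bits := Nat.lt_pow_succ_log_self (by omega) _
  rw [labels, ← pow_mul, mul_comm, pow_mul]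
  exact h1

theorem sq_labels_le : φ.labels ^ 2 ≤ 4 * (φ.n + 1) := by
  have h1 : 4 ^ Nat.log 4 (φ.n + 1) ≤ φ.n + 1 := Nat.pow_log_le_self 4 (by omega)
  rw [labels, ← pow_mul, mul_comm, pow_mul, bits, pow_succ, show 2 ^ 2 = 4 from rfl]
  omega

/-- The number of labels is of order `√n` and the number of groups of order `n / log n`, so that
the width is of order `n / log n`. -/
theorem width_mul_bits_le : 48 * φ.width * (10 * φ.bits) ≤ 21600 * (φ.n + 1) := by
  have h1 := φ.sq_labels_le
  have h2 : φ.bits ≤ φ.labels := Nat.lt_two_pow_self.le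
  have h3 : φ.n / φ.bits * φ.bits ≤ φ.n := Nat.div_mul_le_self _ _
  have h4 := φ.labels_pos
  rw [width, groups]
  nlinarith

theorem width_add_two_le : 48 * φ.width + 2 ≤ 2 ^ (10 * φ.bits) := by
  have h1 := φ.lt_sq_labels
  have h2 : φ.n / φ.bits ≤ φ.n := Nat.div_le_self _ _
  have h3 : 2 ≤ φ.labels := Nat.le_self_pow φ.bits_pos.ne' 2
  have h4 : 48 * φ.width + 2 ≤ 2 ^ 8 * φ.labels ^ 2 := by
    rw [width, groups]
    nlinarith
  refine h4.trans ?_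
  rw [labels, ← pow_mul, ← pow_add]
  exact Nat.pow_le_pow_right (by omega) (by have := φ.bits_pos; omega)

end ThreeCNF

/-- If `f` is sublinear and `κ n * log (κ n + 2)` is at most linear in `n`, with `κ` unbounded, then
`(K + 2) ^ f K` is at most `2 ^ o(n)` for `K ≤ κ n`. -/
theorem exists_isLittleO_rpow_le {f : ℕ → ℝ} (hf : f =o[Filter.atTop] (fun k : ℕ => (k : ℝ)))
    {κ : ℕ → ℕ} {A : ℝ} (hκ : ∀ n, (κ n : ℝ) * Real.logb 2 (κ n + 2) ≤ A * (n + 1))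
    (hκ' : Filter.Tendsto κ Filter.atTop Filter.atTop) :
    ∃ g : ℕ → ℝ, g =o[Filter.atTop] (fun k : ℕ => (k : ℝ)) ∧ (∀ n, 0 ≤ g n) ∧
      ∀ n, ∀ K ≤ κ n, ((K : ℝ) + 2) ^ f K ≤ 2 ^ g n := by
  have hlog : ∀ K : ℕ, 0 ≤ Real.logb 2 (K + 2) := fun K =>
    Real.logb_nonneg one_lt_two (by linarith [K.cast_nonneg (α := ℝ)])
  have hlog' : ∀ K L : ℕ, K ≤ L → Real.logb 2 (K + 2) ≤ Real.logb 2 (L + 2) := fun K L h =>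
    Real.logb_le_logb_of_le one_lt_two (by positivity) (by
      have : (K : ℝ) ≤ L := by exact_mod_cast h
      linarith)
  let g : ℕ → ℝ := fun n => (Finset.range (κ n + 1)).sup' ⟨0, by simp⟩
    fun K => |f K| * Real.logb 2 (K + 2)
  have hg : ∀ n, ∀ K ≤ κ n, |f K| * Real.logb 2 (K + 2) ≤ g n := fun n K hK =>
    Finset.le_sup' (fun K : ℕ => |f K| * Real.logb 2 (K + 2)) (Finset.mem_range.2 (by omega))
  have hg0 : ∀ n, 0 ≤ g n := fun n =>
    (mul_nonneg (abs_nonneg _) (hlog 0)).trans (hg n 0 (Nat.zero_le _))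
  refine ⟨g, ?_, hg0, fun n K hK => ?_⟩
  · have hA : 0 ≤ A := by
      have := hκ 0
      have := mul_nonneg (Nat.cast_nonneg (α := ℝ) (κ 0)) (hlog (κ 0))
      push_cast at *
      linarith
    rw [Asymptotics.isLittleO_iff]
    intro ε hε
    -- `|f K| ≤ δ K + B` for all `K`, and `B ≤ δ κ n` for large `n`.
    set δ := ε / (4 * (A + 1)) with hδ
    have hδ0 : 0 < δ := by positivity
    obtain ⟨N, hN⟩ := Filter.eventually_atTop.1 (hf.bound hδ0)
    set B := ∑ K ∈ Finset.range N, |f K| with hB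
    have hfK : ∀ K : ℕ, |f K| ≤ δ * K + B := by
      intro K
      rcases lt_or_ge K N with h | h
      · have h1 := Finset.single_le_sum (fun K _ => abs_nonneg (f K)) (Finset.mem_range.2 h)
        have h2 : 0 ≤ δ * K := by positivity
        linarith
      · have h1 := hN K h
        have h2 : 0 ≤ B := Finset.sum_nonneg fun _ _ => abs_nonneg _
        rw [Real.norm_eq_abs, Real.norm_eq_abs, Nat.abs_cast] at h1
        linarith
    obtain ⟨k, hk⟩ := exists_nat_ge (B / δ)
    filter_upwards [hκ'.eventually_ge_atTop k, Filter.eventually_ge_atTop 1] with n h1 h2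
    rw [Real.norm_eq_abs, abs_of_nonneg (hg0 n), Real.norm_eq_abs, Nat.abs_cast]
    have h3 : B ≤ δ * κ n := by
      rw [div_le_iff₀ hδ0] at hk
      have : (k : ℝ) ≤ κ n := by exact_mod_cast h1
      nlinarith
    have h4 : (1 : ℝ) ≤ n := by exact_mod_cast h2
    refine Finset.sup'_le _ _ fun K hK => ?_
    have hK : K ≤ κ n := Nat.lt_succ_iff.1 (Finset.mem_range.1 hK)
    have hK' : (K : ℝ) ≤ κ n := by exact_mod_cast hK
    calc |f K| * Real.logb 2 (K + 2) ≤ (2 * δ * κ n) * Real.logb 2 (κ n + 2) := by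
          refine mul_le_mul ((hfK K).trans ?_) (hlog' K _ hK) (hlog K) (by positivity)
          nlinarith
      _ = 2 * δ * (κ n * Real.logb 2 (κ n + 2)) := by ring
      _ ≤ 2 * δ * (A * (n + 1)) := mul_le_mul_of_nonneg_left (hκ n) (by positivity)
      _ ≤ 2 * δ * ((A + 1) * (2 * n)) := by gcongr <;> linarith
      _ = ε * n := by rw [hδ]; field_simp; ring
  · have h1 : (0 : ℝ) < K + 2 := by positivity
    calc ((K : ℝ) + 2) ^ f K = 2 ^ (Real.logb 2 (K + 2) * f K) := by
          rw [Real.rpow_mul zero_le_two, Real.rpow_logb two_pos (by norm_num) h1]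
      _ ≤ 2 ^ g n := by
          refine Real.rpow_le_rpow_of_exponent_le one_le_two (le_trans ?_ (hg n K hK))
          rw [mul_comm]
          exact mul_le_mul_of_nonneg_right (le_abs_self _) (hlog K)

/-- The width of the game of a formula depends on the number of variables only. -/
theorem ThreeCNF.exists_width_eq :
    ∃ w b t : ℕ → ℕ, ∀ φ : ThreeCNF, φ.width = w φ.n ∧ φ.bits = b φ.n ∧ φ.labels = t φ.n :=
  ⟨fun n => (ThreeCNF.mk n []).width, fun n => (ThreeCNF.mk n []).bits,
    fun n => (ThreeCNF.mk n []).labels, fun _ => ⟨rfl, rfl, rfl⟩⟩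

/-- The factor of the running time that depends on the parameter is at most `2 ^ o(n)`. -/
theorem ThreeCNF.exists_isLittleO_param {f : ℕ → ℝ}
    (hf : f =o[Filter.atTop] (fun k : ℕ => (k : ℝ))) :
    ∃ g : ℕ → ℝ, g =o[Filter.atTop] (fun k : ℕ => (k : ℝ)) ∧ (∀ n, 0 ≤ g n) ∧
      ∀ φ : ThreeCNF, ((φ.toASHG.param : ℝ) + 2) ^ f φ.toASHG.param ≤ 2 ^ g φ.n := by
  obtain ⟨w, b, t, hwb⟩ := ThreeCNF.exists_width_eq
  have h1 : ∀ n, 48 * w n * (10 * b n) ≤ 21600 * (n + 1) := fun n => by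
    have := (ThreeCNF.mk n []).width_mul_bits_le
    rwa [(hwb _).1, (hwb _).2.1] at this
  have h2 : ∀ n, 48 * w n + 2 ≤ 2 ^ (10 * b n) := fun n => by
    have := (ThreeCNF.mk n []).width_add_two_le
    rwa [(hwb _).1, (hwb _).2.1] at this
  have h3 : ∀ n, n + 1 < t n ^ 2 := fun n => by
    have := (ThreeCNF.mk n []).lt_sq_labels
    rwa [(hwb _).2.2] at this
  have h4 : ∀ n, t n ≤ w n := fun n => by
    have : (ThreeCNF.mk n []).labels ≤ (ThreeCNF.mk n []).width := Nat.le_add_left _ _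
    rwa [(hwb _).1, (hwb _).2.2] at this
  have h5 : ∀ n, ((48 * w n : ℕ) : ℝ) * Real.logb 2 ((48 * w n : ℕ) + 2) ≤ 21600 * (n + 1) := by
    intro n
    have h5 : Real.logb 2 ((48 * w n : ℕ) + 2) ≤ (10 * b n : ℕ) := by
      rw [Real.logb_le_iff_le_rpow one_lt_two (by positivity), Real.rpow_natCast]
      exact_mod_cast h2 n
    calc ((48 * w n : ℕ) : ℝ) * Real.logb 2 ((48 * w n : ℕ) + 2)
        ≤ (48 * w n : ℕ) * (10 * b n : ℕ) := by gcongr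
      _ ≤ 21600 * (n + 1) := by exact_mod_cast h1 n
  have h6 : Filter.Tendsto (fun n => 48 * w n) Filter.atTop Filter.atTop := by
    rw [Filter.tendsto_atTop]
    intro k
    filter_upwards [Filter.eventually_ge_atTop (k ^ 2)] with n hn
    have h7 : k < t n := lt_of_pow_lt_pow_left₀ 2 (Nat.zero_le _)
      (hn.trans_lt ((Nat.lt_succ_self n).trans (h3 n)))
    have := h4 n
    omega
  obtain ⟨g, hg, hg0, hg1⟩ := exists_isLittleO_rpow_le hf h5 h6
  refine ⟨g, hg, hg0, fun φ => hg1 φ.n _ ?_⟩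
  rw [← (hwb φ).1]
  exact φ.param_le

theorem mainTheorem2 (hETH : SubexpETH) :
    ¬ ∃ (M : Turing.TM2ComputableAux Γ' Bool) (f : ℕ → ℝ) (C : ℕ),
      f =o[Filter.atTop] (fun k : ℕ => (k : ℝ)) ∧
      DecidesInTime M ASHGInstance.encode (fun I => I.game.HasNashStablePartition)
        fun I => C * ((I.param : ℝ) + 2) ^ f I.param *
          (((I.n : ℝ) + 2) * ((I.game.maxWeight : ℝ) + 2)) ^ C := by
  rintro ⟨M, f, C, hf, hM⟩
  obtain ⟨p, D, hp⟩ := ThreeCNF.exists_program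
  obtain ⟨g, hg, hg0, hparam⟩ := ThreeCNF.exists_isLittleO_param hf
  refine hETH ⟨p.andThen M, g, 2 ^ D + C * (24 * 2 ^ D) ^ C + (D + D * C), hg, fun φ => ?_⟩
  obtain ⟨hsize, n, hn, hrun⟩ := hp φ
  obtain ⟨b, t, hb, ht, hout⟩ := hM φ.toASHG
  refine ⟨b, n + t, hb.trans φ.hasNashStablePartition_iff, ?_, StackProg.outputsInTime_andThen hrun hout⟩
  beta_reduce at ht ⊢
  have hW : (φ.toASHG.game.maxWeight : ℝ) ≤ 6 := by exact_mod_cast φ.maxWeight_le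
  have hsize' : (φ.toASHG.n : ℝ) ≤ ((φ.encode.length : ℝ) + 2) ^ D := by exact_mod_cast hsize
  have hn' : (n : ℝ) ≤ ((φ.encode.length : ℝ) + 2) ^ D := by exact_mod_cast hn
  have hP := hparam φ
  have hG := Real.one_le_rpow one_le_two (hg0 φ.n)
  generalize φ.toASHG.game.maxWeight = W at *
  generalize φ.toASHG.n = N at *
  generalize ((φ.toASHG.param : ℝ) + 2) ^ f φ.toASHG.param = P at *
  generalize (2 : ℝ) ^ g φ.n = G at *
  set X : ℝ := (φ.encode.length : ℝ) + 1 with hX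
  have hX1 : 1 ≤ X := by simp [hX]
  have hXD : (1 : ℝ) ≤ X ^ D := one_le_pow₀ hX1
  have h2D : (1 : ℝ) ≤ 2 ^ D := one_le_pow₀ one_le_two
  have hX2 : ((φ.encode.length : ℝ) + 2) ^ D ≤ 2 ^ D * X ^ D := by
    rw [← mul_pow]
    gcongr
    linarith
  set E := 2 ^ D + C * (24 * 2 ^ D) ^ C + (D + D * C) with hE
  have hDE : D + D * C ≤ E := Nat.le_add_left _ _
  have hE' : (2 : ℝ) ^ D + C * (24 * 2 ^ D) ^ C ≤ (E : ℕ) := by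
    rw [hE]
    push_cast
    have : (0 : ℝ) ≤ D + D * C := by positivity
    linarith
  have h1 : ((N : ℝ) + 2) * (W + 2) ≤ 24 * 2 ^ D * X ^ D := by
    have h2 : (N : ℝ) + 2 ≤ 3 * (2 ^ D * X ^ D) := by nlinarith
    calc ((N : ℝ) + 2) * (W + 2) ≤ 3 * (2 ^ D * X ^ D) * 8 := by gcongr; linarith
      _ = _ := by ring
  have h0 : (0 : ℝ) ≤ X ^ E := by positivity
  calc ((n + t : ℕ) : ℝ) = n + t := by push_cast; rfl
    _ ≤ 2 ^ D * X ^ D + C * G * (24 * 2 ^ D * X ^ D) ^ C := by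
        gcongr
        · exact hn'.trans hX2
        · refine ht.trans ?_
          gcongr
    _ = 2 ^ D * X ^ D + C * G * (24 * 2 ^ D) ^ C * X ^ (D * C) := by
        rw [mul_pow _ (X ^ D), ← pow_mul]; ring
    _ ≤ 2 ^ D * X ^ E + C * G * (24 * 2 ^ D) ^ C * X ^ E := by
        gcongr
        · exact (Nat.le_add_right _ _).trans hDE
        · exact (Nat.le_add_left _ _).trans hDE
    _ ≤ 2 ^ D * (G * X ^ E) + C * G * (24 * 2 ^ D) ^ C * X ^ E := by
        gcongr
        nlinarith
    _ = ((2 : ℝ) ^ D + C * (24 * 2 ^ D) ^ C) * G * X ^ E := by ring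
    _ ≤ E * G * X ^ E := by gcongr
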